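/- Let $F$ be either $\mathbb R$ or a non-archimedean local field of characteristic zero, with normalized absolute value $|\cdot|$, and let $\psi$ be a non-trivial continuous unitary character of $F$. Let $\pi_1,\pi_2$ be irreducible admissible representations of $\mathrm{GL}_2(F)$ (irreducible admissible $(\mathfrak{gl}_2(\mathbb R),\mathrm O(2))$-modules if $F=\mathbb R$) whose central characters satisfy $\omega_{\pi_1}\omega_{\pi_2}=1$, and let $\mathcal W(\pi_i,\psi)$ be their $\psi$-Whittaker models (consisting, for $F=\mathbb R$, of functions of moderate growth); these are $0$ if $\pi_i$ is not generic. Let $V=M_2(F)$ with the quadratic form $\det$ and the bilinear form $(x,y)=\det(x+y)-\det x-\det y$. Let $\omega$ be the Weil representation of $\mathrm{Sp}_4(F)$ on Schwartz–Bruhat functions on $V^2$, given by $$\omega\begin{pmatrix}a&\\&{}^ta^{-1}\end{pmatrix}\varphi(x)=|\det a|^2\varphi(xa),\qquad \omega\begin{pmatrix}1&b\\&1\end{pmatrix}\varphi(x)=\psi\Big(\tfrac12\sum_{i,j}b_{ij}(x_j,x_i)\Big)\varphi(x),$$ $$\omega\begin{pmatrix}&1\\-1&\end{pmatrix}\varphi(x)=\int_{V^2}\varphi(y)\,\psi\Big(\sum_i(x_i,y_i)\Big)\,dy$$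 with $dy$ self-dual. Let $\mathrm{GSp}_4(F)$ be the group of $g$ with ${}^tgJg=\nu(g)J$, $J=\begin{pmatrix}&I_2\\-I_2&\end{pmatrix}$, and for $g\in\mathrm{GSp}_4(F)$ and $h_1,h_2\in \mathrm{GL}_2(F)$ with $\det h_1/\det h_2=\nu(g)$ put $$\omega(g,h_1,h_2)f=|\nu(g)|^{-2}\;\omega\Big(g\begin{pmatrix}I_2&\\&\nu(g)I_2\end{pmatrix}^{-1}\Big)\big(x\mapsto f(h_1^{-1}xh_2)\big).$$ Let $H_1(F)$ be the group of transformations $x\mapsto h_1xh_2^{-1}$ of $V$ with $\det h_1=\det h_2$, that is, the group of pairs $(h_1,h_2)\in\mathrm{GL}_2(F)^2$ with $\det h_1=\det h_2$ modulo the scalar pairs $(z,z)$, and let $\hat N(F)\subset H_1(F)$ be the subgroup of the classes of the pairs $\left(\begin{pmatrix}1&x\\&1\end{pmatrix},\begin{pmatrix}1&x\\&1\end{pmatrix}\right)$. Let $\epsilon=\begin{pmatrix}1&\\&-1\end{pmatrix}$. **Proposition.** For all $W_i\in\mathcal W(\pi_i,\psi)$ ($i=1,2$), every Schwartz–Bruhat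 function $f$ on $V^2=M_2(F)^2$ (in particular every $K$-finite one), and every $g\in\mathrm{GSp}_4(F)$, the integral $$\mathbb W(W_1,W_2;f)(g)=\int_{\hat N(F)\backslash H_1(F)}W_1\Big(\epsilon h_1\begin{pmatrix}\nu(g)&\\&1\end{pmatrix}\Big)W_2(h_2)\;\omega\Big(g,h_1\begin{pmatrix}\nu(g)&\\&1\end{pmatrix},h_2\Big)f\left(\begin{pmatrix}0&-1\\0&0\end{pmatrix},I_2\right)d(h_1,h_2)$$ with respect to a right $H_1(F)$-invariant Radon measure is well defined (the integrand is left $\hat N(F)$-invariant and depends only on the class of $(h_1,h_2)$ in $H_1(F)$) and converges absolutely. -/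

import Mathlib

open MeasureTheory Matrix
open scoped Topology SchwartzMap

noncomputable section

namespace ThetaWhittaker

universe u v

/-! ### Elements of `GL₂(F)` -/

section GLTwo

variable {F : Type u} [Field F]

/-- The upper triangular unipotent matrix `[1, x; 0, 1]`. -/
def unip (x : F) : GL (Fin 2) F where
  val := !![1, x; 0, 1]
  inv := !![1, -x; 0, 1]
  val_inv := by ext i j; fin_cases i <;> fin_cases j <;> simp
  inv_val := by ext i j; fin_cases i <;> fin_cases j <;> simp

/-- The diagonal matrix `[a, 0; 0, b]`. -/
def diag (a b : Fˣ) : GL (Fin 2) F where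
  val := !![(a : F), 0; 0, (b : F)]
  inv := !![((a⁻¹ : Fˣ) : F), 0; 0, ((b⁻¹ : Fˣ) : F)]
  val_inv := by ext i j; fin_cases i <;> fin_cases j <;> simp
  inv_val := by ext i j; fin_cases i <;> fin_cases j <;> simp

/-- `ε = [1, 0; 0, -1]`. -/
def eps : GL (Fin 2) F := diag 1 (-1)

end GLTwo

/-! ### The group `H₁` and the space `N̂ \ H₁` -/

section Quotient

variable (F : Type u) [Field F]

/-- Pairs `(h₁, h₂)` in `GL₂(F) × GL₂(F)` with `det h₁ = det h₂`.  Such a pair acts on `M₂(F)` by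
`x ↦ h₁ x h₂⁻¹`; the group `H₁(F)` of these transformations is the quotient of the group of pairs
by the scalar pairs `(z, z)`. -/
def DetPairs : Subgroup (GL (Fin 2) F × GL (Fin 2) F) where
  carrier := {h | GeneralLinearGroup.det h.1 = GeneralLinearGroup.det h.2}
  one_mem' := by simp
  mul_mem' := by
    intro a b ha hb
    simp only [Set.mem_ofPred_eq, Prod.fst_mul, Prod.snd_mul, map_mul] at *
    rw [ha, hb]
  inv_mem' := by
    intro a ha
    simp only [Set.mem_ofPred_eq, Prod.fst_inv, Prod.snd_inv, map_inv] at *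
    rw [ha]

/-- The inverse image of `N̂(F) = {(n(x), n(x))}` in the group of pairs: all `(z n(x), z n(x))`
with `z` a scalar. -/
def NHat : Subgroup (DetPairs F) where
  carrier := {h | ∃ (z : Fˣ) (x : F), h.1 = (diag z z * unip x, diag z z * unip x)}
  one_mem' := by
    refine ⟨1, 0, ?_⟩
    have : (1 : GL (Fin 2) F) = diag 1 1 * unip 0 := by
      ext i j; fin_cases i <;> fin_cases j <;> simp [diag, unip]
    rw [← this]; rfl
  mul_mem' := by
    rintro a b ⟨z, x, hz⟩ ⟨w, y, hw⟩
    refine ⟨z * w, x + y, ?_⟩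
    have : (diag z z * unip x) * (diag w w * unip y) = diag (z * w) (z * w) * unip (x + y) := by
      ext i j
      fin_cases i <;> fin_cases j <;> simp [diag, unip, Matrix.mul_apply, Fin.sum_univ_two] <;> ring
    rw [Subgroup.coe_mul, hz, hw, Prod.mk_mul_mk, this]
  inv_mem' := by
    rintro a ⟨z, x, hz⟩
    refine ⟨z⁻¹, -x, ?_⟩
    have : (diag z z * unip x)⁻¹ = diag z⁻¹ z⁻¹ * unip (-x) := by
      rw [inv_eq_iff_mul_eq_one]
      ext i j
      fin_cases i <;> fin_cases j <;>
        simp [diag, unip, Matrix.mul_apply, Fin.sum_univ_two, mul_comm, mul_left_comm]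
    rw [Subgroup.coe_inv, hz, Prod.inv_mk, this]

/-- The space of orbits `N̂(F) \ H₁(F)` (left multiplication by `N̂`). -/
def NHatQuot : Type u := Quotient (QuotientGroup.rightRel (NHat F))

/-- The projection `H₁(F) → N̂(F) \ H₁(F)`. -/
def NHatQuot.mk (h : DetPairs F) : NHatQuot F :=
  Quotient.mk (QuotientGroup.rightRel (NHat F)) h

/-- Right translation by `k` on `N̂(F) \ H₁(F)`. -/
def NHatQuot.rightMul (k : DetPairs F) : NHatQuot F → NHatQuot F :=
  Quotient.map (fun h => h * k) (by
    intro a b hab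
    have hab' : QuotientGroup.rightRel (NHat F) a b := hab
    change QuotientGroup.rightRel (NHat F) (a * k) (b * k)
    rw [QuotientGroup.rightRel_apply] at hab' ⊢
    simpa [mul_assoc] using hab')

variable [TopologicalSpace F]

instance : TopologicalSpace (NHatQuot F) :=
  inferInstanceAs (TopologicalSpace (Quotient (QuotientGroup.rightRel (NHat F))))

instance : MeasurableSpace (NHatQuot F) := borel _

instance : BorelSpace (NHatQuot F) := ⟨rfl⟩

variable {F}

/-- `μ` is a right `H₁(F)`-invariant measure on `N̂(F) \ H₁(F)`, finite on compact sets. -/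
structure IsInvariantMeasure (μ : Measure (NHatQuot F)) : Prop where
  finite_on_compacts : ∀ C : Set (NHatQuot F), IsCompact C → μ C < ⊤
  invariant : ∀ (k : DetPairs F) (A : Set (NHatQuot F)), MeasurableSet A →
    μ (NHatQuot.rightMul F k ⁻¹' A) = μ A

/-- The integral over `N̂(F) \ H₁(F)` of the expression `Φ(h)` is well defined (the expression is
invariant under left translation by `N̂(F)`) and absolutely convergent. -/
def ConvergesAbsolutely (μ : Measure (NHatQuot F)) (Φ : DetPairs F → ℂ) : Prop :=
  ∃ Φ' : NHatQuot F → ℂ, (∀ h, Φ' (NHatQuot.mk F h) = Φ h) ∧ Integrable Φ' μ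

end Quotient

/-! ### The quadratic space and the Weil representation -/

/-- The alternating form `J = [0, 1; -1, 0]`. -/
def sympJ (F : Type u) [Field F] : Matrix (Fin 2 ⊕ Fin 2) (Fin 2 ⊕ Fin 2) F :=
  fromBlocks 0 1 (-1) 0

/-- For `(A, C)` the left half of a symplectic matrix with `C` singular, some `A + S C` with `S`
symmetric is invertible. -/
theorem exists_symm_isUnit {F : Type u} [Field F] (A B C D : Matrix (Fin 2) (Fin 2) F)
    (h1 : Aᵀ * C = Cᵀ * A) (h2 : Aᵀ * D - Cᵀ * B = 1) (hC : C.det = 0) :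
    ∃ S : Matrix (Fin 2) (Fin 2) F, Sᵀ = S ∧ IsUnit (A + S * C).det := by
  by_contra hcon
  push Not at hcon
  have s0 := hcon 0 (by simp)
  have s1 := hcon !![1, 0; 0, 0] (by ext i j; fin_cases i <;> fin_cases j <;> simp)
  have s2 := hcon !![0, 0; 0, 1] (by ext i j; fin_cases i <;> fin_cases j <;> simp)
  have g1 := congrFun (congrFun h1 0) 1
  have k00 := congrFun (congrFun h2 0) 0
  have k01 := congrFun (congrFun h2 0) 1
  have k10 := congrFun (congrFun h2 1) 0
  have k11 := congrFun (congrFun h2 1) 1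
  simp only [isUnit_iff_ne_zero, ne_eq, not_not, det_fin_two, Matrix.add_apply, Matrix.sub_apply,
    Matrix.mul_apply, Fin.sum_univ_two, transpose_apply, Matrix.of_apply,
    cons_val', cons_val_zero, cons_val_one, cons_val_fin_one, zero_mul, one_mul, add_zero, zero_add,
    Matrix.one_apply, Fin.isValue, one_ne_zero, zero_ne_one, if_true, if_false] at s0 s1 s2 g1 k00 k01 k10 k11 hC
  have m1 : C 0 0 * A 1 1 - C 0 1 * A 1 0 = 0 := by linear_combination s1 - s0
  have m2 : A 0 0 * C 1 1 - A 0 1 * C 1 0 = 0 := by linear_combination s2 - s0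
  have m3 : A 1 0 * C 1 1 - A 1 1 * C 1 0 = -(A 0 0 * C 0 1 - A 0 1 * C 0 0) := by
    linear_combination g1
  have m4 : A 0 0 * C 0 1 - A 0 1 * C 0 0 = 0 := by
    have : (A 0 0 * C 0 1 - A 0 1 * C 0 0) ^ 2 = 0 := by
      grind
    simpa using this
  have m5 : A 1 0 * C 1 1 - A 1 1 * C 1 0 = 0 := by rw [m3, m4, neg_zero]
  have : (1 : F) = 0 := by
    have e : (1 : F) = (A 0 0 * D 0 0 + A 1 0 * D 1 0 - (C 0 0 * B 0 0 + C 1 0 * B 1 0)) *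
        (A 0 1 * D 0 1 + A 1 1 * D 1 1 - (C 0 1 * B 0 1 + C 1 1 * B 1 1)) -
        (A 0 0 * D 0 1 + A 1 0 * D 1 1 - (C 0 0 * B 0 1 + C 1 0 * B 1 1)) *
        (A 0 1 * D 0 0 + A 1 1 * D 1 0 - (C 0 1 * B 0 0 + C 1 1 * B 1 0)) := by
      rw [k00, k01, k10, k11]; ring
    rw [e]
    linear_combination (D 0 0 * D 1 1 - D 0 1 * D 1 0) * s0 + (B 0 0 * B 1 1 - B 0 1 * B 1 0) * hC
      + (-(D 0 0 * B 0 1 - D 0 1 * B 0 0)) * m4 + (-(D 1 0 * B 1 1 - D 1 1 * B 1 0)) * m5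
      + (-(D 0 0 * B 1 1 - D 0 1 * B 1 0)) * m2 + (D 1 0 * B 0 1 - D 1 1 * B 0 0) * m1
  exact one_ne_zero this

section Weil

/-- `V² = M₂(F)²`. -/
abbrev VSq (F : Type u) : Type u := Fin 2 → Matrix (Fin 2) (Fin 2) F

instance (F : Type u) [TopologicalSpace F] : MeasurableSpace (VSq F) := borel _

instance (F : Type u) [TopologicalSpace F] : BorelSpace (VSq F) := ⟨rfl⟩

variable {F : Type u} [Field F]

/-- The symmetric bilinear form on `M₂(F)` with `(x, x) = 2 det x`. -/
def form (x y : Matrix (Fin 2) (Fin 2) F) : F := (x + y).det - x.det - y.det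

/-- `x a = (x₁, x₂) (aᵢⱼ)`. -/
def rightAct (x : VSq F) (a : Matrix (Fin 2) (Fin 2) F) : VSq F := fun j => ∑ i, a i j • x i

variable [TopologicalSpace F]

/-- The Fourier transform `∫ φ(y) ψ(tr (x, y)) dy` on `V²`. -/
def fourier (ψ : AddChar F Circle) (m : Measure (VSq F)) (φ : VSq F → ℂ) : VSq F → ℂ :=
  fun x => ∫ y, φ y * (ψ (∑ i, form (x i) (y i)) : ℂ) ∂m

/-- `m` is the Haar measure on `V²` that is self-dual for the pairing `ψ(tr (x, y))`: Fourier
inversion holds. -/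
structure IsSelfDual (ψ : AddChar F Circle) (m : Measure (VSq F)) : Prop where
  haar : m.IsAddHaarMeasure
  inversion : ∀ φ : VSq F → ℂ, Continuous φ → Integrable φ m → Integrable (fourier ψ m φ) m →
    ∀ x, fourier ψ m (fourier ψ m φ) x = φ (-x)

variable [IsTopologicalRing F] [LocallyCompactSpace F]

/-- The normalized absolute value on `Fˣ`: the factor by which multiplication by `a` scales the
Haar measure of `F`. -/
def absF (a : Fˣ) : ℝ := (distribHaarChar F a : ℝ)

/-- The operators of the Weil representation of `Sp₄(F)` attached to the split quadratic space
`M₂(F)`, given on the generators `diag(a, ᵗa⁻¹)`, `[1, b; 0, 1]` and `[0, 1; -1, 0]` and extended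
to products.  (For this space the constant in front of the Fourier transform is `1`.) -/
inductive IsWeilOperator (ψ : AddChar F Circle) (m : Measure (VSq F)) :
    Matrix (Fin 2 ⊕ Fin 2) (Fin 2 ⊕ Fin 2) F → ((VSq F → ℂ) → (VSq F → ℂ)) → Prop
  | levi (a : GL (Fin 2) F) :
      IsWeilOperator ψ m
        (fromBlocks (a : Matrix (Fin 2) (Fin 2) F) 0 0
          ((a⁻¹ : GL (Fin 2) F) : Matrix (Fin 2) (Fin 2) F)ᵀ)
        (fun φ x => ((absF (GeneralLinearGroup.det a) ^ 2 : ℝ) : ℂ) *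
          φ (rightAct x (a : Matrix (Fin 2) (Fin 2) F)))
  | siegel (b : Matrix (Fin 2) (Fin 2) F) (hb : bᵀ = b) :
      IsWeilOperator ψ m (fromBlocks 1 b 0 1)
        (fun φ x => (ψ (2⁻¹ * ∑ i, ∑ j, b i j * form (x j) (x i)) : ℂ) * φ x)
  | weyl : IsWeilOperator ψ m (fromBlocks 0 1 (-1) 0) (fourier ψ m)
  | comp {s t : Matrix (Fin 2 ⊕ Fin 2) (Fin 2 ⊕ Fin 2) F}
      {S T : (VSq F → ℂ) → (VSq F → ℂ)} :
      IsWeilOperator ψ m s S → IsWeilOperator ψ m t T → IsWeilOperator ψ m (s * t) (S ∘ T)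

/-- If the lower left block of a symplectic matrix is invertible, it is a product of generators. -/
theorem exists_isWeilOperator_of_isUnit (ψ : AddChar F Circle) (m : Measure (VSq F))
    (A B C D : Matrix (Fin 2) (Fin 2) F)
    (hs : (fromBlocks A B C D)ᵀ * sympJ F * fromBlocks A B C D = sympJ F) (hC : IsUnit C.det) :
    ∃ T, IsWeilOperator ψ m (fromBlocks A B C D) T := by
  have hJJ : sympJ F * sympJ F = -1 := by
    simp [sympJ, fromBlocks_multiply, ← fromBlocks_one, fromBlocks_neg]
  have hs' : fromBlocks A B C D * sympJ F * (fromBlocks A B C D)ᵀ = sympJ F := by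
    have h1 : (-(sympJ F * (fromBlocks A B C D)ᵀ * sympJ F)) * fromBlocks A B C D = 1 := by
      rw [Matrix.neg_mul, Matrix.mul_assoc (sympJ F), Matrix.mul_assoc (sympJ F), hs, hJJ, neg_neg]
    have h2 := mul_eq_one_comm.mp h1
    have h3 : fromBlocks A B C D * sympJ F * (fromBlocks A B C D)ᵀ * (sympJ F * sympJ F)
        = sympJ F * (sympJ F * sympJ F) * (-1) * (-1) := by
      have : fromBlocks A B C D * sympJ F * (fromBlocks A B C D)ᵀ * (sympJ F * sympJ F)
          = -(fromBlocks A B C D * -(sympJ F * (fromBlocks A B C D)ᵀ * sympJ F)) * sympJ F := by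
        simp [Matrix.mul_assoc]
      rw [this, h2, hJJ]; simp
    rw [hJJ] at h3
    simpa using h3
  simp only [sympJ, fromBlocks_transpose, fromBlocks_multiply, Matrix.mul_zero, Matrix.mul_one,
    Matrix.mul_neg, zero_add, add_zero, Matrix.neg_mul, fromBlocks_inj] at hs hs'
  obtain ⟨h11, h12, -, -⟩ := hs
  obtain ⟨-, -, -, k22⟩ := hs'
  have e1 : Aᵀ * C = Cᵀ * A := by rw [← sub_eq_zero, ← h11]; abel
  have e2 : Cᵀ * B = Aᵀ * D - 1 := by rw [← h12]; abel
  have e3 : C * Dᵀ = D * Cᵀ := by rw [← sub_eq_zero, ← k22]; abel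
  have hCt : IsUnit Cᵀ.det := by rwa [det_transpose]
  have c1 : C * C⁻¹ = 1 := mul_nonsing_inv C hC
  have c2 : C⁻¹ * C = 1 := nonsing_inv_mul C hC
  have c3 : Cᵀ * C⁻¹ᵀ = 1 := by rw [← transpose_mul, c2, transpose_one]
  have c4 : C⁻¹ᵀ * Cᵀ = 1 := by rw [← transpose_mul, c1, transpose_one]
  have symX : (A * C⁻¹)ᵀ = A * C⁻¹ := by
    rw [transpose_mul]
    calc C⁻¹ᵀ * Aᵀ = C⁻¹ᵀ * (Aᵀ * C) * C⁻¹ := by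
          rw [Matrix.mul_assoc, Matrix.mul_assoc, c1, Matrix.mul_one]
      _ = A * C⁻¹ := by rw [e1, ← Matrix.mul_assoc, c4, Matrix.one_mul]
  have symb : (C⁻¹ * D)ᵀ = C⁻¹ * D := by
    rw [transpose_mul]
    calc Dᵀ * C⁻¹ᵀ = C⁻¹ * (C * Dᵀ) * C⁻¹ᵀ := by
          rw [← Matrix.mul_assoc, c2, Matrix.one_mul]
      _ = C⁻¹ * D := by rw [e3, Matrix.mul_assoc, Matrix.mul_assoc, c3, Matrix.mul_one]
  let a : GL (Fin 2) F := ⟨-C, -C⁻¹, by simp [c1], by simp [c2]⟩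
  have hB : B = A * C⁻¹ * D - C⁻¹ᵀ := by
    calc B = C⁻¹ᵀ * (Cᵀ * B) := by rw [← Matrix.mul_assoc, c4, Matrix.one_mul]
      _ = C⁻¹ᵀ * (Aᵀ * D - 1) := by rw [e2]
      _ = (A * C⁻¹)ᵀ * D - C⁻¹ᵀ := by
        rw [Matrix.mul_sub, Matrix.mul_one, transpose_mul, Matrix.mul_assoc]
      _ = _ := by rw [symX]
  have key : fromBlocks A B C D = fromBlocks 1 (A * C⁻¹) 0 1 * (fromBlocks 0 1 (-1) 0 *
      (fromBlocks (a : Matrix (Fin 2) (Fin 2) F) 0 0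
        ((a⁻¹ : GL (Fin 2) F) : Matrix (Fin 2) (Fin 2) F)ᵀ * fromBlocks 1 (C⁻¹ * D) 0 1)) := by
    have ha : (a : Matrix (Fin 2) (Fin 2) F) = -C := rfl
    have ha' : ((a⁻¹ : GL (Fin 2) F) : Matrix (Fin 2) (Fin 2) F) = -C⁻¹ := rfl
    rw [ha, ha']
    simp only [fromBlocks_multiply, Matrix.mul_zero, Matrix.mul_one, Matrix.one_mul,
      Matrix.zero_mul, add_zero, zero_add, Matrix.neg_mul, neg_neg, transpose_neg, neg_zero]
    rw [fromBlocks_inj]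
    refine ⟨?_, ?_, rfl, ?_⟩
    · rw [Matrix.mul_assoc, c2, Matrix.mul_one]
    · rw [← Matrix.mul_assoc C, c1, Matrix.one_mul, hB]; abel
    · rw [← Matrix.mul_assoc, c1, Matrix.one_mul]
  rw [key]
  exact ⟨_, .comp (.siegel _ symX) (.comp .weyl (.comp (.levi a) (.siegel _ symb)))⟩

/-- Every element of `Sp₄(F)` is a product of generators. -/
theorem exists_isWeilOperator (ψ : AddChar F Circle) (m : Measure (VSq F))
    (s : Matrix (Fin 2 ⊕ Fin 2) (Fin 2 ⊕ Fin 2) F) (hs : sᵀ * sympJ F * s = sympJ F) :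
    ∃ T, IsWeilOperator ψ m s T := by
  obtain ⟨A, B, C, D, rfl⟩ : ∃ A B C D, s = fromBlocks A B C D :=
    ⟨_, _, _, _, (fromBlocks_toBlocks s).symm⟩
  by_cases hC : C.det = 0
  · have hb := hs
    simp only [sympJ, fromBlocks_transpose, fromBlocks_multiply, Matrix.mul_zero, Matrix.mul_one,
      Matrix.mul_neg, zero_add, add_zero, Matrix.neg_mul, fromBlocks_inj] at hb
    obtain ⟨h11, h12, -, -⟩ := hb
    obtain ⟨S, hS, hU⟩ := exists_symm_isUnit A B C D
      (by rw [← sub_eq_zero, ← h11]; abel) (by rw [← h12]; abel) hC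
    have hJ : (sympJ F)ᵀ * sympJ F * sympJ F = sympJ F := by
      simp [sympJ, fromBlocks_transpose, fromBlocks_multiply]
    have hN : (fromBlocks 1 S 0 1)ᵀ * sympJ F * fromBlocks 1 S 0 1 = sympJ F := by
      simp [sympJ, fromBlocks_transpose, fromBlocks_multiply, hS]
    have hs' : (sympJ F * (fromBlocks 1 S 0 1 * fromBlocks A B C D))ᵀ * sympJ F *
        (sympJ F * (fromBlocks 1 S 0 1 * fromBlocks A B C D)) = sympJ F := by
      calc _ = (fromBlocks A B C D)ᵀ * ((fromBlocks 1 S 0 1)ᵀ *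
            ((sympJ F)ᵀ * sympJ F * sympJ F) * fromBlocks 1 S 0 1) * fromBlocks A B C D := by
            simp only [transpose_mul, Matrix.mul_assoc]
        _ = sympJ F := by rw [hJ, hN, hs]
    have hform : sympJ F * (fromBlocks 1 S 0 1 * fromBlocks A B C D) =
        fromBlocks C D (-(A + S * C)) (-(B + S * D)) := by
      simp [sympJ, fromBlocks_multiply]
    rw [hform] at hs'
    obtain ⟨T, hT⟩ := exists_isWeilOperator_of_isUnit ψ m _ _ _ _ hs'
      (by rw [det_neg]; simpa using hU)
    rw [← hform] at hT
    have key : fromBlocks A B C D = fromBlocks 1 (-S) 0 1 * (fromBlocks 0 1 (-1) 0 *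
        (fromBlocks 0 1 (-1) 0 * (fromBlocks 0 1 (-1) 0 *
          (sympJ F * (fromBlocks 1 S 0 1 * fromBlocks A B C D))))) := by
      simp [sympJ, fromBlocks_multiply]
    rw [key]
    exact ⟨_, .comp (.siegel _ (by simp [hS])) (.comp .weyl (.comp .weyl (.comp .weyl hT)))⟩
  · exact exists_isWeilOperator_of_isUnit ψ m A B C D hs (isUnit_iff_ne_zero.mpr hC)

open Classical in
/-- `ω(s)` for `s ∈ Sp₄(F)`: the operator obtained by writing `s` as a product of the generators.
When `m` is self-dual, its effect on Schwartz-Bruhat functions does not depend on how `s` is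
written, because the formulas on generators define a representation. -/
def weilOp (ψ : AddChar F Circle) (m : Measure (VSq F))
    (s : Matrix (Fin 2 ⊕ Fin 2) (Fin 2 ⊕ Fin 2) F) : (VSq F → ℂ) → (VSq F → ℂ) :=
  if h : ∃ T, IsWeilOperator ψ m s T then h.choose else id

theorem weilOp_spec (ψ : AddChar F Circle) (m : Measure (VSq F))
    (s : Matrix (Fin 2 ⊕ Fin 2) (Fin 2 ⊕ Fin 2) F) (hs : sᵀ * sympJ F * s = sympJ F) :
    IsWeilOperator ψ m s (weilOp ψ m s) := by
  have h := exists_isWeilOperator ψ m s hs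
  rw [weilOp, dif_pos h]
  exact h.choose_spec

end Weil

section GSp

variable (F : Type u) [Field F]

/-- `GSp₄(F)`: matrices `g` with `ᵗg J g = ν(g) J`, `ν(g) ∈ Fˣ`. -/
structure GSp4 where
  mat : Matrix (Fin 2 ⊕ Fin 2) (Fin 2 ⊕ Fin 2) F
  nu : Fˣ
  similitude : matᵀ * sympJ F * mat = (nu : F) • sympJ F

variable {F}

/-- `g · diag(1, 1, ν(g), ν(g))⁻¹ ∈ Sp₄(F)`. -/
def GSp4.toSp (g : GSp4 F) : Matrix (Fin 2 ⊕ Fin 2) (Fin 2 ⊕ Fin 2) F :=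
  g.mat * fromBlocks 1 0 0 ((g.nu : F)⁻¹ • 1)

theorem GSp4.toSp_mem (g : GSp4 F) : g.toSpᵀ * sympJ F * g.toSp = sympJ F := by
  have hd : (fromBlocks 1 0 0 ((g.nu : F)⁻¹ • 1) :
      Matrix (Fin 2 ⊕ Fin 2) (Fin 2 ⊕ Fin 2) F)ᵀ * sympJ F *
      fromBlocks 1 0 0 ((g.nu : F)⁻¹ • 1) = (g.nu : F)⁻¹ • sympJ F := by
    simp [sympJ, fromBlocks_transpose, fromBlocks_multiply, fromBlocks_smul]
  calc _ = (fromBlocks 1 0 0 ((g.nu : F)⁻¹ • 1))ᵀ * (g.matᵀ * sympJ F * g.mat) *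
        fromBlocks 1 0 0 ((g.nu : F)⁻¹ • 1) := by
        simp only [GSp4.toSp, transpose_mul, Matrix.mul_assoc]
    _ = sympJ F := by
        rw [g.similitude, Matrix.mul_smul, Matrix.smul_mul, hd, smul_smul,
          mul_inv_cancel₀ g.nu.ne_zero, one_smul]

/-- The action `x ↦ h₁⁻¹ x h₂` of `(h₁, h₂)⁻¹` on `V²`. -/
def invAct (h₁ h₂ : GL (Fin 2) F) (x : VSq F) : VSq F := fun i =>
  ((h₁⁻¹ : GL (Fin 2) F) : Matrix (Fin 2) (Fin 2) F) * x i * (h₂ : Matrix (Fin 2) (Fin 2) F)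

variable [TopologicalSpace F] [IsTopologicalRing F] [LocallyCompactSpace F]

/-- The extended Weil representation, for `ν(g) = ν(h) = det h₁ / det h₂`:
`ω(g, h₁, h₂) f = |ν(g)|⁻² ω(g diag(1, ν(g))⁻¹) (f ∘ (h₁, h₂)⁻¹)`. -/
def extWeil (ψ : AddChar F Circle) (m : Measure (VSq F)) (g : GSp4 F) (h₁ h₂ : GL (Fin 2) F)
    (f : VSq F → ℂ) : VSq F → ℂ :=
  fun x => (((absF g.nu ^ 2)⁻¹ : ℝ) : ℂ) * weilOp ψ m g.toSp (fun y => f (invAct h₁ h₂ y)) x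

/-- The integrand of `𝕎(W₁, W₂; f)(g)`, as a function of `h = (h₁, h₂)`. -/
def integrand (ψ : AddChar F Circle) (m : Measure (VSq F)) (W₁ W₂ : GL (Fin 2) F → ℂ)
    (f : VSq F → ℂ) (g : GSp4 F) (h : DetPairs F) : ℂ :=
  W₁ (eps * h.1.1 * diag g.nu 1) * W₂ h.1.2 *
    extWeil ψ m g (h.1.1 * diag g.nu 1) h.1.2 f ![!![0, -1; 0, 0], 1]

end GSp

/-! ### Schwartz-Bruhat functions -/

/-- Schwartz-Bruhat functions on `V²`, non-archimedean case. -/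
def IsSchwartzBruhat {F : Type u} [TopologicalSpace F] [Zero F] (f : VSq F → ℂ) : Prop :=
  IsLocallyConstant f ∧ HasCompactSupport f

/-- Schwartz functions on `V²`, real case. -/
def IsRealSchwartz (f : VSq ℝ → ℂ) : Prop :=
  ∃ φ : 𝓢(Fin 2 → Fin 2 → Fin 2 → ℝ, ℂ), ∀ x : VSq ℝ, f x = φ (fun i j k => x i j k)

/-! ### Non-archimedean representations and Whittaker models -/

section NonArch

variable {F : Type u} [Field F] [TopologicalSpace F]
variable {E : Type v} [AddCommGroup E] [Module ℂ E]

/-- Irreducible admissible representations of `GL₂(F)`. -/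
structure IsIrredAdmissible (π : Representation ℂ (GL (Fin 2) F) E) : Prop where
  smooth : ∀ e : E, IsOpen {g : GL (Fin 2) F | π g e = e}
  admissible : ∀ U : Subgroup (GL (Fin 2) F), IsOpen (U : Set (GL (Fin 2) F)) →
    ∃ B : Submodule ℂ E, FiniteDimensional ℂ B ∧ ∀ e : E, (∀ g ∈ U, π g e = e) → e ∈ B
  irreducible : π.IsIrreducible

/-- `ω` is the central character of `π`. -/
def HasCentralChar (π : Representation ℂ (GL (Fin 2) F) E) (ω : Fˣ →* ℂˣ) : Prop :=
  ∀ (z : Fˣ) (e : E), π (diag z z) e = (ω z : ℂ) • e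

/-- The Whittaker model `𝒲(π, ψ)`: the functions `g ↦ l(π(g) e)`, with `l` a `ψ`-Whittaker
functional on `π`. -/
def whittakerModel (π : Representation ℂ (GL (Fin 2) F) E) (ψ : AddChar F Circle) :
    Set (GL (Fin 2) F → ℂ) :=
  {W | ∃ l : E →ₗ[ℂ] ℂ, (∀ (x : F) (e : E), l (π (unip x) e) = (ψ x : ℂ) * l e) ∧
    ∃ e : E, ∀ g, W g = l (π g e)}

end NonArch

/-! ### Real representations and Whittaker models -/

section Arch

/-- The maximal compact subgroup `K = O(2)` of `GL₂(ℝ)`. -/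
abbrev O2 : Type := Matrix.orthogonalGroup (Fin 2) ℝ

/-- `𝔤 = 𝔤𝔩₂(ℝ)`. -/
abbrev gl2 : Type := Matrix (Fin 2) (Fin 2) ℝ

/-- `exp(tX)` as an element of `GL₂(ℝ)`. -/
def expGL (X : gl2) (t : ℝ) : GL (Fin 2) ℝ := (Matrix.isUnit_exp (t • X)).unit

/-- A `(𝔤, K)`-module for `GL₂(ℝ)` on the complex vector space `E`. -/
structure GKModule (E : Type v) [AddCommGroup E] [Module ℂ E] where
  lie : gl2 → Module.End ℂ E
  rep : Representation ℂ O2 E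
  lie_add : ∀ X Y, lie (X + Y) = lie X + lie Y
  lie_smul : ∀ (r : ℝ) X, lie (r • X) = (r : ℂ) • lie X
  lie_bracket : ∀ X Y, lie (X * Y - Y * X) = lie X * lie Y - lie Y * lie X
  locally_finite : ∀ e : E, FiniteDimensional ℂ (Submodule.span ℂ (Set.range fun k => rep k e))
  continuous : ∀ (e : E) (l : E →ₗ[ℂ] ℂ), Continuous fun k => l (rep k e)
  differential : ∀ X : gl2, Xᵀ = -X → ∀ c : ℝ → O2,
    (∀ t, (c t : gl2) = NormedSpace.exp (t • X)) →
    ∀ (e : E) (l : E →ₗ[ℂ] ℂ), HasDerivAt (fun t => l (rep (c t) e)) (l (lie X e)) 0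
  adjoint : ∀ (k : O2) (X : gl2) (e : E),
    rep k (lie X e) = lie ((k : gl2) * X * (k : gl2)ᵀ) (rep k e)

namespace GKModule

variable {E : Type v} [AddCommGroup E] [Module ℂ E]

/-- Irreducible admissible `(𝔤, K)`-modules: every irreducible representation of `K` occurs with
finite multiplicity, and there is no proper non-zero submodule. -/
structure IsIrredAdmissible (π : GKModule E) : Prop where
  admissible : ∀ (n : ℕ) (τ : Representation ℂ O2 (Fin n → ℂ)), τ.IsIrreducible →
    FiniteDimensional ℂ (τ.IntertwiningMap π.rep)
  nontrivial : Nontrivial E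
  irreducible : ∀ S : Submodule ℂ E, (∀ X, ∀ e ∈ S, π.lie X e ∈ S) →
    (∀ k, ∀ e ∈ S, π.rep k e ∈ S) → S = ⊥ ∨ S = ⊤

/-- `ω` is the central character of `π`: it is read off from the action of `-1 ∈ K` and of the
scalar matrices in `𝔤`. -/
def HasCentralChar (π : GKModule E) (ω : ℝˣ →* ℂˣ) : Prop :=
  (∀ e, π.rep (-1) e = (ω (-1) : ℂ) • e) ∧
    ∃ s : ℂ, (∀ e, π.lie 1 e = s • e) ∧
      ∀ z : ℝˣ, 0 < (z : ℝ) → (ω z : ℂ) = Complex.exp (s * Real.log (z : ℝ))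

/-- Moderate growth: `|W(g)| ≤ C ‖g‖ᴺ` with `‖g‖` the sum of the absolute values of the entries of
`g` and `g⁻¹`. -/
def ModerateGrowth (W : GL (Fin 2) ℝ → ℂ) : Prop :=
  ∃ (C : ℝ) (N : ℕ), ∀ g : GL (Fin 2) ℝ,
    ‖W g‖ ≤ C * (∑ i, ∑ j, (|(g : gl2) i j| + |((g⁻¹ : GL (Fin 2) ℝ) : gl2) i j|)) ^ N

/-- The Whittaker model `𝒲(π, ψ)`: the images of vectors of `π` under a `(𝔤, K)`-map `ℓ` into the
space of functions of moderate growth with `W(n(x) g) = ψ(x) W(g)`, on which `K` and `𝔤` act by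
right translation and its derivative.  (The functions `ℓ e` are then automatically smooth.) -/
def whittakerModel (π : GKModule E) (ψ : AddChar ℝ Circle) : Set (GL (Fin 2) ℝ → ℂ) :=
  {W | ∃ ℓ : E →ₗ[ℂ] (GL (Fin 2) ℝ → ℂ),
    (∀ e, Continuous (ℓ e)) ∧
    (∀ e, ModerateGrowth (ℓ e)) ∧
    (∀ e (x : ℝ) g, ℓ e (unip x * g) = (ψ x : ℂ) * ℓ e g) ∧
    (∀ e (k : O2) g, ℓ (π.rep k e) g = ℓ e (g * Unitary.toUnits k)) ∧
    (∀ e (X : gl2) g, HasDerivAt (fun t : ℝ => ℓ e (g * expGL X t)) (ℓ (π.lie X e) g) 0) ∧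
    ∃ e, W = ℓ e}

end GKModule

end Arch

end ThetaWhittaker

end

open ThetaWhittaker

/-! Write `E` for the nilpotent matrix `[0, 1; 0, 0]`. The isometries of `M₂(F)` commute with the
Weil representation of `Sp₄`, so the integrand equals `W₁(ε h₁ d) W₂(h₂) φ(-h₁⁻¹ E h₂, h₁⁻¹ h₂)`
with one fixed Schwartz-Bruhat function `φ` and `d = diag(ν(g), 1)`
(`IsTestSpace.exists_extWeil_eq`). Scalars and `N̂` fix the base point, and the characters by which
they act on `W₁` and `W₂` cancel, so the integrand descends to the quotient.

For convergence, the second argument of `φ` controls `h₁⁻¹ h₂`, and also its inverse because the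
determinant is one; both arguments together control `h₂⁻¹ E h₂`. If `h₂ = z n(x) diag(t, 1) k` with
`k` in the maximal compact subgroup, this matrix has size about `|t|⁻¹`, so `φ` keeps `t` away from
`0`. Large `t` is handled by `W₂`, and `W₁` needs no more than moderate growth.

Over a non-archimedean field, `W₂` vanishes where `h₂⁻¹ E h₂` is small (`exists_nhd_whittaker`), so
the integrand is continuous and supported in the image of a compact set
(`exists_mul_mem_boundedGL`).

Over the reals, vanishing becomes rapid decay (`GKModule.IsWhittakerMap.rapid_decay`). The Casimir
operator is a scalar, so the functions attached to a basis of a finite-dimensional `K`-stable space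
satisfy, on the torus, a second-order system with dominant term `α² t²`; moderate growth excludes
the growing solutions. The integrand then decays faster than every power of the size of a suitable
representative, while volume grows polynomially in the size (`exists_measure_pairSize_le`). -/

namespace ThetaWhittaker

/-! ### Reduction to normed ultrametric fields -/

section Normed

/-- The conclusion of the convergence theorem for one topological field. -/
def NonarchConverges (F : Type*) [Field F] [TopologicalSpace F] [IsTopologicalRing F]
    [LocallyCompactSpace F] : Prop :=
  ∀ (ψ : AddChar F Circle), Continuous ψ → ψ ≠ 1 →
      ∀ (E₁ E₂ : Type*) [AddCommGroup E₁] [Module ℂ E₁] [AddCommGroup E₂] [Module ℂ E₂]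
        (π₁ : Representation ℂ (Matrix.GeneralLinearGroup (Fin 2) F) E₁)
        (π₂ : Representation ℂ (Matrix.GeneralLinearGroup (Fin 2) F) E₂),
        IsIrredAdmissible π₁ → IsIrredAdmissible π₂ →
      ∀ ω₁ ω₂ : Fˣ →* ℂˣ, HasCentralChar π₁ ω₁ → HasCentralChar π₂ ω₂ → ω₁ * ω₂ = 1 →
      ∀ W₁ ∈ whittakerModel π₁ ψ, ∀ W₂ ∈ whittakerModel π₂ ψ,
      ∀ f : VSq F → ℂ, IsSchwartzBruhat f →
      ∀ g : GSp4 F,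
      ∀ m : MeasureTheory.Measure (VSq F), IsSelfDual ψ m →
      ∀ μ : MeasureTheory.Measure (NHatQuot F), IsInvariantMeasure μ →
        ConvergesAbsolutely μ (integrand ψ m W₁ W₂ f g)

/-- The valuation has rank one and therefore comes from a norm inducing the given topology. Local
compactness becomes properness, and all later estimates can be made with norms. -/
theorem nonarchConverges_of_normed.{u, v, w}
    (H : ∀ (F : Type u) [NontriviallyNormedField F] [IsUltrametricDist F] [ProperSpace F],
      NonarchConverges.{u, v, w} F)
    (F : Type u) [Field F] [ValuativeRel F] [TopologicalSpace F]
    [IsNonarchimedeanLocalField F] : NonarchConverges.{u, v, w} F := by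
  let := IsTopologicalAddGroup.rightUniformSpace F
  have := isUniformAddGroup_of_addCommGroup (G := F)
  let : (Valued.v (R := F)).RankOne :=
  { hom' := ValuativeRel.IsRankLeOne.nonempty.some.emb (R := F).comp
      MonoidWithZeroHom.ValueGroup₀.embedding
    strictMono' := ValuativeRel.IsRankLeOne.nonempty.some.strictMono.comp
        MonoidWithZeroHom.ValueGroup₀.embedding_strictMono }
  let := Valued.toNontriviallyNormedField F (ValuativeRel.ValueGroupWithZero F)
  have : ProperSpace F := .of_nontriviallyNormedField_of_weaklyLocallyCompactSpace F
  have : IsUltrametricDist F :=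
    inferInstanceAs (@IsUltrametricDist F
      (Valued.toNormedField F (ValuativeRel.ValueGroupWithZero F)).toMetricSpace.toDist)
  exact H F

end Normed

/-! ### The isometries `x ↦ h₁⁻¹ x h₂` of the quadratic space -/

section Algebra

variable {F : Type*} [Field F]

theorem form_mul_mul (a b x y : Matrix (Fin 2) (Fin 2) F) :
    form (a * x * b) (a * y * b) = a.det * b.det * form x y := by
  simp only [form, det_fin_two, Matrix.add_apply, Matrix.mul_apply, Fin.sum_univ_two]
  ring

theorem form_eq (x y : Matrix (Fin 2) (Fin 2) F) :
    form x y = x 0 0 * y 1 1 + x 1 1 * y 0 0 - x 0 1 * y 1 0 - x 1 0 * y 0 1 := by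
  simp only [form, det_fin_two, Matrix.add_apply]
  ring

theorem form_invAct {h₁ h₂ : GL (Fin 2) F}
    (h : GeneralLinearGroup.det h₁ = GeneralLinearGroup.det h₂) (x y : VSq F) (i j : Fin 2) :
    form (invAct h₁ h₂ x i) (invAct h₁ h₂ y j) = form (x i) (y j) := by
  have h' : ((h₁⁻¹ : GL (Fin 2) F) : Matrix (Fin 2) (Fin 2) F).det *
      (h₂ : Matrix (Fin 2) (Fin 2) F).det = 1 := by
    rw [← GeneralLinearGroup.val_det_apply, ← GeneralLinearGroup.val_det_apply, map_inv, h,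
      Units.inv_mul]
  rw [invAct, invAct, form_mul_mul, h', one_mul]

theorem invAct_mul (a₁ a₂ b₁ b₂ : GL (Fin 2) F) (x : VSq F) :
    invAct (a₁ * b₁) (a₂ * b₂) x = invAct b₁ b₂ (invAct a₁ a₂ x) := by
  funext i
  simp only [invAct, _root_.mul_inv_rev, Units.val_mul, Matrix.mul_assoc]

@[simp] theorem invAct_one (x : VSq F) : invAct 1 1 x = x := by
  funext i
  simp [invAct]

theorem invAct_add (h₁ h₂ : GL (Fin 2) F) (x y : VSq F) :
    invAct h₁ h₂ (x + y) = invAct h₁ h₂ x + invAct h₁ h₂ y := by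
  funext i
  simp [invAct, Matrix.mul_add, Matrix.add_mul]

theorem invAct_neg (h₁ h₂ : GL (Fin 2) F) (x : VSq F) :
    invAct h₁ h₂ (-x) = -invAct h₁ h₂ x := by
  funext i
  simp [invAct]

theorem invAct_rightAct (h₁ h₂ : GL (Fin 2) F) (x : VSq F) (a : Matrix (Fin 2) (Fin 2) F) :
    invAct h₁ h₂ (rightAct x a) = rightAct (invAct h₁ h₂ x) a := by
  funext i
  simp [invAct, rightAct, Matrix.mul_add, Matrix.add_mul]

theorem continuous_invAct [TopologicalSpace F] [IsTopologicalRing F] (h₁ h₂ : GL (Fin 2) F) :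
    Continuous (invAct h₁ h₂) := by
  unfold invAct
  fun_prop

/-- The automorphism `x ↦ h₁⁻¹ x h₂` of the additive group `V²`. -/
def invActEquiv [TopologicalSpace F] [IsTopologicalRing F] (h₁ h₂ : GL (Fin 2) F) :
    VSq F ≃ₜ+ VSq F where
  toFun := invAct h₁ h₂
  invFun := invAct h₁⁻¹ h₂⁻¹
  left_inv x := by rw [← invAct_mul, mul_inv_cancel, mul_inv_cancel, invAct_one]
  right_inv x := by rw [← invAct_mul, inv_mul_cancel, inv_mul_cancel, invAct_one]
  map_add' := invAct_add h₁ h₂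
  continuous_toFun := continuous_invAct h₁ h₂
  continuous_invFun := continuous_invAct h₁⁻¹ h₂⁻¹

end Algebra

/-! ### The Weil representation on spaces of test functions -/

section Weil

variable {F : Type*} [Field F] [TopologicalSpace F] [IsTopologicalRing F] [LocallyCompactSpace F]

/-- A space of test functions on `V²` on which the Weil representation acts. -/
structure IsTestSpace (ψ : AddChar F Circle) (m : Measure (VSq F)) (S : Set (VSq F → ℂ)) :
    Prop where
  continuous : ∀ f ∈ S, Continuous f
  integrable : ∀ f ∈ S, Integrable f m
  exists_ne_zero : ∃ f ∈ S, ∃ x, f x ≠ 0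
  smul : ∀ (c : ℂ), ∀ f ∈ S, (fun x => c * f x) ∈ S
  comp_rightAct : ∀ a : GL (Fin 2) F, ∀ f ∈ S,
    (fun x => f (rightAct x (a : Matrix (Fin 2) (Fin 2) F))) ∈ S
  comp_invAct : ∀ h₁ h₂ : GL (Fin 2) F, ∀ f ∈ S, (fun x => f (invAct h₁ h₂ x)) ∈ S
  siegel_mul : ∀ b : Matrix (Fin 2) (Fin 2) F, ∀ f ∈ S,
    (fun x => (ψ (2⁻¹ * ∑ i, ∑ j, b i j * form (x j) (x i)) : ℂ) * f x) ∈ S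
  fourier_mem : ∀ f ∈ S, fourier ψ m f ∈ S

variable {ψ : AddChar F Circle} {m : Measure (VSq F)} {S : Set (VSq F → ℂ)}

/-- Equal determinants make the pairing invariant, so this is the substitution `y ↦ h₁⁻¹ y h₂`. Its
Jacobian enters only as an unknown constant, supplied by uniqueness of Haar measure. -/
theorem exists_fourier_comp_invAct [SecondCountableTopology F]
    (hm : m.IsAddHaarMeasure) {h₁ h₂ : GL (Fin 2) F}
    (h : GeneralLinearGroup.det h₁ = GeneralLinearGroup.det h₂) :
    ∃ c : ℝ, 0 < c ∧ ∀ φ x, fourier ψ m (fun y => φ (invAct h₁ h₂ y)) x =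
      c * fourier ψ m φ (invAct h₁ h₂ x) := by
  have : SecondCountableTopology (VSq F) :=
    inferInstanceAs (SecondCountableTopology (Fin 2 → Fin 2 → Fin 2 → F))
  have : LocallyCompactSpace (VSq F) :=
    inferInstanceAs (LocallyCompactSpace (Fin 2 → Fin 2 → Fin 2 → F))
  set A := invActEquiv h₁ h₂ with hA
  have hA' : (m.map A).IsAddHaarMeasure :=
    A.isAddHaarMeasure_map m
  obtain ⟨c, hc0, hctop, hc⟩ : ∃ c : ENNReal, c ≠ 0 ∧ c ≠ ⊤ ∧ m.map A = c • m := by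
    have := Measure.isAddLeftInvariant_eq_smul (m.map A) m
    have hpos := Measure.addHaarScalarFactor_pos_of_isAddHaarMeasure (m.map A) m
    exact ⟨_, by exact_mod_cast hpos.ne', ENNReal.coe_ne_top, this⟩
  refine ⟨c.toReal, ENNReal.toReal_pos hc0 hctop, fun φ x => ?_⟩
  have key : ∀ G : VSq F → ℂ, ∫ y, G (A y) ∂m = c.toReal * ∫ y, G y ∂m := by
    intro G
    have := A.toHomeomorph.measurableEmbedding.integral_map (μ := m) G
    rw [show (A.toHomeomorph : VSq F → VSq F) = A from rfl, hc, integral_smul_measure] at this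
    rw [← this, Complex.real_smul]
  unfold fourier
  rw [← key]
  refine integral_congr_ae (ae_of_all _ fun y => ?_)
  change _ = φ (invAct h₁ h₂ y) *
    (ψ (∑ i, form (invAct h₁ h₂ x i) (invAct h₁ h₂ y i)) : ℂ)
  simp only [form_invAct h]

/-- The Fourier transform commutes with the isometries `x ↦ h₁⁻¹ x h₂`; the scaling factor is `1`
because applying the Fourier transform twice gives back the function up to sign. -/
theorem IsTestSpace.fourier_comp_invAct [SecondCountableTopology F] (hS : IsTestSpace ψ m S)
    (hm : IsSelfDual ψ m) {h₁ h₂ : GL (Fin 2) F}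
    (h : GeneralLinearGroup.det h₁ = GeneralLinearGroup.det h₂) (φ : VSq F → ℂ) (x : VSq F) :
    fourier ψ m (fun y => φ (invAct h₁ h₂ y)) x =
      fourier ψ m φ (invAct h₁ h₂ x) := by
  obtain ⟨c, hc, H⟩ := exists_fourier_comp_invAct (ψ := ψ) hm.haar h
  suffices hc1 : c = 1 by rw [H, hc1, Complex.ofReal_one, one_mul]
  obtain ⟨f, hf, x₀, hx₀⟩ := hS.exists_ne_zero
  have inv : ∀ f ∈ S, ∀ x, fourier ψ m (fourier ψ m f) x = f (-x) :=
    fun f hf => hm.inversion f (hS.continuous f hf) (hS.integrable f hf)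
      (hS.integrable _ (hS.fourier_mem f hf))
  -- Chosen so that `invAct h₁ h₂ (-x₁) = x₀`, a point where `f` does not vanish.
  set x₁ := -(invActEquiv h₁ h₂).symm x₀ with hx₁
  have e1 := inv _ (hS.comp_invAct h₁ h₂ f hf) x₁
  have e2 : fourier ψ m (fun y => f (invAct h₁ h₂ y)) =
      fun x => (c : ℂ) * fourier ψ m f (invAct h₁ h₂ x) :=
    funext fun x => H f x
  have e3 : invAct h₁ h₂ (-x₁) = x₀ := by
    rw [hx₁, neg_neg]
    exact (invActEquiv h₁ h₂).apply_symm_apply x₀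
  -- Each of the two Fourier transforms contributes a factor `c`, so inversion gives `c² f(x₀) =
  -- f(x₀)`.
  rw [e2, H (fun x => (c : ℂ) * fourier ψ m f x) x₁] at e1
  have e4 : fourier ψ m (fun x => (c : ℂ) * fourier ψ m f x)
      (invAct h₁ h₂ x₁) = c * f x₀ := by
    have e5 := inv f hf (-x₀)
    rw [neg_neg] at e5
    rw [show invAct h₁ h₂ x₁ = -x₀ by rw [← e3, invAct_neg, neg_neg], ← e5]
    simp only [fourier, mul_assoc, integral_const_mul]
  rw [e4, e3, ← mul_assoc, ← Complex.ofReal_mul] at e1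
  have e5 : ((c * c : ℝ) : ℂ) = 1 := mul_right_cancel₀ hx₀ (e1.trans (one_mul _).symm)
  have e6 : c * c = 1 := by exact_mod_cast e5
  nlinarith

/-- Both properties are checked on generators and pass to words. They hold for every word
representing `s`, so it does not matter which word `weilOp` has chosen. -/
theorem IsTestSpace.weilOperator [SecondCountableTopology F] (hS : IsTestSpace ψ m S)
    (hm : IsSelfDual ψ m) {s : Matrix (Fin 2 ⊕ Fin 2) (Fin 2 ⊕ Fin 2) F}
    {T : (VSq F → ℂ) → (VSq F → ℂ)} (hT : IsWeilOperator ψ m s T) :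
    (∀ f ∈ S, T f ∈ S) ∧ ∀ h₁ h₂ : GL (Fin 2) F,
      GeneralLinearGroup.det h₁ = GeneralLinearGroup.det h₂ → ∀ f : VSq F → ℂ, 
        T (fun x => f (invAct h₁ h₂ x)) =
          fun x => T f (invAct h₁ h₂ x) := by
  induction hT with
  | levi a =>
    refine ⟨fun f hf => hS.smul _ _ (hS.comp_rightAct a f hf), fun h₁ h₂ _ f => ?_⟩
    simp only [invAct_rightAct]
  | siegel b hb =>
    refine ⟨fun f hf => hS.siegel_mul b f hf, fun h₁ h₂ h f => ?_⟩
    simp only [form_invAct h]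
  | weyl =>
    exact ⟨hS.fourier_mem, fun h₁ h₂ h f => funext fun x => hS.fourier_comp_invAct hm h f x⟩
  | comp _ _ ih₁ ih₂ =>
    refine ⟨fun f hf => ih₁.1 _ (ih₂.1 f hf), fun h₁ h₂ h f => ?_⟩
    simp only [Function.comp_apply, ih₂.2 h₁ h₂ h, ih₁.2 h₁ h₂ h]

/-- The base point of `V²` at which the theta kernel is evaluated. -/
def basePoint (F : Type*) [Field F] : VSq F := ![!![0, -1; 0, 0], 1]

/-- The factor `diag(ν, 1)` is absorbed into `f` before the Weil operator is applied. What is left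
is a pair of equal determinants, which commutes past the operator and only moves the base point. -/
theorem IsTestSpace.exists_extWeil_eq [SecondCountableTopology F] (hS : IsTestSpace ψ m S)
    (hm : IsSelfDual ψ m) {f : VSq F → ℂ} (hf : f ∈ S) (g : GSp4 F) :
    ∃ φ ∈ S, ∀ h : DetPairs F,
      extWeil ψ m g (h.1.1 * diag g.nu 1) h.1.2 f ![!![0, -1; 0, 0], 1] =
        φ (invAct h.1.1 h.1.2 (basePoint F)) := by
  obtain ⟨h1, h2⟩ := hS.weilOperator hm (weilOp_spec ψ m g.toSp g.toSp_mem)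
  refine ⟨_, hS.smul (((absF g.nu ^ 2)⁻¹ : ℝ) : ℂ) _ (h1 _ (hS.comp_invAct (diag g.nu 1) 1 f hf)),
    fun h => ?_⟩
  have := h2 h.1.1 h.1.2 h.2 (fun x => f (invAct (diag g.nu 1) 1 x))
  simp only [← invAct_mul, mul_one] at this
  rw [extWeil, this]
  rfl

end Weil

/-! ### Invariance under `N̂` and the quotient space -/

section Invariance

variable {F : Type*} [Field F]

/-- This is the role of `ε`: it turns `n(x)` into `n(-x)`, so that `W₁` contributes `ψ(-x)` against
the `ψ(x)` of `W₂`. -/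
theorem diag_mul_unip_comm (z : Fˣ) (x : F) (g : GL (Fin 2) F) :
    eps * (diag z z * unip x * g) = diag z z * unip (-x) * (eps * g) := by
  simp only [← mul_assoc]
  congr 1
  ext i j
  fin_cases i <;> fin_cases j <;> simp [eps, diag, unip, Matrix.mul_apply, Fin.sum_univ_two]

/-- A pair `(u, u)` acts by conjugation, and `z n(x)` commutes with both components of the base
point, `-E` and the identity. -/
theorem invAct_basePoint_eq (z : Fˣ) (x : F) :
    invAct (diag z z * unip x) (diag z z * unip x) (basePoint F) = basePoint F := by
  have key : ∀ M : Matrix (Fin 2) (Fin 2) F,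
      M * ((diag z z * unip x : GL (Fin 2) F) : Matrix (Fin 2) (Fin 2) F) =
        ((diag z z * unip x : GL (Fin 2) F) : Matrix (Fin 2) (Fin 2) F) * M →
      (((diag z z * unip x : GL (Fin 2) F)⁻¹ : GL (Fin 2) F) : Matrix (Fin 2) (Fin 2) F) * M *
        ((diag z z * unip x : GL (Fin 2) F) : Matrix (Fin 2) (Fin 2) F) = M := by
    intro M hM
    rw [Matrix.mul_assoc, hM, ← Matrix.mul_assoc, Units.inv_mul, Matrix.one_mul]
  funext i
  refine key _ ?_
  fin_cases i
  · ext i j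
    fin_cases i <;> fin_cases j <;>
      simp [basePoint, diag, unip, Matrix.mul_apply, Fin.sum_univ_two]
  · simp [basePoint]

/-- Equivariance of a function on `GL₂(F)` under scalars and upper triangular unipotents. -/
def IsWhittaker (ψ : AddChar F Circle) (ω : Fˣ →* ℂˣ) (W : GL (Fin 2) F → ℂ) : Prop :=
  ∀ (z : Fˣ) (x : F) (g : GL (Fin 2) F),
    W (diag z z * unip x * g) = (ω z : ℂ) * (ψ x : ℂ) * W g

variable {ψ : AddChar F Circle} {ω₁ ω₂ : Fˣ →* ℂˣ} {W₁ W₂ : GL (Fin 2) F → ℂ}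

theorem IsWhittaker.mul_left_invariant (h₁ : IsWhittaker ψ ω₁ W₁) (h₂ : IsWhittaker ψ ω₂ W₂)
    (hω : ω₁ * ω₂ = 1) (d : GL (Fin 2) F) (φ : VSq F → ℂ) {n : DetPairs F} (hn : n ∈ NHat F)
    (h : DetPairs F) :
    W₁ (eps * (n * h).1.1 * d) * W₂ (n * h).1.2 *
        φ (invAct (n * h).1.1 (n * h).1.2 (basePoint F)) =
      W₁ (eps * h.1.1 * d) * W₂ h.1.2 * φ (invAct h.1.1 h.1.2 (basePoint F)) := by
  obtain ⟨z, x, hz⟩ := hn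
  have e1 : (n * h).1.1 = diag z z * unip x * h.1.1 := by
    rw [Subgroup.coe_mul, Prod.fst_mul, hz]
  have e2 : (n * h).1.2 = diag z z * unip x * h.1.2 := by
    rw [Subgroup.coe_mul, Prod.snd_mul, hz]
  have hω' : ((ω₁ z : ℂˣ) : ℂ) * ω₂ z = 1 := by
    rw [← Units.val_mul, ← MonoidHom.mul_apply, hω]; simp
  have hψ : ((ψ (-x) : Circle) : ℂ) * ψ x = 1 := by
    rw [← Circle.coe_mul, ← AddChar.map_add_eq_mul]; simp
  rw [e1, e2, invAct_mul, invAct_basePoint_eq, diag_mul_unip_comm, mul_assoc _ _ d, h₁, h₂]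
  linear_combination (W₁ (eps * h.1.1 * d) * W₂ h.1.2 * φ (invAct h.1.1 h.1.2 (basePoint F))) *
    (((ψ (-x) : Circle) : ℂ) * ψ x * hω' + hψ)

theorem NHatQuot.mk_eq {n : DetPairs F} (hn : n ∈ NHat F) (h : DetPairs F) :
    NHatQuot.mk F (n * h) = NHatQuot.mk F h := by
  refine Quotient.sound ?_
  change QuotientGroup.rightRel (NHat F) (n * h) h
  rw [QuotientGroup.rightRel_apply]
  simpa [_root_.mul_inv_rev] using (NHat F).inv_mem hn

theorem NHatQuot.exists_lift {Φ : DetPairs F → ℂ} (hΦ : ∀ n ∈ NHat F, ∀ h, Φ (n * h) = Φ h) :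
    ∃ Φ' : NHatQuot F → ℂ, ∀ h, Φ' (NHatQuot.mk F h) = Φ h := by
  refine ⟨Quotient.lift Φ fun a b hab => ?_, fun h => rfl⟩
  have hab' : QuotientGroup.rightRel (NHat F) a b := hab
  rw [QuotientGroup.rightRel_apply] at hab'
  have := hΦ _ hab' a
  rw [inv_mul_cancel_right] at this
  exact this.symm

theorem NHatQuot.mk_surjective : Function.Surjective (NHatQuot.mk F) := Quotient.mk_surjective

variable [TopologicalSpace F]

theorem NHatQuot.isQuotientMap_mk : Topology.IsQuotientMap (NHatQuot.mk F) := isQuotientMap_quotient_mk'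

/-- The saturation of an open set is a union of its translates. In the volume estimate this makes
images of open sets of pairs measurable. -/
theorem NHatQuot.isOpenMap_mk [IsTopologicalRing F] : IsOpenMap (NHatQuot.mk F) := by
  intro U hU
  rw [← NHatQuot.isQuotientMap_mk.isOpen_preimage]
  have : NHatQuot.mk F ⁻¹' (NHatQuot.mk F '' U) = ⋃ n ∈ NHat F, (fun h => n * h) ⁻¹' U := by
    ext h
    simp only [Set.mem_preimage, Set.mem_image, Set.mem_iUnion, exists_prop]
    constructor
    · rintro ⟨u, hu, hmk⟩
      have : QuotientGroup.rightRel (NHat F) u h := Quotient.exact hmk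
      rw [QuotientGroup.rightRel_apply] at this
      exact ⟨_, (NHat F).inv_mem this, by simpa [_root_.mul_inv_rev] using hu⟩
    · rintro ⟨n, hn, hu⟩
      exact ⟨_, hu, NHatQuot.mk_eq hn h⟩
  rw [this]
  exact isOpen_biUnion fun n _ => hU.preimage (continuous_const_mul n)

end Invariance

/-! ### Compact sets of pairs -/

section Compact

variable {F : Type*} [NormedField F]

/-- Invertible matrices whose entries, and those of the inverse, are bounded by `R`. -/
def boundedGL (F : Type*) [NormedField F] (R : ℝ) : Set (GL (Fin 2) F) :=
  {g | (∀ i j, ‖(g : Matrix (Fin 2) (Fin 2) F) i j‖ ≤ R) ∧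
    ∀ i j, ‖((g⁻¹ : GL (Fin 2) F) : Matrix (Fin 2) (Fin 2) F) i j‖ ≤ R}

theorem isCompact_boundedMatrix [ProperSpace F] (R : ℝ) :
    IsCompact {g : Matrix (Fin 2) (Fin 2) F | ∀ i j, ‖g i j‖ ≤ R} := by
  have h : IsCompact (Set.univ.pi fun _ : Fin 2 => Set.univ.pi fun _ : Fin 2 =>
      Metric.closedBall (0 : F) R) :=
    isCompact_univ_pi fun _ => isCompact_univ_pi fun _ => isCompact_closedBall _ _
  have e : {g : Matrix (Fin 2) (Fin 2) F | ∀ i j, ‖g i j‖ ≤ R} =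
      Set.univ.pi fun _ : Fin 2 => Set.univ.pi fun _ : Fin 2 => Metric.closedBall (0 : F) R := by
    ext g
    exact ⟨fun h i _ j _ => mem_closedBall_zero_iff.mpr (h i j),
      fun h i j => mem_closedBall_zero_iff.mp (h i trivial j trivial)⟩
  rw [e]
  exact h

/-- The unit group carries the topology of the closed embedding `g ↦ (g, g⁻¹)`; the bound on the
inverse keeps the determinant away from zero. -/
theorem isCompact_boundedGL [ProperSpace F] (R : ℝ) : IsCompact (boundedGL F R) := by
  have h := (isCompact_boundedMatrix (F := F) R).prod
    (MulOpposite.opHomeomorph.symm.isCompact_preimage.mpr (isCompact_boundedMatrix (F := F) R))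
  exact Units.isClosedEmbedding_embedProduct.isCompact_preimage h

theorem isClosed_detPairs {F : Type*} [Field F] [TopologicalSpace F] [IsTopologicalRing F]
    [T2Space F] : IsClosed (DetPairs F : Set (GL (Fin 2) F × GL (Fin 2) F)) := by
  have : (DetPairs F : Set (GL (Fin 2) F × GL (Fin 2) F)) =
      {h | (h.1 : Matrix (Fin 2) (Fin 2) F).det = (h.2 : Matrix (Fin 2) (Fin 2) F).det} := by
    ext h
    change GeneralLinearGroup.det h.1 = GeneralLinearGroup.det h.2 ↔ _
    rw [Units.ext_iff]
    rfl
  rw [this]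
  exact isClosed_eq ((Units.continuous_val.comp continuous_fst).matrix_det)
    ((Units.continuous_val.comp continuous_snd).matrix_det)

/-- Pairs in `DetPairs` with both components bounded by `R`. -/
def boundedPairs (F : Type*) [NormedField F] (R : ℝ) : Set (DetPairs F) :=
  {h | h.1.1 ∈ boundedGL F R ∧ h.1.2 ∈ boundedGL F R}

theorem isCompact_boundedPairs [ProperSpace F] (R : ℝ) : IsCompact (boundedPairs F R) :=
  isClosed_detPairs.isClosedEmbedding_subtypeVal.isCompact_preimage
    ((isCompact_boundedGL R).prod (isCompact_boundedGL R))

end Compact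

/-! ### Additive characters of an ultrametric field -/

section NonarchCharacter

variable {F : Type*} [NontriviallyNormedField F]

/-- The circle has no small subgroups. In `w² - 1 = (w - 1)(w + 1)` the second factor has norm at
least `3/2` when `w` is near `1`, so repeated squaring moves `z ≠ 1` away from `1` geometrically. -/
theorem circle_eq_one_of_pow_near {z : Circle} (h : ∀ n : ℕ, ‖((z : ℂ)) ^ n - 1‖ < 1 / 2) :
    z = 1 := by
  by_contra hz
  have hz' : 0 < ‖(z : ℂ) - 1‖ := by
    rw [norm_pos_iff, sub_ne_zero]
    exact fun h => hz (Circle.ext (by simpa using h))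
  have key : ∀ k : ℕ, (3 / 2 : ℝ) ^ k * ‖(z : ℂ) - 1‖ ≤ ‖(z : ℂ) ^ (2 ^ k) - 1‖ := by
    intro k
    induction k with
    | zero => simp
    | succ k ih =>
      have e : (z : ℂ) ^ (2 ^ (k + 1)) - 1 = ((z : ℂ) ^ (2 ^ k) - 1) * ((z : ℂ) ^ (2 ^ k) + 1) := by
        rw [pow_succ 2 k, pow_mul]; ring
      have h2 : 3 / 2 ≤ ‖(z : ℂ) ^ (2 ^ k) + 1‖ := by
        have e2 : (2 : ℂ) = ((z : ℂ) ^ (2 ^ k) + 1) - ((z : ℂ) ^ (2 ^ k) - 1) := by ring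
        have := norm_sub_le ((z : ℂ) ^ (2 ^ k) + 1) ((z : ℂ) ^ (2 ^ k) - 1)
        rw [← e2] at this
        have h3 := h (2 ^ k)
        have h4 : ‖(2 : ℂ)‖ = 2 := by simp
        linarith
      rw [e, norm_mul, pow_succ]
      nlinarith [norm_nonneg ((z : ℂ) ^ (2 ^ k) - 1)]
  obtain ⟨k, hk⟩ := pow_unbounded_of_one_lt (1 / ‖(z : ℂ) - 1‖) (by norm_num : (1 : ℝ) < 3 / 2)
  have h1 := key k
  have h2 := h (2 ^ k)
  rw [div_lt_iff₀ hz'] at hk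
  linarith

/-- Integers have norm at most one, so all multiples of a small `x` stay small and all powers of `ψ
x` stay near `1`. -/
theorem exists_conductor [IsUltrametricDist F] {ψ : AddChar F Circle} (hψ : Continuous ψ) :
    ∃ δ > 0, ∀ x : F, ‖x‖ < δ → ψ x = 1 := by
  have hc : Continuous fun x => ((ψ x : Circle) : ℂ) := continuous_subtype_val.comp hψ
  obtain ⟨δ, hδ, H⟩ := Metric.continuous_iff.mp hc 0 (1 / 2) (by norm_num)
  refine ⟨δ, hδ, fun x hx => circle_eq_one_of_pow_near fun n => ?_⟩
  have h1 : ‖n • x‖ < δ := by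
    refine lt_of_le_of_lt ?_ hx
    rw [nsmul_eq_mul, norm_mul]
    exact mul_le_of_le_one_left (norm_nonneg _) (IsUltrametricDist.norm_natCast_le_one F n)
  have := H (n • x) (by simpa using h1)
  rw [dist_eq_norm, AddChar.map_nsmul_eq_pow] at this
  simpa using this

/-- If `a` were larger, `x = a⁻¹ b` would lie in the ball and give `ψ b = 1`. This bounds supports
of Fourier transforms. -/
theorem norm_le_of_forall_eq_one {ψ : AddChar F Circle} {b : F} (hb : ψ b ≠ 1) {ρ : ℝ}
    (hρ : 0 < ρ) {a : F} (h : ∀ x, ‖x‖ ≤ ρ → ψ (a * x) = 1) : ‖a‖ ≤ ‖b‖ / ρ := by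
  by_contra hcon
  push Not at hcon
  have ha : 0 < ‖a‖ := lt_of_le_of_lt (by positivity) hcon
  refine hb ?_
  have := h (a⁻¹ * b) ?_
  · rwa [mul_inv_cancel_left₀ (norm_pos_iff.mp ha)] at this
  · rw [norm_mul, norm_inv, inv_mul_le_iff₀ ha]
    rw [div_lt_iff₀ hρ] at hcon
    linarith

end NonarchCharacter

/-! ### Schwartz-Bruhat functions and their Fourier transforms -/

section SchwartzBruhat

variable {F : Type*} [NontriviallyNormedField F]

/-- A Lebesgue number of the cover of the support by level sets works at points of the support. If
only `x + u` is in the support, the same argument applies to it with `-u`. -/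
theorem exists_uniform_locallyConstant {X : Type*} [NormedAddCommGroup X] {f : X → ℂ}
    (hf : IsLocallyConstant f) (hc : HasCompactSupport f) :
    ∃ δ > 0, ∀ x u, ‖u‖ < δ → f (x + u) = f x := by
  obtain ⟨δ, hδ, H⟩ := lebesgue_number_lemma_of_metric (s := tsupport f) (c := fun v : ℂ => f ⁻¹' {v})
    hc (fun v => hf.isOpen_fiber v) (fun x _ => Set.mem_iUnion.mpr ⟨f x, rfl⟩)
  have key : ∀ x ∈ tsupport f, ∀ u, ‖u‖ < δ → f (x + u) = f x := by
    intro x hx u hu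
    obtain ⟨v, hv⟩ := H x hx
    have h1 : f x = v := hv (Metric.mem_ball_self hδ)
    have h2 : f (x + u) = v := hv (by simpa using hu)
    rw [h1, h2]
  refine ⟨δ, hδ, fun x u hu => ?_⟩
  by_cases hx : x ∈ tsupport f
  · exact key x hx u hu
  by_cases hxu : x + u ∈ tsupport f
  · have := key _ hxu (-u) (by simpa using hu)
    rwa [add_neg_cancel_right, eq_comm] at this
  · rw [image_eq_zero_of_notMem_tsupport hx, image_eq_zero_of_notMem_tsupport hxu]

/-- The entries of an element of `V²`, as an element of a normed space. -/
abbrev entries (x : VSq F) : Fin 2 → Fin 2 → Fin 2 → F := x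

theorem norm_le_norm_entries (x : VSq F) (k i j : Fin 2) : ‖x k i j‖ ≤ ‖entries x‖ :=
  (norm_le_pi_norm (entries x k i) j).trans
    ((norm_le_pi_norm (entries x k) i).trans (norm_le_pi_norm (entries x) k))

theorem norm_entries_le {x : VSq F} {R : ℝ} (hR : 0 ≤ R) (h : ∀ k i j, ‖x k i j‖ ≤ R) :
    ‖entries x‖ ≤ R :=
  (pi_norm_le_iff_of_nonneg hR).mpr fun k => (pi_norm_le_iff_of_nonneg hR).mpr fun i =>
    (pi_norm_le_iff_of_nonneg hR).mpr fun j => h k i j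

theorem norm_pairing_le (x y : VSq F) :
    ‖∑ i, form (x i) (y i)‖ ≤ 8 * (‖entries x‖ * ‖entries y‖) := by
  have h : ∀ k i j k' i' j', ‖x k i j * y k' i' j'‖ ≤ ‖entries x‖ * ‖entries y‖ := by
    intro k i j k' i' j'
    rw [norm_mul]
    exact mul_le_mul (norm_le_norm_entries x k i j) (norm_le_norm_entries y k' i' j')
      (norm_nonneg _) (norm_nonneg _)
  have h4 : ∀ k, ‖form (x k) (y k)‖ ≤ 4 * (‖entries x‖ * ‖entries y‖) := by
    intro k
    rw [form_eq]
    refine (norm_sub_le _ _).trans ?_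
    refine (add_le_add_left (norm_sub_le _ _) _).trans ?_
    refine (add_le_add_left (add_le_add_left (norm_add_le _ _) _) _).trans ?_
    linarith [h k 0 0 k 1 1, h k 1 1 k 0 0, h k 0 1 k 1 0, h k 1 0 k 0 1]
  rw [Fin.sum_univ_two]
  exact (norm_add_le _ _).trans (by linarith [h4 0, h4 1])

theorem form_add_right (x y z : Matrix (Fin 2) (Fin 2) F) :
    form x (y + z) = form x y + form x z := by
  simp only [form_eq, Matrix.add_apply]; ring

theorem form_add_left (x y z : Matrix (Fin 2) (Fin 2) F) :
    form (x + y) z = form x z + form y z := by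
  simp only [form_eq, Matrix.add_apply]; ring

/-- The polar form of `det` pairs each matrix entry, up to sign, with the diagonally opposite one,
so a single non-zero entry `t` isolates any coordinate. -/
theorem exists_pairing_eq (k i j : Fin 2) (t : F) :
    ∃ u : VSq F, ‖entries u‖ ≤ ‖t‖ ∧ ∀ x : VSq F,
      ∑ l, form (x l) (u l) = x k i j * t ∨ ∑ l, form (x l) (u l) = x k i j * (-t) := by
  refine ⟨fun l => Matrix.of fun i' j' => if l = k ∧ i' ≠ i ∧ j' ≠ j then t else 0,
    norm_entries_le (norm_nonneg _) fun l i' j' => ?_, fun x => ?_⟩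
  · rw [Matrix.of_apply]
    split_ifs <;> simp
  · fin_cases k <;> fin_cases i <;> fin_cases j <;> simp [form_eq]

theorem hasCompactSupport_of_entries [ProperSpace F] {f : VSq F → ℂ} {R : ℝ}
    (h : ∀ x, f x ≠ 0 → ‖entries x‖ ≤ R) : HasCompactSupport f := by
  have hc : IsCompact {x : Fin 2 → Fin 2 → Fin 2 → F | ‖x‖ ≤ R} := by
    have := isCompact_closedBall (0 : Fin 2 → Fin 2 → Fin 2 → F) R
    have e : Metric.closedBall (0 : Fin 2 → Fin 2 → Fin 2 → F) R = {x | ‖x‖ ≤ R} := by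
      ext x; simp
    rwa [e] at this
  have hc' : IsCompact {x : VSq F | ‖entries x‖ ≤ R} := hc
  exact HasCompactSupport.intro hc' fun x hx => by
    by_contra hne
    exact hx (h x hne)

theorem IsSchwartzBruhat.exists_bound {f : VSq F → ℂ} (hf : IsSchwartzBruhat f) :
    ∃ R > 0, ∀ x, f x ≠ 0 → ‖entries x‖ ≤ R := by
  have h2 : Bornology.IsBounded (tsupport f : Set (Fin 2 → Fin 2 → Fin 2 → F)) :=
    IsCompact.isBounded hf.2
  obtain ⟨R, hR, h⟩ := h2.exists_pos_norm_le
  exact ⟨R, hR, fun x hx => h x (subset_tsupport f hx)⟩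

theorem IsSchwartzBruhat.exists_uniform {f : VSq F → ℂ} (hf : IsSchwartzBruhat f) :
    ∃ δ > 0, ∀ x u : VSq F, ‖entries u‖ < δ → f (x + u) = f x :=
  exists_uniform_locallyConstant (X := Fin 2 → Fin 2 → Fin 2 → F) hf.1 hf.2

theorem isLocallyConstant_of_uniform {f : VSq F → ℂ} {δ : ℝ} (hδ : 0 < δ)
    (h : ∀ x u : VSq F, ‖entries u‖ < δ → f (x + u) = f x) : IsLocallyConstant f := by
  rw [IsLocallyConstant.iff_eventually_eq]
  intro x
  have : ∀ᶠ y : Fin 2 → Fin 2 → Fin 2 → F in 𝓝 (entries x), ‖y - entries x‖ < δ := by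
    filter_upwards [Metric.ball_mem_nhds (entries x) hδ] with y hy
    rwa [← dist_eq_norm]
  refine Filter.Eventually.mono this fun y hy => ?_
  have := h x (y - x) hy
  rwa [add_sub_cancel] at this

/-- A period `u` of `f` forces `ψ(tr (x, u)) = 1` wherever the transform is non-zero, which confines
its support. -/
theorem fourier_add_eq [ProperSpace F] {ψ : AddChar F Circle} {m : Measure (VSq F)} [m.IsAddHaarMeasure]
    {f : VSq F → ℂ} {x u : VSq F} (hu : ∀ y, f (y + u) = f y) :
    fourier ψ m f x = (ψ (∑ i, form (x i) (u i)) : ℂ) * fourier ψ m f x := by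
  have : fourier ψ m f x = ∫ y, f (y + u) * (ψ (∑ i, form (x i) ((y + u) i)) : ℂ) ∂m :=
    (integral_add_right_eq_self (μ := m)
      (fun y => f y * (ψ (∑ i, form (x i) (y i)) : ℂ)) u).symm
  conv_lhs => rw [this]
  simp only [hu, fourier]
  rw [← integral_const_mul]
  refine integral_congr_ae (ae_of_all _ fun y => ?_)
  simp only [Pi.add_apply, form_add_right, Finset.sum_add_distrib, AddChar.map_add_eq_mul,
    Circle.coe_mul]
  ring

/-- The Fourier transform exchanges the two conditions: bounded support of `f` makes the transform
locally constant, and uniform local constancy of `f` makes its support bounded. -/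
theorem isSchwartzBruhat_fourier [ProperSpace F] [IsUltrametricDist F] {ψ : AddChar F Circle} (hψ : Continuous ψ)
    (hψ1 : ψ ≠ 1) {m : Measure (VSq F)} [m.IsAddHaarMeasure] {f : VSq F → ℂ}
    (hf : IsSchwartzBruhat f) : IsSchwartzBruhat (fourier ψ m f) := by
  obtain ⟨b, hb⟩ : ∃ b, ψ b ≠ 1 := by
    by_contra hcon
    push Not at hcon
    exact hψ1 (DFunLike.ext _ _ hcon)
  obtain ⟨R, hR, hfR⟩ := hf.exists_bound
  obtain ⟨δ, hδ, hfδ⟩ := hf.exists_uniform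
  obtain ⟨η, hη, hψη⟩ := exists_conductor hψ
  constructor
  -- The `8` is the constant of `norm_pairing_le`; on the support of `f` the pairing with `u` then
  -- stays below `η`, where `ψ` is trivial.
  · refine isLocallyConstant_of_uniform (δ := η / (8 * R)) (by positivity) fun x u hu => ?_
    refine integral_congr_ae (ae_of_all _ fun y => ?_)
    dsimp only
    by_cases hy : f y = 0
    · rw [hy, zero_mul, zero_mul]
    simp only [Pi.add_apply, form_add_left, Finset.sum_add_distrib, AddChar.map_add_eq_mul]
    rw [hψη (∑ i, form (u i) (y i)), mul_one]
    refine (norm_pairing_le u y).trans_lt ?_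
    rw [lt_div_iff₀ (by positivity)] at hu
    nlinarith [hfR y hy, norm_nonneg (entries u)]
  -- Halving `δ` turns the bound `‖t‖ ≤ δ / 2` into the strict one required of a period.
  · refine hasCompactSupport_of_entries (R := ‖b‖ / (δ / 2)) fun x hx => ?_
    refine norm_entries_le (by positivity) fun k i j => ?_
    refine norm_le_of_forall_eq_one hb (by positivity) fun t ht => ?_
    have key : ∀ u : VSq F, ‖entries u‖ ≤ ‖t‖ → ψ (∑ l, form (x l) (u l)) = 1 := by
      intro u hu
      have h1 := fourier_add_eq (ψ := ψ) (m := m) (x := x) fun y => hfδ y u (by linarith)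
      exact Circle.ext (mul_right_cancel₀ hx ((one_mul (fourier ψ m f x)).trans h1).symm)
    obtain ⟨u, hu, hux⟩ := exists_pairing_eq k i j t
    rcases hux x with h | h
    · rw [← h]; exact key u hu
    · have := key u hu
      rw [h, mul_neg, AddChar.map_neg_eq_inv, inv_eq_one] at this
      exact this

theorem exists_isSchwartzBruhat_ne_zero [ProperSpace F] [IsUltrametricDist F] :
    ∃ f : VSq F → ℂ, IsSchwartzBruhat f ∧ ∃ x, f x ≠ 0 := by
  classical
  refine ⟨fun x => if ∀ k i j, ‖x k i j‖ ≤ 1 then 1 else 0, ⟨?_, ?_⟩, 0, by simp⟩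
  · refine isLocallyConstant_of_uniform one_pos fun x u hu => ?_
    have key : ∀ x u : VSq F, ‖entries u‖ < 1 → (∀ k i j, ‖x k i j‖ ≤ 1) →
        ∀ k i j, ‖(x + u) k i j‖ ≤ 1 := fun x u hu hx k i j =>
      (IsUltrametricDist.norm_add_le_max _ _).trans
        (max_le (hx k i j) ((norm_le_norm_entries u k i j).trans hu.le))
    refine if_congr ⟨fun h => ?_, key x u hu⟩ rfl rfl
    have := key (x + u) (-u) (by rwa [show entries (-u) = -entries u from rfl, norm_neg]) h
    rwa [add_neg_cancel_right] at this
  · refine hasCompactSupport_of_entries (R := 1) fun x hx => ?_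
    exact norm_entries_le zero_le_one (by by_contra h; exact hx (if_neg h))

theorem isLocallyConstant_addChar [IsUltrametricDist F] {ψ : AddChar F Circle}
    (hψ : Continuous ψ) : IsLocallyConstant ψ := by
  obtain ⟨η, hη, hψη⟩ := exists_conductor hψ
  rw [IsLocallyConstant.iff_eventually_eq]
  intro x
  filter_upwards [Metric.ball_mem_nhds x hη] with y hy
  rw [← sub_add_cancel y x, AddChar.map_add_eq_mul, hψη _ (by simpa [dist_eq_norm] using hy),
    one_mul]

theorem rightAct_rightAct {F : Type*} [Field F] (x : VSq F) (a b : Matrix (Fin 2) (Fin 2) F) :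
    rightAct (rightAct x a) b = rightAct x (a * b) := by
  funext j
  simp only [rightAct, Finset.smul_sum, smul_smul, Matrix.mul_apply, Finset.sum_smul]
  rw [Finset.sum_comm]
  simp only [mul_comm]

@[simp] theorem rightAct_one {F : Type*} [Field F] (x : VSq F) : rightAct x 1 = x := by
  funext j
  simp [rightAct, Matrix.one_apply]

theorem isTestSpace_schwartzBruhat [ProperSpace F] [IsUltrametricDist F] {ψ : AddChar F Circle}
    (hψ : Continuous ψ) (hψ1 : ψ ≠ 1) {m : Measure (VSq F)} (hm : m.IsAddHaarMeasure) :
    IsTestSpace ψ m {f | IsSchwartzBruhat f} where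
  continuous f hf := hf.1.continuous
  integrable f hf := hf.1.continuous.integrable_of_hasCompactSupport hf.2
  exists_ne_zero := exists_isSchwartzBruhat_ne_zero
  smul c f hf := ⟨hf.1.comp (c * ·), hf.2.mul_left⟩
  comp_rightAct a f hf := by
    let e : VSq F ≃ₜ VSq F :=
      { toFun := fun x => rightAct x (a : Matrix (Fin 2) (Fin 2) F)
        invFun := fun x => rightAct x ((a⁻¹ : GL (Fin 2) F) : Matrix (Fin 2) (Fin 2) F)
        left_inv := fun x => by dsimp only; rw [rightAct_rightAct, Units.mul_inv, rightAct_one]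
        right_inv := fun x => by dsimp only; rw [rightAct_rightAct, Units.inv_mul, rightAct_one]
        continuous_toFun := by unfold rightAct; fun_prop
        continuous_invFun := by unfold rightAct; fun_prop }
    exact ⟨hf.1.comp_continuous e.continuous, hf.2.comp_homeomorph e⟩
  comp_invAct h₁ h₂ f hf := ⟨hf.1.comp_continuous (continuous_invAct h₁ h₂),
    hf.2.comp_homeomorph (invActEquiv h₁ h₂).toHomeomorph⟩
  siegel_mul b f hf := by
    refine ⟨?_, hf.2.mul_left⟩
    have h1 : Continuous fun x : VSq F => 2⁻¹ * ∑ i, ∑ j, b i j * form (x j) (x i) := by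
      simp only [form_eq]
      fun_prop
    exact (((isLocallyConstant_addChar hψ).comp_continuous h1).comp
      (fun z : Circle => (z : ℂ))).comp₂ hf.1 (· * ·)
  fourier_mem f hf := isSchwartzBruhat_fourier hψ hψ1 hf

end SchwartzBruhat

/-! ### Integrability from compact support -/

section Integrable

variable {F : Type*} [Field F] [TopologicalSpace F]

theorem integrable_of_support_subset {μ : Measure (NHatQuot F)} (hμ : IsInvariantMeasure μ)
    {Φ : NHatQuot F → ℂ} (hΦ : Continuous Φ) {C : Set (NHatQuot F)} (hC : IsCompact C)
    (h : ∀ x, Φ x ≠ 0 → x ∈ C) : Integrable Φ μ := by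
  obtain ⟨B, hB⟩ := (hC.image hΦ.norm).isBounded.exists_norm_le
  -- Integration is restricted to this open set, so that no measurability of `C` is needed.
  have hmeas : MeasurableSet {x | Φ x ≠ 0} :=
    (isOpen_ne_fun hΦ continuous_const).measurableSet
  have hfin : μ {x | Φ x ≠ 0} < ⊤ :=
    (measure_mono h).trans_lt (hμ.finite_on_compacts C hC)
  have hsm : AEStronglyMeasurable Φ μ := hΦ.measurable.aestronglyMeasurable
  have h1 : IntegrableOn Φ {x | Φ x ≠ 0} μ := by
    refine Measure.integrableOn_of_bounded (M := B) hfin.ne hsm ?_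
    refine (ae_restrict_iff' hmeas).mpr (ae_of_all _ fun x hx => ?_)
    have := hB _ (Set.mem_image_of_mem _ (h x hx))
    rwa [norm_norm] at this
  rw [integrableOn_iff_integrable_of_support_subset] at h1
  · exact h1
  · exact fun x hx => hx

end Integrable

/-! ### The non-archimedean case -/

section Nonarch

variable {F : Type*} [NontriviallyNormedField F]

theorem mul_mem_boundedGL {R R' : ℝ} {g g' : GL (Fin 2) F} (hg : g ∈ boundedGL F R)
    (hg' : g' ∈ boundedGL F R') : g * g' ∈ boundedGL F (2 * (R * R')) := by
  have key : ∀ (R R' : ℝ) (A B : Matrix (Fin 2) (Fin 2) F), (∀ i j, ‖A i j‖ ≤ R) →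
      (∀ i j, ‖B i j‖ ≤ R') → ∀ i j, ‖(A * B) i j‖ ≤ 2 * (R * R') := by
    intro R R' A B hA hB i j
    have hR : 0 ≤ R := (norm_nonneg _).trans (hA 0 0)
    have h : ∀ k, ‖A i k * B k j‖ ≤ R * R' := fun k => by
      rw [norm_mul]
      exact mul_le_mul (hA i k) (hB k j) (norm_nonneg _) hR
    rw [Matrix.mul_apply, Fin.sum_univ_two]
    exact (norm_add_le _ _).trans (by linarith [h 0, h 1])
  refine ⟨fun i j => key R R' _ _ hg.1 hg'.1 i j, fun i j => ?_⟩
  rw [_root_.mul_inv_rev, mul_comm R R']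
  exact key R' R _ _ hg'.2 hg.2 i j

theorem inv_mem_boundedGL {R : ℝ} {g : GL (Fin 2) F} (hg : g ∈ boundedGL F R) :
    g⁻¹ ∈ boundedGL F R := ⟨hg.2, by rw [inv_inv]; exact hg.1⟩

/-- The nilpotent matrix `g⁻¹ [0, 1; 0, 0] g`. -/
def conjNilp {F : Type*} [Field F] (g : GL (Fin 2) F) : Matrix (Fin 2) (Fin 2) F :=
  ((g⁻¹ : GL (Fin 2) F) : Matrix (Fin 2) (Fin 2) F) * !![0, 1; 0, 0] *
    (g : Matrix (Fin 2) (Fin 2) F)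

theorem inv_mul_unip_mul {F : Type*} [Field F] (g : GL (Fin 2) F) (x : F) :
    ((g⁻¹ * unip x * g : GL (Fin 2) F) : Matrix (Fin 2) (Fin 2) F) = 1 + x • conjNilp g := by
  have e : ((unip x : GL (Fin 2) F) : Matrix (Fin 2) (Fin 2) F) = 1 + x • !![0, 1; 0, 0] := by
    ext i j; fin_cases i <;> fin_cases j <;> simp [unip]
  rw [Units.val_mul, Units.val_mul, e, Matrix.mul_add, Matrix.add_mul, Matrix.mul_one,
    Units.inv_mul, Matrix.mul_smul, Matrix.smul_mul, conjNilp]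

theorem exists_forall_mem_of_mem_nhds_one {V : Set (Matrix (Fin 2) (Fin 2) F)} (hV : V ∈ 𝓝 1) :
    ∃ δ > 0, ∀ M : Matrix (Fin 2) (Fin 2) F, (∀ i j, ‖M i j‖ < δ) → 1 + M ∈ V := by
  have hV' : (V : Set (Fin 2 → Fin 2 → F)) ∈ 𝓝 ((1 : Matrix (Fin 2) (Fin 2) F) : Fin 2 → Fin 2 → F) :=
    hV
  obtain ⟨δ, hδ, h⟩ := (Metric.mem_nhds_iff (α := Fin 2 → Fin 2 → F)).mp hV'
  refine ⟨δ, hδ, fun M hM => h ?_⟩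
  refine (dist_pi_lt_iff hδ).mpr fun i => (dist_pi_lt_iff hδ).mpr fun j => ?_
  rw [dist_eq_norm]
  have : (1 + M - 1) i j = M i j := by rw [add_sub_cancel_left]
  exact (congrArg norm this).trans_lt (hM i j)

/-- Here `g⁻¹ n(b) g = 1 + b • conjNilp g`. When this is close to `1` it fixes `e` by smoothness,
whence `W(g) = W(n(b) g) = ψ(b) W(g)`; with `ψ(b) ≠ 1` this forces `W(g) = 0`. -/
theorem exists_nhd_whittaker {E : Type*} [AddCommGroup E] [Module ℂ E]
    {π : Representation ℂ (GL (Fin 2) F) E} (hπ : IsIrredAdmissible π) {ψ : AddChar F Circle}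
    (hψ1 : ψ ≠ 1) {W : GL (Fin 2) F → ℂ} (hW : W ∈ whittakerModel π ψ) :
    ∃ δ > 0, ∀ g, W g ≠ 0 → ∃ i j, δ ≤ ‖conjNilp g i j‖ := by
  obtain ⟨b, hb⟩ : ∃ b, ψ b ≠ 1 := by
    by_contra hcon
    push Not at hcon
    exact hψ1 (DFunLike.ext _ _ hcon)
  have hb0 : 0 < ‖b‖ := norm_pos_iff.mpr (by rintro rfl; simp at hb)
  obtain ⟨l, hl, e, hWe⟩ := hW
  have hS : {g : GL (Fin 2) F | π g e = e} ∈ 𝓝 (1 : GL (Fin 2) F) :=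
    (hπ.smooth e).mem_nhds (by simp)
  -- Closeness to `1` in `GL₂` means closeness of the matrix and of its inverse; the inverse is the
  -- same conjugate with `-b`, so one bound on `conjNilp g` serves both.
  rw [(Units.isEmbedding_embedProduct (M := Matrix (Fin 2) (Fin 2) F)).nhds_eq_comap,
    Filter.mem_comap] at hS
  obtain ⟨t, ht, hts⟩ := hS
  rw [map_one, Prod.one_eq_mk, nhds_prod_eq, Filter.mem_prod_iff] at ht
  obtain ⟨V₁, hV₁, V₂, hV₂, hV⟩ := ht
  obtain ⟨δ₁, hδ₁, h₁⟩ := exists_forall_mem_of_mem_nhds_one hV₁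
  obtain ⟨δ₂, hδ₂, h₂⟩ := exists_forall_mem_of_mem_nhds_one
    (MulOpposite.continuous_op.continuousAt.preimage_mem_nhds hV₂)
  refine ⟨min δ₁ δ₂ / ‖b‖, by positivity, fun g hg => ?_⟩
  by_contra hcon
  push Not at hcon
  have hsmall : ∀ i j, ‖b‖ * ‖conjNilp g i j‖ < min δ₁ δ₂ := fun i j => by
    have := hcon i j
    rw [lt_div_iff₀ hb0] at this
    linarith
  have hinv : (g⁻¹ * unip b * g)⁻¹ = g⁻¹ * unip (-b) * g := by
    have : (unip b : GL (Fin 2) F)⁻¹ = unip (-b) := by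
      rw [inv_eq_iff_mul_eq_one]
      ext i j
      fin_cases i <;> fin_cases j <;> simp [unip, Matrix.mul_apply, Fin.sum_univ_two]
    simp only [_root_.mul_inv_rev, this, inv_inv, mul_assoc]
  have hmem : g⁻¹ * unip b * g ∈ {g : GL (Fin 2) F | π g e = e} := by
    refine hts (hV ⟨?_, ?_⟩)
    · change ((g⁻¹ * unip b * g : GL (Fin 2) F) : Matrix (Fin 2) (Fin 2) F) ∈ V₁
      rw [inv_mul_unip_mul]
      refine h₁ _ fun i j => ?_
      rw [Matrix.smul_apply, smul_eq_mul, norm_mul]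
      exact (hsmall i j).trans_le (min_le_left _ _)
    · change MulOpposite.op (((g⁻¹ * unip b * g)⁻¹ : GL (Fin 2) F) :
        Matrix (Fin 2) (Fin 2) F) ∈ V₂
      rw [hinv, inv_mul_unip_mul]
      refine h₂ _ fun i j => ?_
      rw [Matrix.smul_apply, smul_eq_mul, norm_mul, norm_neg]
      exact (hsmall i j).trans_le (min_le_right _ _)
  have h3 : l (π (unip b * g) e) = l (π g e) := by
    have : unip b * g = g * (g⁻¹ * unip b * g) := by group
    rw [this, map_mul, Module.End.mul_apply, hmem]
  rw [map_mul, Module.End.mul_apply, hl, ← hWe] at h3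
  refine hb (Circle.ext ?_)
  rw [Circle.coe_one]
  exact mul_right_cancel₀ hg (h3.trans (one_mul _).symm)

theorem isWhittaker_of_mem {E : Type*} [AddCommGroup E] [Module ℂ E]
    {π : Representation ℂ (GL (Fin 2) F) E} {ω : Fˣ →* ℂˣ} (hω : HasCentralChar π ω)
    {ψ : AddChar F Circle} {W : GL (Fin 2) F → ℂ} (hW : W ∈ whittakerModel π ψ) :
    IsWhittaker ψ ω W := by
  obtain ⟨l, hl, e, hWe⟩ := hW
  intro z x g
  rw [hWe, hWe, mul_assoc, map_mul, Module.End.mul_apply, hω, map_smul, map_mul,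
    Module.End.mul_apply, hl, smul_eq_mul, mul_assoc]

theorem continuous_of_mem_whittakerModel {E : Type*} [AddCommGroup E] [Module ℂ E]
    {π : Representation ℂ (GL (Fin 2) F) E} (hπ : IsIrredAdmissible π)
    {ψ : AddChar F Circle} {W : GL (Fin 2) F → ℂ} (hW : W ∈ whittakerModel π ψ) :
    Continuous W := by
  obtain ⟨l, hl, e, hWe⟩ := hW
  refine IsLocallyConstant.continuous ((IsLocallyConstant.iff_eventually_eq _).mpr fun g => ?_)
  have h1 : Filter.Tendsto (fun g' => g⁻¹ * g') (𝓝 g) (𝓝 1) := by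
    have := (continuous_const_mul g⁻¹).tendsto g
    rwa [inv_mul_cancel] at this
  filter_upwards [h1 ((hπ.smooth e).mem_nhds (by simp))] with g' hg'
  have hg'' : π (g⁻¹ * g') e = e := hg'
  rw [hWe, hWe, ← mul_inv_cancel_left g g', map_mul, Module.End.mul_apply, hg'']

/-- Only the bottom row and the determinant enter, and the size is that of the square of the larger
bottom entry over the determinant. -/
theorem conjNilp_eq {F : Type*} [Field F] (g : GL (Fin 2) F) :
    conjNilp g = ((g : Matrix (Fin 2) (Fin 2) F).det)⁻¹ • !![g 1 0 * g 1 1, g 1 1 * g 1 1;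
      -(g 1 0 * g 1 0), -(g 1 0 * g 1 1)] := by
  rw [conjNilp, Matrix.coe_units_inv, Matrix.inv_def, Ring.inverse_eq_inv', Matrix.adjugate_fin_two]
  ext i j
  fin_cases i <;> fin_cases j <;> simp [Matrix.mul_apply, Fin.sum_univ_two] <;> ring

/-- Modulo scalars and upper triangular unipotents, a matrix `g` is bounded in terms of
`g⁻¹ [0, 1; 0, 0] g`. -/
theorem exists_mul_mem_boundedGL {g : GL (Fin 2) F} {δ R : ℝ} (hδ : 0 < δ)
    (hR : ∀ i j, ‖conjNilp g i j‖ ≤ R) (h : ∃ i j, δ ≤ ‖conjNilp g i j‖) :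
    ∃ z x, diag z z * unip x * g ∈ boundedGL F (max 1 (max R δ⁻¹)) := by
  set D := (g : Matrix (Fin 2) (Fin 2) F).det with hD
  have hD0 : D ≠ 0 := by
    have := (Matrix.isUnit_iff_isUnit_det _).mp g.isUnit
    exact this.ne_zero
  have hD' : D = g 0 0 * g 1 1 - g 0 1 * g 1 0 := det_fin_two _
  have hDn : 0 < ‖D‖ := norm_pos_iff.mpr hD0
  set B := max 1 (max R δ⁻¹) with hB
  have hB1 : 1 ≤ B := le_max_left _ _
  have hBR : R ≤ B := (le_max_left _ _).trans (le_max_right _ _)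
  have hBδ : δ⁻¹ ≤ B := (le_max_right _ _).trans (le_max_right _ _)
  have e00 : conjNilp g 0 0 = D⁻¹ * (g 1 0 * g 1 1) := by rw [conjNilp_eq]; simp [hD]
  have e01 : conjNilp g 0 1 = D⁻¹ * (g 1 1 * g 1 1) := by rw [conjNilp_eq]; simp [hD]
  have e10 : conjNilp g 1 0 = -(D⁻¹ * (g 1 0 * g 1 0)) := by rw [conjNilp_eq]; simp [hD]
  have e11 : conjNilp g 1 1 = -(D⁻¹ * (g 1 0 * g 1 1)) := by rw [conjNilp_eq]; simp [hD]
  have n00 := congrArg norm e00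
  have n01 := congrArg norm e01
  have n10 := congrArg norm e10
  have n11 := congrArg norm e11
  simp only [norm_neg, norm_mul, norm_inv] at n00 n01 n10 n11
  have r := norm_nonneg (g 1 0)
  have s := norm_nonneg (g 1 1)
  have dinv : 0 ≤ ‖D‖⁻¹ := by positivity
  -- The larger bottom entry is scaled to `1` and the entry above it is cleared by a unipotent. The
  -- remaining entries of the result and of its inverse are a ratio at most `1`, entries of
  -- `conjNilp g`, or a term of norm at most `δ⁻¹`.
  rcases le_total ‖g 1 1‖ ‖g 1 0‖ with hrs | hrs
  · have hmax : δ ≤ ‖D‖⁻¹ * (‖g 1 0‖ * ‖g 1 0‖) := by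
      obtain ⟨i, j, hij⟩ := h
      refine hij.trans ?_
      fin_cases i <;> fin_cases j
      · exact n00.trans_le (by gcongr)
      · exact n01.trans_le (by gcongr)
      · exact n10.le
      · exact n11.trans_le (by gcongr)
    have hr0 : g 1 0 ≠ 0 := by
      intro h0
      rw [h0, norm_zero] at hmax
      linarith [mul_zero ‖D‖⁻¹, mul_zero (0 : ℝ)]
    set u := diag (Units.mk0 _ hr0)⁻¹ (Units.mk0 _ hr0)⁻¹ * unip (-(g 0 0 / g 1 0)) * g with hu
    have hval : (u : Matrix (Fin 2) (Fin 2) F) =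
        !![0, -(D * (g 1 0 * g 1 0)⁻¹); 1, g 1 1 / g 1 0] := by
      ext i j
      fin_cases i <;> fin_cases j <;>
        simp [hu, diag, unip, Matrix.mul_apply, Fin.sum_univ_two, hD', hr0] <;> field_simp <;> ring
    have hinv : ((u⁻¹ : GL (Fin 2) F) : Matrix (Fin 2) (Fin 2) F) =
        !![conjNilp g 0 0, 1; conjNilp g 1 0, 0] := by
      refine Units.inv_eq_of_mul_eq_one_right ?_
      rw [hval, e00, e10]
      ext i j
      fin_cases i <;> fin_cases j <;> simp [Matrix.mul_apply, Fin.sum_univ_two] <;> field_simp <;>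
        ring
    have b1 : ‖D‖ * (‖g 1 0‖ * ‖g 1 0‖)⁻¹ ≤ B := by
      refine le_trans ?_ hBδ
      rw [← inv_inv ‖D‖, ← mul_inv]
      exact inv_anti₀ hδ hmax
    rw [mul_inv] at b1
    have b2 : ‖g 1 1‖ / ‖g 1 0‖ ≤ B :=
      (div_le_one_of_le₀ hrs r).trans hB1
    refine ⟨(Units.mk0 _ hr0)⁻¹, -(g 0 0 / g 1 0), fun i j => ?_, fun i j => ?_⟩
    · rw [hval]
      fin_cases i <;> fin_cases j <;> simp <;> linarith
    · rw [hinv]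
      have := hR 0 0
      have := hR 1 0
      fin_cases i <;> fin_cases j <;> simp <;> linarith
  · have hmax : δ ≤ ‖D‖⁻¹ * (‖g 1 1‖ * ‖g 1 1‖) := by
      obtain ⟨i, j, hij⟩ := h
      refine hij.trans ?_
      fin_cases i <;> fin_cases j
      · exact n00.trans_le (by gcongr)
      · exact n01.le
      · exact n10.trans_le (by gcongr)
      · exact n11.trans_le (by gcongr)
    have hs0 : g 1 1 ≠ 0 := by
      intro h0
      rw [h0, norm_zero] at hmax
      linarith [mul_zero ‖D‖⁻¹, mul_zero (0 : ℝ)]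
    set u := diag (Units.mk0 _ hs0)⁻¹ (Units.mk0 _ hs0)⁻¹ * unip (-(g 0 1 / g 1 1)) * g with hu
    have hval : (u : Matrix (Fin 2) (Fin 2) F) =
        !![D * (g 1 1 * g 1 1)⁻¹, 0; g 1 0 / g 1 1, 1] := by
      ext i j
      fin_cases i <;> fin_cases j <;>
        simp [hu, diag, unip, Matrix.mul_apply, Fin.sum_univ_two, hD', hs0] <;> field_simp <;> ring
    have hinv : ((u⁻¹ : GL (Fin 2) F) : Matrix (Fin 2) (Fin 2) F) =
        !![conjNilp g 0 1, 0; conjNilp g 1 1, 1] := by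
      refine Units.inv_eq_of_mul_eq_one_right ?_
      rw [hval, e01, e11]
      ext i j
      fin_cases i <;> fin_cases j <;> simp [Matrix.mul_apply, Fin.sum_univ_two] <;> field_simp <;>
        ring
    have b1 : ‖D‖ * (‖g 1 1‖ * ‖g 1 1‖)⁻¹ ≤ B := by
      refine le_trans ?_ hBδ
      rw [← inv_inv ‖D‖, ← mul_inv]
      exact inv_anti₀ hδ hmax
    rw [mul_inv] at b1
    have b2 : ‖g 1 0‖ / ‖g 1 1‖ ≤ B :=
      (div_le_one_of_le₀ hrs s).trans hB1
    refine ⟨(Units.mk0 _ hs0)⁻¹, -(g 0 1 / g 1 1), fun i j => ?_, fun i j => ?_⟩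
    · rw [hval]
      fin_cases i <;> fin_cases j <;> simp <;> linarith
    · rw [hinv]
      have := hR 0 1
      have := hR 1 1
      fin_cases i <;> fin_cases j <;> simp <;> linarith

/-- `h₁⁻¹ h₂ · h₂⁻¹ E h₂ = h₁⁻¹ E h₂`. Multiplying by the inverse of `h₁⁻¹ h₂` recovers `conjNilp
h₂` from the two coordinates of the moved base point. -/
theorem neg_conjNilp_invAct {F : Type*} [Field F] (h₁ h₂ : GL (Fin 2) F) :
    ((h₁⁻¹ * h₂ : GL (Fin 2) F) : Matrix (Fin 2) (Fin 2) F) * conjNilp h₂ =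
      -invAct h₁ h₂ (basePoint F) 0 := by
  have e : (!![0, -1; 0, 0] : Matrix (Fin 2) (Fin 2) F) = -!![0, 1; 0, 0] := by
    ext i j; fin_cases i <;> fin_cases j <;> simp
  rw [invAct, conjNilp, Units.val_mul]
  change _ = -(_ * !![0, -1; 0, 0] * _)
  rw [e, Matrix.mul_neg, Matrix.neg_mul, neg_neg, ← Matrix.mul_assoc, ← Matrix.mul_assoc,
    Matrix.mul_assoc _ (h₂ : Matrix (Fin 2) (Fin 2) F), Units.mul_inv, Matrix.mul_one]

theorem invAct_basePoint_one {F : Type*} [Field F] (h₁ h₂ : GL (Fin 2) F) :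
    invAct h₁ h₂ (basePoint F) 1 = ((h₁⁻¹ * h₂ : GL (Fin 2) F) : Matrix (Fin 2) (Fin 2) F) := by
  rw [invAct, Units.val_mul]
  change _ * 1 * _ = _
  rw [Matrix.mul_one]

/-- With determinant one, a bound on the entries of `k` is also a bound on those of `k⁻¹`. -/
theorem coe_inv_eq_adjugate {F : Type*} [Field F] {k : GL (Fin 2) F}
    (hk : GeneralLinearGroup.det k = 1) :
    ((k⁻¹ : GL (Fin 2) F) : Matrix (Fin 2) (Fin 2) F) = !![k 1 1, -k 0 1; -k 1 0, k 0 0] := by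
  have : (k : Matrix (Fin 2) (Fin 2) F).det = 1 := by
    rw [← GeneralLinearGroup.val_det_apply, hk, Units.val_one]
  rw [Matrix.coe_units_inv, Matrix.inv_def, this, Ring.inverse_one, one_smul,
    Matrix.adjugate_fin_two]

theorem det_inv_mul_detPairs {F : Type*} [Field F] (h : DetPairs F) :
    GeneralLinearGroup.det (h.1.1⁻¹ * h.1.2) = 1 := by
  rw [map_mul, map_inv, h.2, inv_mul_cancel]

theorem continuous_invAct_basePoint :
    Continuous fun h : DetPairs F => invAct h.1.1 h.1.2 (basePoint F) := by
  have h1 : Continuous fun h : DetPairs F =>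
      ((h.1.1⁻¹ : GL (Fin 2) F) : Matrix (Fin 2) (Fin 2) F) :=
    Units.continuous_val.comp (continuous_inv.comp (continuous_fst.comp continuous_subtype_val))
  have h2 : Continuous fun h : DetPairs F => (h.1.2 : Matrix (Fin 2) (Fin 2) F) :=
    Units.continuous_val.comp (continuous_snd.comp continuous_subtype_val)
  exact continuous_pi fun i => (h1.matrix_mul continuous_const).matrix_mul h2

theorem NHatQuot.continuous_of_comp_mk {Φ : NHatQuot F → ℂ}
    (h : Continuous fun x => Φ (NHatQuot.mk F x)) : Continuous Φ :=
  NHatQuot.isQuotientMap_mk.continuous_iff.mpr h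

theorem nonarchConverges_normed [IsUltrametricDist F] [ProperSpace F] : NonarchConverges F := by
  intro ψ hψ hψ1 E₁ E₂ _ _ _ _ π₁ π₂ hπ₁ hπ₂ ω₁ ω₂ hω₁ hω₂ hω W₁ hW₁ W₂ hW₂ f hf g m hm μ hμ
  obtain ⟨φ, hφ, hφe⟩ := (isTestSpace_schwartzBruhat hψ hψ1 hm.haar).exists_extWeil_eq hm hf g
  have hΦ : integrand ψ m W₁ W₂ f g = fun h => W₁ (eps * h.1.1 * diag g.nu 1) * W₂ h.1.2 *
      φ (invAct h.1.1 h.1.2 (basePoint F)) := by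
    funext h
    rw [integrand, hφe]
  rw [hΦ]
  obtain ⟨Φ, hΦ'⟩ := NHatQuot.exists_lift
    (Φ := fun h : DetPairs F => W₁ (eps * h.1.1 * diag g.nu 1) * W₂ h.1.2 *
      φ (invAct h.1.1 h.1.2 (basePoint F))) fun n hn h =>
    (isWhittaker_of_mem hω₁ hW₁).mul_left_invariant (isWhittaker_of_mem hω₂ hW₂) hω (diag g.nu 1)
      φ hn h
  refine ⟨Φ, hΦ', ?_⟩
  have hcont : Continuous Φ := by
    refine NHatQuot.continuous_of_comp_mk ?_
    simp only [hΦ']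
    have c1 : Continuous fun h : DetPairs F => h.1.1 := continuous_fst.comp continuous_subtype_val
    have c2 : Continuous fun h : DetPairs F => h.1.2 := continuous_snd.comp continuous_subtype_val
    exact (((continuous_of_mem_whittakerModel hπ₁ hW₁).comp
      ((continuous_const.mul c1).mul continuous_const)).mul
      ((continuous_of_mem_whittakerModel hπ₂ hW₂).comp c2)).mul
      ((show IsSchwartzBruhat φ from hφ).1.continuous.comp continuous_invAct_basePoint)
  obtain ⟨R, hR, hφR⟩ := (show IsSchwartzBruhat φ from hφ).exists_bound
  obtain ⟨δ, hδ, hδW⟩ := exists_nhd_whittaker hπ₂ hψ1 hW₂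
  -- `2 * (R * R)` bounds the entries of `conjNilp h₂`, a product of two matrices with entries
  -- bounded by `R`.
  set B := max 1 (max (2 * (R * R)) δ⁻¹) with hB
  refine integrable_of_support_subset hμ hcont
    ((isCompact_boundedPairs (max B (2 * (B * R)))).image NHatQuot.isQuotientMap_mk.continuous) ?_
  intro x hx
  obtain ⟨h, rfl⟩ := NHatQuot.mk_surjective x
  rw [hΦ'] at hx
  have hx1 : W₂ h.1.2 ≠ 0 := fun h0 => hx (by rw [h0, mul_zero, zero_mul])
  have hx2 : φ (invAct h.1.1 h.1.2 (basePoint F)) ≠ 0 := fun h0 => hx (by rw [h0, mul_zero])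
  have hent := fun k i j => (norm_le_norm_entries _ k i j).trans (hφR _ hx2)
  set k := h.1.1⁻¹ * h.1.2 with hk
  have hdet : GeneralLinearGroup.det k = 1 := det_inv_mul_detPairs h
  have hkR : k ∈ boundedGL F R := by
    have h1 : ∀ i j, ‖k i j‖ ≤ R := fun i j => by
      rw [hk, ← invAct_basePoint_one]; exact hent 1 i j
    refine ⟨h1, fun i j => ?_⟩
    rw [coe_inv_eq_adjugate hdet]
    fin_cases i <;> fin_cases j <;> simp [h1]
  have hY : ∀ i j, ‖conjNilp h.1.2 i j‖ ≤ 2 * (R * R) := by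
    have e : conjNilp h.1.2 = ((k⁻¹ : GL (Fin 2) F) : Matrix (Fin 2) (Fin 2) F) *
        (-invAct h.1.1 h.1.2 (basePoint F) 0) := by
      rw [← neg_conjNilp_invAct, ← hk, ← Matrix.mul_assoc, Units.inv_mul, Matrix.one_mul]
    intro i j
    rw [e, Matrix.mul_apply, Fin.sum_univ_two]
    have h2 : ∀ l, ‖((k⁻¹ : GL (Fin 2) F) : Matrix (Fin 2) (Fin 2) F) i l *
        (-invAct h.1.1 h.1.2 (basePoint F) 0) l j‖ ≤ R * R := fun l => by
      rw [norm_mul, Matrix.neg_apply, norm_neg]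
      exact mul_le_mul (hkR.2 i l) (hent 0 l j) (norm_nonneg _) hR.le
    exact (norm_add_le _ _).trans (by linarith [h2 0, h2 1])
  -- The support of `φ` bounds `conjNilp h₂` above and non-vanishing of `W₂` bounds it below. Hence
  -- some representative has bounded `h₂`, and then `h₁ = h₂ k⁻¹` is bounded too.
  obtain ⟨z, x, hzx⟩ := exists_mul_mem_boundedGL hδ hY (hδW _ hx1)
  let n : DetPairs F := ⟨(diag z z * unip x, diag z z * unip x), rfl⟩
  have hn : n ∈ NHat F := ⟨z, x, rfl⟩
  refine ⟨n * h, ?_, NHatQuot.mk_eq hn h⟩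
  have hmono : ∀ {r r' : ℝ} {u : GL (Fin 2) F}, r ≤ r' → u ∈ boundedGL F r → u ∈ boundedGL F r' :=
    fun hr hu => ⟨fun i j => (hu.1 i j).trans hr, fun i j => (hu.2 i j).trans hr⟩
  constructor
  · have e : (n * h).1.1 = diag z z * unip x * h.1.2 * k⁻¹ := by
      change diag z z * unip x * h.1.1 = _
      rw [hk]
      group
    rw [e]
    exact hmono (le_max_right _ _) (mul_mem_boundedGL hzx (inv_mem_boundedGL hkR))
  · exact hmono (le_max_left _ _) hzx

end Nonarch

/-! ### Additive characters of the reals -/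

section RealCharacter

/-- A primitive `G` of `ψ` satisfies `G(x + δ) - G(x) = ψ(x) G(δ)`. Since `G(δ) ≠ 0` for some `δ`,
the character inherits differentiability from `G` and solves `c' = a c`; norm one makes `a`
imaginary. -/
theorem exists_eq_exp {ψ : AddChar ℝ Circle} (hψ : Continuous ψ) (hψ1 : ψ ≠ 1) :
    ∃ α : ℝ, α ≠ 0 ∧ ∀ x, ((ψ x : Circle) : ℂ) = Complex.exp (Complex.I * (α * x : ℝ)) := by
  set c : ℝ → ℂ := fun x => (ψ x : ℂ) with hc
  have hcont : Continuous c := continuous_subtype_val.comp hψ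
  have hadd : ∀ x y, c (x + y) = c x * c y := fun x y => by
    simp only [hc, AddChar.map_add_eq_mul, Circle.coe_mul]
  have h0 : c 0 = 1 := by simp [hc]
  set G : ℝ → ℂ := fun x => ∫ t in (0 : ℝ)..x, c t with hG
  have hGd : ∀ x, HasDerivAt G (c x) x := fun x =>
    (hcont.integral_hasStrictDerivAt 0 x).hasDerivAt
  obtain ⟨δ, hδ⟩ : ∃ δ, G δ ≠ 0 := by
    by_contra hcon
    push Not at hcon
    have h1 : G = fun _ => 0 := funext hcon
    have h2 := hGd 0
    rw [h1, h0] at h2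
    exact one_ne_zero (h2.unique (hasDerivAt_const 0 (0 : ℂ)))
  have hshift : ∀ x, G (x + δ) - G x = c x * G δ := by
    intro x
    have h1 : G (x + δ) - G x = ∫ t in x..(x + δ), c t :=
      intervalIntegral.integral_interval_sub_left (hcont.intervalIntegrable _ _)
        (hcont.intervalIntegrable _ _)
    have h2 : ∫ t in (0 : ℝ)..δ, c (x + t) = ∫ t in x..(x + δ), c t := by
      rw [intervalIntegral.integral_comp_add_left, add_zero]
    rw [h1, ← h2]
    simp only [hadd]
    rw [intervalIntegral.integral_const_mul]
  set a : ℂ := (c δ - 1) / G δ with ha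
  have hcd : ∀ x, HasDerivAt c (c x * a) x := by
    intro x
    have h1 : HasDerivAt (fun x => (G (x + δ) - G x) / G δ) ((c (x + δ) - c x) / G δ) x :=
      (((hGd (x + δ)).comp_add_const x δ).sub (hGd x)).div_const _
    have h2 : (fun x => (G (x + δ) - G x) / G δ) = c := by
      funext y; rw [hshift, mul_div_assoc, div_self hδ, mul_one]
    rw [h2, hadd] at h1
    convert h1 using 1
    rw [ha]; ring
  have hexp : ∀ x : ℝ, c x = Complex.exp (a * x) := by
    have hd : ∀ x : ℝ, HasDerivAt (fun x : ℝ => c x * Complex.exp (-(a * x))) 0 x := by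
      intro x
      have h1 : HasDerivAt (fun x : ℝ => -(a * (x : ℂ))) (-(a * 1)) x :=
        ((Complex.ofRealCLM.hasDerivAt (x := x)).const_mul a).neg
      have h2 := (hcd x).mul h1.cexp
      have e : c x * a * Complex.exp (-(a * x)) +
          c x * (Complex.exp (-(a * x)) * -(a * 1)) = 0 := by ring
      rwa [e] at h2
    intro x
    have h1 := is_const_of_deriv_eq_zero (fun x => (hd x).differentiableAt)
      (fun x => (hd x).deriv) x 0
    simp only [h0, Complex.ofReal_zero, mul_zero, neg_zero, Complex.exp_zero, one_mul] at h1
    rw [Complex.exp_neg, mul_inv_eq_one₀ (Complex.exp_ne_zero _)] at h1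
    exact h1
  have hre : a.re = 0 := by
    have h1 : ‖c 1‖ = 1 := Circle.norm_coe _
    rw [hexp, Complex.norm_exp] at h1
    simpa using h1
  have haI : a = Complex.I * (a.im : ℂ) := by
    apply Complex.ext <;> simp [hre]
  have hfin : ∀ x, ((ψ x : Circle) : ℂ) = Complex.exp (Complex.I * (a.im * x : ℝ)) := fun x => by
    change c x = _
    rw [hexp, Complex.ofReal_mul, ← mul_assoc, ← haI]
  refine ⟨a.im, fun h => hψ1 (DFunLike.ext _ _ fun x => Circle.ext ?_), hfin⟩
  rw [hfin, h]
  simp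

end RealCharacter

/-! ### Schwartz functions over the reals and their Fourier transforms -/

section RealSchwartz

/-- The Euclidean space underlying `V²` over the reals. -/
abbrev EuclideanVSq : Type := EuclideanSpace ℝ (Fin 2 × Fin 2 × Fin 2)

def vsqEquiv : VSq ℝ ≃ₗ[ℝ] EuclideanVSq where
  toFun x := WithLp.toLp 2 fun p => x p.1 p.2.1 p.2.2
  invFun v := fun k => Matrix.of fun i j => v (k, i, j)
  map_add' _ _ := rfl
  map_smul' _ _ := rfl
  left_inv _ := rfl
  right_inv _ := rfl

theorem continuous_vsqEquiv : Continuous vsqEquiv :=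
  (PiLp.continuous_toLp 2 _).comp <| continuous_pi fun p =>
    ((continuous_apply p.2.2).comp ((continuous_apply p.2.1).comp (continuous_apply p.1)))

theorem continuous_vsqEquiv_symm : Continuous vsqEquiv.symm :=
  continuous_pi fun k => continuous_matrix fun i j => by
    change Continuous fun v : EuclideanVSq => v (k, i, j)
    fun_prop

def vsqCLE : VSq ℝ ≃L[ℝ] EuclideanVSq :=
  { vsqEquiv with
    continuous_toFun := continuous_vsqEquiv
    continuous_invFun := continuous_vsqEquiv_symm }

/-- A matrix is definitionally a function of two indices, so the same map starts from the normed
function space in which `IsRealSchwartz` is phrased. -/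
def piCLE : (Fin 2 → Fin 2 → Fin 2 → ℝ) ≃L[ℝ] EuclideanVSq := vsqCLE

/-- Passing to an inner product space gives access to the Fourier transform of Schwartz functions.
-/
theorem isRealSchwartz_iff {f : VSq ℝ → ℂ} :
    IsRealSchwartz f ↔ ∃ φ : 𝓢(EuclideanVSq, ℂ), ∀ x, f x = φ (vsqCLE x) := by
  constructor
  · rintro ⟨φ, hφ⟩
    exact ⟨SchwartzMap.compCLMOfContinuousLinearEquiv ℂ piCLE.symm φ, hφ⟩
  · rintro ⟨φ, hφ⟩
    exact ⟨SchwartzMap.compCLMOfContinuousLinearEquiv ℂ piCLE φ, hφ⟩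

theorem IsRealSchwartz.comp {f : VSq ℝ → ℂ} (hf : IsRealSchwartz f) (A : VSq ℝ ≃L[ℝ] VSq ℝ) :
    IsRealSchwartz fun x => f (A x) := by
  rw [isRealSchwartz_iff] at *
  obtain ⟨φ, hφ⟩ := hf
  refine ⟨SchwartzMap.compCLMOfContinuousLinearEquiv ℂ (vsqCLE.symm.trans (A.trans vsqCLE)) φ,
    fun x => ?_⟩
  simp [hφ]

theorem hasTemperateGrowth_cexp (β : ℝ) :
    Function.HasTemperateGrowth fun t : ℝ => Complex.exp (Complex.I * (β * t : ℝ)) := by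
  have hd : ∀ n : ℕ, iteratedDeriv n (fun t : ℝ => Complex.exp (Complex.I * (β * t : ℝ))) =
      fun t : ℝ => (Complex.I * β) ^ n * Complex.exp (Complex.I * (β * t : ℝ)) := by
    intro n
    induction n with
    | zero => simp
    | succ n ih =>
      rw [iteratedDeriv_succ, ih]
      funext t
      have h1 : HasDerivAt (fun t : ℝ => Complex.I * ((β * t : ℝ) : ℂ)) (Complex.I * β) t := by
        have := ((hasDerivAt_id t).const_mul β).ofReal_comp.const_mul Complex.I
        simpa using this
      rw [(h1.cexp.const_mul _).deriv]
      ring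
  refine ⟨?_, fun n => ⟨0, |β| ^ n, fun t => ?_⟩⟩
  · exact Complex.contDiff_exp.comp (contDiff_const.mul
      (Complex.ofRealCLM.contDiff.comp (contDiff_const.mul contDiff_id)))
  · rw [norm_iteratedFDeriv_eq_norm_iteratedDeriv, hd, norm_mul, mul_comm Complex.I ((β * t : ℝ) : ℂ),
      Complex.norm_exp_ofReal_mul_I]
    simp

theorem hasTemperateGrowth_vsq_apply (k i j : Fin 2) :
    Function.HasTemperateGrowth fun v : EuclideanVSq => vsqCLE.symm v k i j :=
  (EuclideanSpace.proj (𝕜 := ℝ) ((k, i, j) : Fin 2 × Fin 2 × Fin 2)).hasTemperateGrowth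

theorem hasTemperateGrowth_form (b : Matrix (Fin 2) (Fin 2) ℝ) :
    Function.HasTemperateGrowth fun v : EuclideanVSq => 2⁻¹ * ∑ i, ∑ j, b i j *
      form (vsqCLE.symm v j) (vsqCLE.symm v i) := by
  have h := hasTemperateGrowth_vsq_apply
  have h2 : ∀ k l, Function.HasTemperateGrowth fun v : EuclideanVSq =>
      form (vsqCLE.symm v k) (vsqCLE.symm v l) := fun k l => by
    simp only [form_eq]
    exact ((((h k 0 0).mul (h l 1 1)).add ((h k 1 1).mul (h l 0 0))).sub
      ((h k 0 1).mul (h l 1 0))).sub ((h k 1 0).mul (h l 0 1))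
  exact (Function.HasTemperateGrowth.const _).mul (Function.HasTemperateGrowth.sum fun i _ =>
    Function.HasTemperateGrowth.sum fun j _ => (Function.HasTemperateGrowth.const _).mul (h2 j i))

theorem exists_isRealSchwartz_ne_zero : ∃ f : VSq ℝ → ℂ, IsRealSchwartz f ∧ ∃ x, f x ≠ 0 := by
  let b : ContDiffBump (0 : EuclideanVSq) := ⟨1, 2, one_pos, one_lt_two⟩
  have h1 : HasCompactSupport fun v => ((b v : ℝ) : ℂ) :=
    b.hasCompactSupport.comp_left Complex.ofReal_zero
  refine ⟨fun x => (h1.toSchwartzMap (Complex.ofRealCLM.contDiff.comp b.contDiff)) (vsqCLE x),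
    isRealSchwartz_iff.mpr ⟨_, fun x => rfl⟩, 0, ?_⟩
  have h2 : b 0 = 1 := b.one_of_mem_closedBall (Metric.mem_closedBall_self zero_le_one)
  change ((b (vsqCLE 0) : ℝ) : ℂ) ≠ 0
  rw [map_zero, h2]
  simp

/-- The endomorphism of `V²` that turns the Euclidean inner product into a multiple of the pairing
`tr (x, y)`. -/
def pairingMap (κ : ℝ) : EuclideanVSq →ₗ[ℝ] EuclideanVSq where
  toFun w := WithLp.toLp 2 fun p =>
    -- Adding `1` in `Fin 2` switches to the other index; the sign is that of the corresponding term
    -- of the polar form of `det`.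
    κ * ((if p.2.1 = p.2.2 then 1 else -1) * w (p.1, p.2.1 + 1, p.2.2 + 1))
  map_add' x y := by ext p; simp; split_ifs <;> ring
  map_smul' c x := by ext p; simp; split_ifs <;> ring

theorem inner_pairingMap (κ : ℝ) (v w : EuclideanVSq) :
    inner ℝ v (pairingMap κ w) = κ * ∑ i, form (vsqCLE.symm w i) (vsqCLE.symm v i) := by
  have e : ∀ (u : EuclideanVSq) k i j, vsqCLE.symm u k i j = u (k, i, j) := fun u k i j => rfl
  simp [PiLp.inner_apply, pairingMap, Fintype.sum_prod_type, Fin.sum_univ_two, form_eq, e]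
  ring

theorem pairingMap_injective {κ : ℝ} (hκ : κ ≠ 0) : Function.Injective (pairingMap κ) := by
  rw [injective_iff_map_eq_zero]
  intro w hw
  ext ⟨k, i, j⟩
  have := congrArg (fun v : EuclideanVSq => v (k, i + 1, j + 1)) hw
  fin_cases i <;> fin_cases j <;> simpa [pairingMap, hκ] using this

theorem exists_map_vsqCLE_eq {m : Measure (VSq ℝ)} (hm : m.IsAddHaarMeasure) :
    ∃ c : NNReal, m.map vsqCLE = c • (volume : Measure EuclideanVSq) := by
  have : (m.map vsqCLE).IsAddHaarMeasure :=
    vsqCLE.toContinuousAddEquiv.isAddHaarMeasure_map m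
  exact ⟨_, Measure.isAddLeftInvariant_eq_smul _ _⟩

/-- With `ψ(t) = exp(iαt)` and the Euclidean kernel `exp(-2πi⟨v, w⟩)`, the transform is the
Euclidean one composed with `pairingMap κ` for `κ = -α / (2π)`, times the ratio of the two Haar
measures. -/
theorem isRealSchwartz_fourier {ψ : AddChar ℝ Circle} (hψ : Continuous ψ) (hψ1 : ψ ≠ 1)
    {m : Measure (VSq ℝ)} (hm : m.IsAddHaarMeasure) {f : VSq ℝ → ℂ} (hf : IsRealSchwartz f) :
    IsRealSchwartz (fourier ψ m f) := by
  obtain ⟨α, hα, hψα⟩ := exists_eq_exp hψ hψ1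
  rw [isRealSchwartz_iff] at *
  obtain ⟨φ, hφ⟩ := hf
  obtain ⟨c, hc⟩ := exists_map_vsqCLE_eq hm
  have hκ : -(α / (2 * Real.pi)) ≠ 0 :=
    neg_ne_zero.mpr (div_ne_zero hα (mul_ne_zero two_ne_zero Real.pi_ne_zero))
  set κ := -(α / (2 * Real.pi)) with hκdef
  let A : EuclideanVSq ≃L[ℝ] EuclideanVSq :=
    (LinearEquiv.ofInjectiveEndo (pairingMap κ) (pairingMap_injective hκ)).toContinuousLinearEquiv
  have hA : ∀ w, A w = pairingMap κ w := fun w => rfl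
  refine ⟨((c : ℝ) : ℂ) • SchwartzMap.compCLMOfContinuousLinearEquiv ℂ A
    (FourierTransform.fourier φ), fun x => ?_⟩
  rw [_root_.smul_apply, SchwartzMap.compCLMOfContinuousLinearEquiv_apply,
    Function.comp_apply, SchwartzMap.fourier_coe, Real.fourier_eq', fourier]
  have h1 : ∫ y, f y * (ψ (∑ i, form (x i) (y i)) : ℂ) ∂m =
      ∫ v, φ v * (ψ (∑ i, form (x i) (vsqCLE.symm v i)) : ℂ) ∂(m.map vsqCLE) := by
    have := vsqCLE.toHomeomorph.measurableEmbedding.integral_map (μ := m)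
      (fun v => φ v * (ψ (∑ i, form (x i) (vsqCLE.symm v i)) : ℂ))
    rw [show (vsqCLE.toHomeomorph : VSq ℝ → EuclideanVSq) = vsqCLE from rfl] at this
    rw [this]
    simp [hφ]
  rw [h1, hc, integral_smul_nnreal_measure, NNReal.smul_def, Complex.real_smul, smul_eq_mul]
  congr 1
  refine integral_congr_ae (ae_of_all _ fun v => ?_)
  dsimp only
  rw [hA, inner_pairingMap, hψα, smul_eq_mul, mul_comm, ContinuousLinearEquiv.symm_apply_apply,
    mul_comm Complex.I]
  congr 4
  rw [hκdef]
  field_simp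

theorem IsRealSchwartz.exists_decay {f : VSq ℝ → ℂ} (hf : IsRealSchwartz f) (N : ℕ) :
    ∃ C, ∀ x, (1 + ‖entries x‖) ^ N * ‖f x‖ ≤ C := by
  obtain ⟨φ, hφ⟩ := hf
  have key := SchwartzMap.one_add_le_sup_seminorm_apply (𝕜 := ℝ) (m := (N, 0)) (k := N) (n := 0)
    le_rfl le_rfl φ
  simp only [norm_iteratedFDeriv_zero] at key
  exact ⟨_, fun x => (hφ x).symm ▸ key (entries x)⟩

theorem isTestSpace_realSchwartz {ψ : AddChar ℝ Circle}
    (hψ : Continuous ψ) (hψ1 : ψ ≠ 1) {m : Measure (VSq ℝ)} (hm : m.IsAddHaarMeasure) :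
    IsTestSpace ψ m {f | IsRealSchwartz f} where
  continuous f hf := by
    obtain ⟨φ, hφ⟩ := isRealSchwartz_iff.mp hf
    rw [show f = fun x => φ (vsqCLE x) from funext hφ]
    exact φ.continuous.comp vsqCLE.continuous
  integrable f hf := by
    obtain ⟨φ, hφ⟩ := isRealSchwartz_iff.mp hf
    obtain ⟨c, hc⟩ := exists_map_vsqCLE_eq hm
    have h1 : Integrable φ (m.map vsqCLE) := by
      rw [hc]
      exact φ.integrable.smul_measure_nnreal
    rw [show f = fun x => φ (vsqCLE x) from funext hφ]
    exact (vsqCLE.toHomeomorph.measurableEmbedding.integrable_map_iff (μ := m)).mp h1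
  exists_ne_zero := exists_isRealSchwartz_ne_zero
  smul c f hf := by
    obtain ⟨φ, hφ⟩ := isRealSchwartz_iff.mp hf
    exact isRealSchwartz_iff.mpr ⟨c • φ, fun x => by simp [hφ]⟩
  comp_rightAct a f hf := by
    let e : VSq ℝ ≃ₗ[ℝ] VSq ℝ :=
      { toFun := fun x => rightAct x (a : Matrix (Fin 2) (Fin 2) ℝ)
        invFun := fun x => rightAct x ((a⁻¹ : GL (Fin 2) ℝ) : Matrix (Fin 2) (Fin 2) ℝ)
        left_inv := fun x => by dsimp only; rw [rightAct_rightAct, Units.mul_inv, rightAct_one]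
        right_inv := fun x => by dsimp only; rw [rightAct_rightAct, Units.inv_mul, rightAct_one]
        map_add' := fun x y => by funext i; simp [rightAct]; abel
        map_smul' := fun c x => by funext i; simp [rightAct, smul_comm c] }
    exact IsRealSchwartz.comp hf
      { e with
        continuous_toFun := by
          change Continuous fun x : VSq ℝ => rightAct x (a : Matrix (Fin 2) (Fin 2) ℝ)
          unfold rightAct
          fun_prop
        continuous_invFun := by
          change Continuous fun x : VSq ℝ =>
            rightAct x ((a⁻¹ : GL (Fin 2) ℝ) : Matrix (Fin 2) (Fin 2) ℝ)
          unfold rightAct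
          fun_prop }
  comp_invAct h₁ h₂ f hf := by
    let e : VSq ℝ ≃L[ℝ] VSq ℝ :=
      { invActEquiv h₁ h₂ with
        map_smul' := fun c x => by
          change invAct h₁ h₂ (c • x) = c • invAct h₁ h₂ x
          funext i
          simp [invAct] }
    exact IsRealSchwartz.comp hf e
  siegel_mul b f hf := by
    obtain ⟨φ, hφ⟩ := isRealSchwartz_iff.mp hf
    obtain ⟨α, -, hψα⟩ := exists_eq_exp hψ hψ1
    refine isRealSchwartz_iff.mpr ⟨SchwartzMap.smulLeftCLM ℂ
      (fun v : EuclideanVSq => (ψ (2⁻¹ * ∑ i, ∑ j, b i j *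
        form (vsqCLE.symm v j) (vsqCLE.symm v i)) : ℂ)) φ, fun x => ?_⟩
    have h : Function.HasTemperateGrowth (fun v : EuclideanVSq => (ψ (2⁻¹ * ∑ i, ∑ j, b i j *
        form (vsqCLE.symm v j) (vsqCLE.symm v i)) : ℂ)) := by
      simp only [hψα]
      exact (hasTemperateGrowth_cexp α).comp (hasTemperateGrowth_form b)
    rw [SchwartzMap.smulLeftCLM_apply_apply h]
    simp [hφ]
  fourier_mem f hf := isRealSchwartz_fourier hψ hψ1 hm hf

end RealSchwartz

/-! ### The Casimir operator and its invariance -/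

namespace GKModule

variable {E : Type*} [AddCommGroup E] [Module ℂ E] (π : GKModule E)

/-- The action of the elementary matrix with entry `1` in position `(i, j)`. -/
def elem (i j : Fin 2) : Module.End ℂ E := π.lie (Matrix.single i j 1)

theorem lie_eq_sum (X : gl2) : π.lie X = ∑ i, ∑ j, (X i j : ℂ) • π.elem i j := by
  have h : X = X 0 0 • Matrix.single 0 0 1 + X 0 1 • Matrix.single 0 1 1 +
      (X 1 0 • Matrix.single 1 0 1 + X 1 1 • Matrix.single 1 1 1) := by
    ext i j; fin_cases i <;> fin_cases j <;> simp
  conv_lhs => rw [h]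
  simp only [lie_add, lie_smul, Fin.sum_univ_two, elem]

/-- The Casimir operator of `𝔤𝔩₂`. -/
def casimir : Module.End ℂ E := ∑ i, ∑ j, π.elem i j * π.elem j i

theorem elem_bracket (i j k l : Fin 2) : π.elem i j * π.elem k l - π.elem k l * π.elem i j =
    (if j = k then π.elem i l else 0) - (if l = i then π.elem k j else 0) := by
  have h0 : π.lie 0 = 0 := by simpa using π.lie_smul 0 0
  have hneg : ∀ X Y, π.lie (X - Y) = π.lie X - π.lie Y := fun X Y => by
    rw [sub_eq_add_neg, lie_add, ← neg_one_smul ℝ Y, lie_smul]; simp [sub_eq_add_neg]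
  rw [elem, elem, ← lie_bracket, hneg]
  congr 1
  · split_ifs with h
    · subst h; simp [elem]
    · rw [Matrix.single_mul_single_of_ne _ _ _ _ h, h0]
  · split_ifs with h
    · subst h; simp [elem]
    · rw [Matrix.single_mul_single_of_ne _ _ _ _ h, h0]

/-- By linearity it is enough to commute with the four elementary matrices; each commutator is a
combination of bracket relations multiplied by generators. -/
theorem casimir_commute_lie (X : gl2) : Commute π.casimir (π.lie X) := by
  have h1 := π.elem_bracket 0 0 0 1
  have h2 := π.elem_bracket 0 1 1 1
  have h3 := π.elem_bracket 0 1 1 0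
  have h4 := π.elem_bracket 0 0 1 0
  have h5 := π.elem_bracket 1 0 1 1
  have h6 := π.elem_bracket 0 0 1 1
  simp at h1 h2 h3 h4 h5 h6
  rw [lie_eq_sum]
  refine Commute.sum_right _ _ _ fun i _ => Commute.sum_right _ _ _ fun j _ =>
    Commute.smul_right ?_ _
  rw [commute_iff_eq, eq_comm]
  simp only [casimir, Fin.sum_univ_two]
  set A := π.elem 0 0
  set B := π.elem 0 1
  set C := π.elem 1 0
  set D := π.elem 1 1
  fin_cases i <;> fin_cases j
  · change A * _ = _ * A
    linear_combination (norm := noncomm_ring) h1 * C + B * h4 + h4 * B + C * h1 + h6 * D + D * h6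
  · change B * _ = _ * B
    linear_combination (norm := noncomm_ring) -(h1 * A) - A * h1 + h2 * D + D * h2 + B * h3 + h3 * B
  · change C * _ = _ * C
    linear_combination (norm := noncomm_ring) -(h4 * A) - A * h4 + h5 * D + D * h5 - C * h3 - h3 * C
  · change D * _ = _ * D
    linear_combination (norm := noncomm_ring) -(h2 * C) - B * h5 - h5 * B - C * h2 - h6 * A - A * h6

/-- `O(2)` is disconnected, so commuting with the Lie algebra is not enough. Conjugation by `k`
sends `E_ij` to `∑ k_pi k_qj E_pq`, and the orthogonality relations for `k` restore the Casimir sum.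
-/
theorem casimir_commute_rep (k : O2) : Commute π.casimir (π.rep k) := by
  have hk : (k : gl2) * (k : gl2)ᵀ = 1 := (Matrix.mem_orthogonalGroup_iff (Fin 2) ℝ).mp k.2
  have h00 := congrFun (congrFun hk 0) 0
  have h01 := congrFun (congrFun hk 0) 1
  have h11 := congrFun (congrFun hk 1) 1
  simp [Matrix.mul_apply, Fin.sum_univ_two] at h00 h01 h11
  have hconj : ∀ i j, π.rep k * π.elem i j =
      (∑ p, ∑ q, (((k : gl2) p i * (k : gl2) q j : ℝ) : ℂ) • π.elem p q) * π.rep k := by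
    intro i j
    have h1 : π.rep k * π.elem i j =
        π.lie ((k : gl2) * Matrix.single i j 1 * (k : gl2)ᵀ) * π.rep k :=
      LinearMap.ext fun e => π.adjoint k _ e
    rw [h1, lie_eq_sum]
    congr 1
    refine Finset.sum_congr rfl fun p _ => Finset.sum_congr rfl fun q _ => ?_
    congr 2
    fin_cases i <;> fin_cases j <;> fin_cases p <;> fin_cases q <;>
      simp [Matrix.mul_apply, Fin.sum_univ_two]
  have hconj2 : ∀ i j i' j', π.rep k * (π.elem i j * π.elem i' j') =
      (∑ p, ∑ q, (((k : gl2) p i * (k : gl2) q j : ℝ) : ℂ) • π.elem p q) *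
      (∑ p, ∑ q, (((k : gl2) p i' * (k : gl2) q j' : ℝ) : ℂ) • π.elem p q) * π.rep k := by
    intro i j i' j'
    rw [← mul_assoc, hconj, mul_assoc, hconj, mul_assoc]
  rw [commute_iff_eq, eq_comm, casimir]
  simp only [Finset.mul_sum, hconj2, ← Finset.sum_mul]
  congr 1
  have c00 : ((k : gl2) 0 0 : ℂ) * (k : gl2) 0 0 + (k : gl2) 0 1 * (k : gl2) 0 1 = 1 := by
    exact_mod_cast h00
  have c01 : ((k : gl2) 0 0 : ℂ) * (k : gl2) 1 0 + (k : gl2) 0 1 * (k : gl2) 1 1 = 0 := by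
    exact_mod_cast h01
  have c11 : ((k : gl2) 1 0 : ℂ) * (k : gl2) 1 0 + (k : gl2) 1 1 * (k : gl2) 1 1 = 1 := by
    exact_mod_cast h11
  simp only [Fin.sum_univ_two, Complex.ofReal_mul]
  generalize π.elem 0 0 = A
  generalize π.elem 0 1 = B
  generalize π.elem 1 0 = C
  generalize π.elem 1 1 = D
  generalize (((k : gl2) 0 0 : ℝ) : ℂ) = a at *
  generalize (((k : gl2) 0 1 : ℝ) : ℂ) = b at *
  generalize (((k : gl2) 1 0 : ℝ) : ℂ) = c at *
  generalize (((k : gl2) 1 1 : ℝ) : ℂ) = d at *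
  clear hconj hconj2 h00 h01 h11 hk
  simp only [add_mul, smul_mul_assoc, mul_smul_comm]
  match_scalars <;> grind

end GKModule

/-! ### Schur's lemma for the Casimir operator -/

namespace GKModule

variable {E : Type*} [AddCommGroup E] [Module ℂ E] (π : GKModule E)

/-- The span of the `K`-orbit of a vector. -/
def orbitSpan (e : E) : Submodule ℂ E := Submodule.span ℂ (Set.range fun k => π.rep k e)

theorem mem_orbitSpan (e : E) : e ∈ π.orbitSpan e :=
  Submodule.subset_span ⟨1, by simp⟩

theorem rep_mem_orbitSpan {e v : E} (hv : v ∈ π.orbitSpan e) (k : O2) :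
    π.rep k v ∈ π.orbitSpan e := by
  have : π.orbitSpan e ≤ (π.orbitSpan e).comap (π.rep k) := by
    refine Submodule.span_le.mpr ?_
    rintro _ ⟨k', rfl⟩
    refine Submodule.subset_span ⟨k * k', ?_⟩
    simp [map_mul]
  exact this hv

/-- Local finiteness provides finite-dimensional non-zero stable subspaces; one of least dimension
is minimal. -/
theorem exists_minimal_stable [Nontrivial E] : ∃ N : Submodule ℂ E, N ≠ ⊥ ∧
    FiniteDimensional ℂ N ∧ (∀ k, ∀ v ∈ N, π.rep k v ∈ N) ∧
    ∀ S : Submodule ℂ E, S ≤ N → (∀ k, ∀ v ∈ S, π.rep k v ∈ S) → S = ⊥ ∨ S = N := by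
  classical
  let P : ℕ → Prop := fun n => ∃ N : Submodule ℂ E, N ≠ ⊥ ∧ FiniteDimensional ℂ N ∧
    (∀ k, ∀ v ∈ N, π.rep k v ∈ N) ∧ Module.finrank ℂ N = n
  have hP : ∃ n, P n := by
    obtain ⟨e, he⟩ := exists_ne (0 : E)
    refine ⟨_, π.orbitSpan e, fun h => he ?_, π.locally_finite e,
      fun k v hv => π.rep_mem_orbitSpan hv k, rfl⟩
    have := π.mem_orbitSpan e
    rwa [h, Submodule.mem_bot] at this
  obtain ⟨N, hN0, hNf, hNs, hNn⟩ := Nat.find_spec hP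
  refine ⟨N, hN0, hNf, hNs, fun S hS hSs => ?_⟩
  by_contra! hcon
  have hSf : FiniteDimensional ℂ S := Submodule.finiteDimensional_of_le hS
  have h1 := Nat.find_min' hP ⟨S, hcon.1, hSf, hSs, rfl⟩
  have h2 : Module.finrank ℂ S < Module.finrank ℂ N :=
    Submodule.finrank_lt_finrank_of_lt (lt_of_le_of_ne hS hcon.2)
  omega

/-- Some irreducible representation of `K` embeds in a non-zero `(𝔤, K)`-module. -/
theorem exists_irreducible_intertwining [Nontrivial E] : ∃ (n : ℕ)
    (τ : Representation ℂ O2 (Fin n → ℂ)), τ.IsIrreducible ∧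
      Nontrivial (τ.IntertwiningMap π.rep) := by
  obtain ⟨N, hN0, hNf, hNs, hmin⟩ := π.exists_minimal_stable
  let e : N ≃ₗ[ℂ] (Fin (Module.finrank ℂ N) → ℂ) := (Module.finBasis ℂ N).equivFun
  let ρ : Representation ℂ O2 N :=
    { toFun := fun k => (π.rep k).restrict (hNs k)
      map_one' := by ext; simp
      map_mul' := fun x y => by ext; simp }
  let τ : Representation ℂ O2 (Fin (Module.finrank ℂ N) → ℂ) :=
    { toFun := fun k => e.conj (ρ k)
      map_one' := by rw [map_one]; ext; simp [LinearEquiv.conj_apply]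
      map_mul' := fun x y => by rw [map_mul]; ext; simp [LinearEquiv.conj_apply] }
  have hτ : ∀ k v, (e.symm (τ k v) : E) = π.rep k (e.symm v) := fun k v => by
    simp [τ, ρ, LinearEquiv.conj_apply]
  obtain ⟨v, hv, hv0⟩ := (Submodule.ne_bot_iff N).mp hN0
  refine ⟨_, τ, ?_, ?_⟩
  · have hnt : (⊥ : Subrepresentation τ) ≠ ⊤ := by
      intro h
      have h1 : e ⟨v, hv⟩ ∈ (⊥ : Subrepresentation τ) := by rw [h]; trivial
      have h2 : e ⟨v, hv⟩ = 0 := h1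
      rw [LinearEquiv.map_eq_zero_iff] at h2
      exact hv0 (congrArg Subtype.val h2)
    have : Nontrivial (Subrepresentation τ) := ⟨⟨_, _, hnt⟩⟩
    refine { eq_bot_or_eq_top := fun S => ?_ }
    set j : (Fin (Module.finrank ℂ N) → ℂ) →ₗ[ℂ] E := N.subtype ∘ₗ e.symm.toLinearMap with hj
    have hjinj : Function.Injective j := Subtype.val_injective.comp e.symm.injective
    have hle : S.toSubmodule.map j ≤ N := by
      rintro _ ⟨w, -, rfl⟩
      exact (e.symm w).2
    have hst : ∀ k, ∀ v ∈ S.toSubmodule.map j, π.rep k v ∈ S.toSubmodule.map j := by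
      rintro k _ ⟨w, hw, rfl⟩
      exact ⟨τ k w, S.apply_mem_toSubmodule k hw, hτ k w⟩
    rcases hmin _ hle hst with h | h
    · left
      apply Subrepresentation.toSubmodule_injective
      refine (Submodule.eq_bot_iff _).mpr fun w hw => hjinj ?_
      have h1 : j w ∈ S.toSubmodule.map j := ⟨w, hw, rfl⟩
      rw [h, Submodule.mem_bot] at h1
      rw [h1, map_zero]
    · right
      apply Subrepresentation.toSubmodule_injective
      refine (Submodule.eq_top_iff'.mpr fun w => ?_)
      have : j w ∈ S.toSubmodule.map j := by rw [h]; exact (e.symm w).2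
      obtain ⟨w', hw', hww'⟩ := this
      rwa [← hjinj hww']
  · let T : τ.IntertwiningMap π.rep :=
      (N.subtype ∘ₗ e.symm.toLinearMap).intertwiningMap_of_isIntertwiningMap τ π.rep hτ
    refine ⟨T, 0, fun h => hv0 ?_⟩
    have h1 : T (e ⟨v, hv⟩) = 0 := by rw [h]; rfl
    have h2 : T (e ⟨v, hv⟩) = ((e.symm (e ⟨v, hv⟩) : N) : E) := rfl
    rwa [h2, LinearEquiv.symm_apply_apply] at h1

/-- The Casimir operator acts by a scalar on an irreducible admissible `(𝔤, K)`-module. -/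
theorem IsIrredAdmissible.exists_casimir_eq {π : GKModule E} (hπ : π.IsIrredAdmissible) :
    ∃ c : ℂ, ∀ e, π.casimir e = c • e := by
  have := hπ.nontrivial
  obtain ⟨n, τ, hτ, hnt⟩ := π.exists_irreducible_intertwining
  have := hπ.admissible n τ hτ
  have hC : ∀ k v, π.casimir (π.rep k v) = π.rep k (π.casimir v) := fun k v =>
    LinearMap.congr_fun (π.casimir_commute_rep k).eq v
  -- The Casimir operator acts by composition on `Hom_K(τ, E)`, which admissibility makes
  -- finite-dimensional, so it has an eigenvalue there.
  let Ω : Module.End ℂ (τ.IntertwiningMap π.rep) :=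
    { toFun := fun T => (π.casimir ∘ₗ T.toLinearMap).intertwiningMap_of_isIntertwiningMap τ π.rep
        fun k v => by
          simp only [LinearMap.comp_apply, Representation.IntertwiningMap.toLinearMap_apply,
            T.isIntertwining, hC]
      map_add' := fun S T => by
        ext v
        simp
      map_smul' := fun c T => by
        ext v
        simp }
  obtain ⟨c, hc⟩ := Module.End.exists_eigenvalue Ω
  obtain ⟨T, hT⟩ := hc.exists_hasEigenvector
  have hTc : ∀ v, π.casimir (T v) = c • T v := fun v =>
    DFunLike.congr_fun hT.apply_eq_smul v
  obtain ⟨v, hv⟩ : ∃ v, T v ≠ 0 := by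
    by_contra! hcon
    exact hT.2 (DFunLike.ext _ _ hcon)
  refine ⟨c, ?_⟩
  -- The eigenspace for `c` is a submodule and contains a non-zero vector of the image of `T`, so by
  -- irreducibility it is everything.
  have hker := hπ.irreducible (LinearMap.ker (π.casimir - c • (1 : Module.End ℂ E)))
    (fun X e he => ?_) fun k e he => ?_
  · rcases hker with h | h
    · have h1 : T v ∈ LinearMap.ker (π.casimir - c • (1 : Module.End ℂ E)) := by
        simp [hTc]
      rw [h, Submodule.mem_bot] at h1
      exact absurd h1 hv
    · intro e
      have h1 : e ∈ LinearMap.ker (π.casimir - c • (1 : Module.End ℂ E)) := by rw [h]; trivial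
      simpa [sub_eq_zero] using h1
  · simp only [LinearMap.mem_ker, LinearMap.sub_apply, LinearMap.smul_apply, Module.End.one_apply,
      sub_eq_zero] at he ⊢
    have := LinearMap.congr_fun (π.casimir_commute_lie X).eq e
    simp only [Module.End.mul_apply] at this
    rw [this, he, map_smul]
  · simp only [LinearMap.mem_ker, LinearMap.sub_apply, LinearMap.smul_apply, Module.End.one_apply,
      sub_eq_zero] at he ⊢
    rw [hC, he, map_smul]

/-- The rotation generator of `𝔤`. -/
def rotGen : gl2 := Matrix.single 0 1 1 - Matrix.single 1 0 1

/-- The exponentials of the generator lie in `K`. A functional vanishing on the orbit span vanishes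
along the rotated vector, hence on its derivative. This closes the system of differential equations
on the torus. -/
theorem lie_rotGen_mem_orbitSpan {e v : E} (hv : v ∈ π.orbitSpan e) :
    π.lie rotGen v ∈ π.orbitSpan e := by
  have hskew : rotGenᵀ = -rotGen := by
    ext i j; fin_cases i <;> fin_cases j <;> simp [rotGen]
  have hmem : ∀ t : ℝ, NormedSpace.exp (t • rotGen) ∈ Matrix.orthogonalGroup (Fin 2) ℝ := by
    intro t
    rw [Matrix.mem_orthogonalGroup_iff]
    change NormedSpace.exp (t • rotGen) * (NormedSpace.exp (t • rotGen))ᵀ = 1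
    rw [← Matrix.exp_transpose, Matrix.transpose_smul, hskew, smul_neg, Matrix.exp_neg]
    exact Matrix.mul_nonsing_inv _ ((Matrix.isUnit_iff_isUnit_det _).mp (Matrix.isUnit_exp _))
  by_contra hcon
  obtain ⟨l, hl, hlv⟩ := Submodule.exists_le_ker_of_notMem hcon
  have h1 := π.differential rotGen hskew (fun t => ⟨_, hmem t⟩) (fun t => rfl) v l
  have h2 : (fun t : ℝ => l (π.rep ⟨_, hmem t⟩ v)) = fun _ => 0 := by
    funext t
    exact hlv (π.rep_mem_orbitSpan hv _)
  rw [h2] at h1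
  exact hl (h1.unique (hasDerivAt_const 0 (0 : ℂ)))

end GKModule

/-! ### Decay of slowly growing solutions of differential inequalities -/

section Decay

/-- A non-negative solution of `w'' ≥ M² w` that grows more slowly than `exp (M u)` decays like
`exp (-M u)`. -/
theorem exp_decay_of_convex {w w' w'' : ℝ → ℝ} (hw : ∀ u, HasDerivAt w (w' u) u)
    (hw' : ∀ u, HasDerivAt w' (w'' u) u) {M N C u₀ : ℝ} (hM : 0 < M) (hNM : N < M)
    (hconv : ∀ u, u₀ ≤ u → M ^ 2 * w u ≤ w'' u)
    (hgrow : ∀ u, u₀ ≤ u → w u ≤ C * Real.exp (N * u)) :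
    ∃ C', ∀ u, u₀ ≤ u → w u ≤ C' * Real.exp (-(M * u)) := by
  have hexp : ∀ a u : ℝ, HasDerivAt (fun u => Real.exp (a * u)) (Real.exp (a * u) * a) u :=
    fun a u => by simpa using ((hasDerivAt_id u).const_mul a).exp
  -- The operator factors as `w'' - M² w = (d/du - M)(d/du + M) w`; these are the integrating
  -- factors of the two first-order pieces.
  have hq : ∀ u, HasDerivAt (fun u => (w' u + M * w u) * Real.exp (-M * u))
      ((w'' u - M ^ 2 * w u) * Real.exp (-M * u)) u := fun u => by
    have := ((hw' u).fun_add ((hw u).const_mul M)).fun_mul (hexp (-M) u)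
    have e : (w'' u + M * w' u) * Real.exp (-M * u) +
        (w' u + M * w u) * (Real.exp (-M * u) * -M) =
        (w'' u - M ^ 2 * w u) * Real.exp (-M * u) := by ring
    rwa [e] at this
  have hr : ∀ u, HasDerivAt (fun u => w u * Real.exp (M * u))
      ((w' u + M * w u) * Real.exp (M * u)) u := fun u => by
    have := (hw u).fun_mul (hexp M u)
    have e : w' u * Real.exp (M * u) + w u * (Real.exp (M * u) * M) =
        (w' u + M * w u) * Real.exp (M * u) := by ring
    rwa [e] at this
  have hmono : MonotoneOn (fun u => (w' u + M * w u) * Real.exp (-M * u)) (Set.Ici u₀) := by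
    refine monotoneOn_of_deriv_nonneg (convex_Ici _)
      (fun u _ => (hq u).continuousAt.continuousWithinAt)
      (fun u _ => (hq u).differentiableAt.differentiableWithinAt) fun u hu => ?_
    rw [interior_Ici, Set.mem_Ioi] at hu
    rw [(hq u).deriv]
    exact mul_nonneg (sub_nonneg.mpr (hconv u hu.le)) (Real.exp_pos _).le
  -- A positive value at `u₁` would propagate to `w' + M w ≥ κ exp(M u)`; integrating gives growth
  -- of `w` of order `exp(M u)`, against the assumption `N < M`.
  have hneg : ∀ u, u₀ ≤ u → w' u + M * w u ≤ 0 := by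
    intro u₁ hu₁
    by_contra! hpos
    obtain ⟨κ, hκ⟩ : ∃ κ, κ = (w' u₁ + M * w u₁) * Real.exp (-M * u₁) := ⟨_, rfl⟩
    have hκ0 : 0 < κ := hκ ▸ mul_pos hpos (Real.exp_pos _)
    have hlow : ∀ u, u₁ ≤ u → κ * Real.exp (M * u) ≤ w' u + M * w u := by
      intro u hu
      have h1 : κ ≤ (w' u + M * w u) * Real.exp (-M * u) :=
        hκ ▸ hmono hu₁ (hu₁.trans hu) hu
      have h2 := mul_le_mul_of_nonneg_right h1 (Real.exp_pos (M * u)).le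
      rwa [mul_assoc (_ + _), ← Real.exp_add, neg_mul, neg_add_cancel, Real.exp_zero, mul_one] at h2
    have hs : ∀ u, HasDerivAt (fun u => w u * Real.exp (M * u) -
        κ / (2 * M) * Real.exp (2 * M * u)) ((w' u + M * w u) * Real.exp (M * u) -
        κ / (2 * M) * (Real.exp (2 * M * u) * (2 * M))) u := fun u =>
      (hr u).sub ((hexp (2 * M) u).const_mul _)
    have hmono2 : MonotoneOn (fun u => w u * Real.exp (M * u) -
        κ / (2 * M) * Real.exp (2 * M * u)) (Set.Ici u₁) := by
      refine monotoneOn_of_deriv_nonneg (convex_Ici _)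
        (fun u _ => (hs u).continuousAt.continuousWithinAt)
        (fun u _ => (hs u).differentiableAt.differentiableWithinAt) fun u hu => ?_
      rw [interior_Ici, Set.mem_Ioi] at hu
      rw [(hs u).deriv]
      have h1 := mul_le_mul_of_nonneg_right (hlow u hu.le) (Real.exp_pos (M * u)).le
      have h2 : κ / (2 * M) * (Real.exp (2 * M * u) * (2 * M)) =
          κ * Real.exp (M * u) * Real.exp (M * u) := by
        rw [mul_assoc κ, ← Real.exp_add, ← two_mul, ← mul_assoc 2 M u]
        field_simp
      linarith
    set K := w u₁ * Real.exp (M * u₁) - κ / (2 * M) * Real.exp (2 * M * u₁) with hK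
    have hbd : ∀ u, u₁ ≤ u →
        κ / (2 * M) ≤ C * Real.exp (-((M - N) * u)) + -K * Real.exp (-(2 * M * u)) := by
      intro u hu
      have h1 : K ≤ w u * Real.exp (M * u) - κ / (2 * M) * Real.exp (2 * M * u) :=
        hmono2 (Set.mem_Ici.mpr le_rfl) hu hu
      have h2 := mul_le_mul_of_nonneg_right (hgrow u (hu₁.trans hu)) (Real.exp_pos (M * u)).le
      have h3 : κ / (2 * M) * Real.exp (2 * M * u) ≤
          C * Real.exp (N * u) * Real.exp (M * u) - K := by linarith
      have h4 := mul_le_mul_of_nonneg_right h3 (Real.exp_pos (-(2 * M * u))).le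
      rw [mul_assoc, ← Real.exp_add, add_neg_cancel, Real.exp_zero, mul_one, sub_mul, mul_assoc C,
        mul_assoc C, ← Real.exp_add, ← Real.exp_add] at h4
      have e : N * u + M * u + -(2 * M * u) = -((M - N) * u) := by ring
      rw [e] at h4
      linarith
    have hlim : Filter.Tendsto (fun u => C * Real.exp (-((M - N) * u)) +
        -K * Real.exp (-(2 * M * u))) Filter.atTop (𝓝 (C * 0 + -K * 0)) := by
      refine Filter.Tendsto.add (Filter.Tendsto.const_mul _ ?_) (Filter.Tendsto.const_mul _ ?_)
      · exact Real.tendsto_exp_neg_atTop_nhds_zero.comp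
          (Filter.tendsto_id.const_mul_atTop (sub_pos.mpr hNM))
      · exact Real.tendsto_exp_neg_atTop_nhds_zero.comp
          (Filter.tendsto_id.const_mul_atTop (by positivity))
    have := ge_of_tendsto hlim (Filter.eventually_atTop.mpr ⟨u₁, hbd⟩)
    rw [mul_zero, mul_zero, add_zero] at this
    exact absurd this (not_le.mpr (by positivity))
  have hanti : AntitoneOn (fun u => w u * Real.exp (M * u)) (Set.Ici u₀) := by
    refine antitoneOn_of_deriv_nonpos (convex_Ici _)
      (fun u _ => (hr u).continuousAt.continuousWithinAt)
      (fun u _ => (hr u).differentiableAt.differentiableWithinAt) fun u hu => ?_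
    rw [interior_Ici, Set.mem_Ioi] at hu
    rw [(hr u).deriv]
    exact mul_nonpos_of_nonpos_of_nonneg (hneg u hu.le) (Real.exp_pos _).le
  refine ⟨w u₀ * Real.exp (M * u₀), fun u hu => ?_⟩
  have h1 : w u * Real.exp (M * u) ≤ w u₀ * Real.exp (M * u₀) :=
    hanti (Set.mem_Ici.mpr le_rfl) hu hu
  rw [Real.exp_neg, ← div_eq_mul_inv, le_div_iff₀ (Real.exp_pos _)]
  exact h1

/-- Solutions of polynomial growth (in `t = exp u`) of a system
`y'' = a y' + (β² t² + c) y + γ t A y` are rapidly decreasing. -/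
theorem rapid_decay_of_ode {ι : Type*} [Fintype ι] {y y' y'' : ι → ℝ → ℂ}
    (hy : ∀ i u, HasDerivAt (y i) (y' i u) u) (hy' : ∀ i u, HasDerivAt (y' i) (y'' i u) u)
    {a c γ : ℂ} {β : ℝ} (hβ : β ≠ 0) {A : ι → ι → ℂ}
    (hode : ∀ i u, y'' i u = a * y' i u + ((β ^ 2 * Real.exp u ^ 2 : ℝ) : ℂ) * y i u + c * y i u +
      γ * (Real.exp u : ℂ) * ∑ j, A i j * y j u)
    {C : ℝ} {N : ℕ} (hgrow : ∀ i u, 0 ≤ u → ‖y i u‖ ≤ C * Real.exp (N * u)) (M : ℕ) :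
    ∃ C', ∀ i u, 0 ≤ u → ‖y i u‖ ≤ C' * Real.exp (-(M * u)) := by
  -- The sum of squares turns the coupled complex system into one scalar inequality. In `w''` the
  -- first-order term is absorbed into `‖y'‖²` by completing the square, at the cost `‖a‖² / 4`.
  set w : ℝ → ℝ := fun u => ∑ i, ‖y i u‖ ^ 2 with hw
  set w' : ℝ → ℝ := fun u => ∑ i, 2 * inner ℝ (y i u) (y' i u) with hw'
  set w'' : ℝ → ℝ := fun u => ∑ i, 2 * (inner ℝ (y i u) (y'' i u) + inner ℝ (y' i u) (y' i u))
    with hw''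
  have hdw : ∀ u, HasDerivAt w (w' u) u := fun u =>
    HasDerivAt.fun_sum fun i _ => (hy i u).norm_sq
  have hdw' : ∀ u, HasDerivAt w' (w'' u) u := fun u =>
    HasDerivAt.fun_sum fun i _ => ((hy i u).inner ℝ (hy' i u)).const_mul 2
  have hle : ∀ i u, ‖y i u‖ ^ 2 ≤ w u := fun i u =>
    Finset.single_le_sum (f := fun i => ‖y i u‖ ^ 2) (fun i _ => sq_nonneg _) (Finset.mem_univ i)
  have hw0 : ∀ u, 0 ≤ w u := fun u => Finset.sum_nonneg fun i _ => sq_nonneg _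
  set S := ∑ i, ∑ j, ‖A i j‖ with hS
  have hS0 : 0 ≤ S := Finset.sum_nonneg fun i _ => Finset.sum_nonneg fun j _ => norm_nonneg _
  have hlow : ∀ u, 2 * (β ^ 2 * Real.exp u ^ 2 - (‖c‖ + ‖a‖ ^ 2 / 4) - ‖γ‖ * S * Real.exp u) * w u ≤
      w'' u := by
    intro u
    have hcross : ∀ i, ‖y i u‖ * ‖∑ j, A i j * y j u‖ ≤ (∑ j, ‖A i j‖) * w u := by
      intro i
      rw [Finset.sum_mul]
      refine (mul_le_mul_of_nonneg_left (norm_sum_le _ _) (norm_nonneg _)).trans ?_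
      rw [Finset.mul_sum]
      refine Finset.sum_le_sum fun j _ => ?_
      rw [norm_mul]
      have : ‖y i u‖ * ‖y j u‖ ≤ w u := by nlinarith [hle i u, hle j u, sq_nonneg (‖y i u‖ - ‖y j u‖)]
      nlinarith [norm_nonneg (A i j)]
    have hterm : ∀ i, 2 * ((β ^ 2 * Real.exp u ^ 2 - (‖c‖ + ‖a‖ ^ 2 / 4)) * ‖y i u‖ ^ 2 -
        ‖γ‖ * Real.exp u * ((∑ j, ‖A i j‖) * w u)) ≤
        2 * (inner ℝ (y i u) (y'' i u) + inner ℝ (y' i u) (y' i u)) := by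
      intro i
      have habs : ∀ z v : ℂ, -(‖z‖ * ‖v‖) ≤ inner ℝ z v := fun z v =>
        (abs_le.mp (abs_real_inner_le_norm z v)).1
      have h1 := habs (y i u) (a * y' i u)
      have h2 : inner ℝ (y i u) (((β ^ 2 * Real.exp u ^ 2 : ℝ) : ℂ) * y i u) =
          β ^ 2 * Real.exp u ^ 2 * ‖y i u‖ ^ 2 := by
        rw [← Complex.real_smul, real_inner_smul_right, real_inner_self_eq_norm_sq]
      have h3 := habs (y i u) (c * y i u)
      have h4 := habs (y i u) (γ * (Real.exp u : ℂ) * ∑ j, A i j * y j u)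
      have hexp : ‖((Real.exp u : ℝ) : ℂ)‖ = Real.exp u := by
        rw [Complex.norm_real, Real.norm_of_nonneg (Real.exp_pos u).le]
      rw [norm_mul] at h1 h3
      rw [norm_mul, norm_mul, hexp] at h4
      rw [hode, inner_add_right, inner_add_right, inner_add_right, h2, real_inner_self_eq_norm_sq]
      have h5 := mul_le_mul_of_nonneg_left (hcross i)
        (mul_nonneg (norm_nonneg γ) (Real.exp_pos u).le)
      nlinarith [sq_nonneg (‖y' i u‖ - ‖a‖ / 2 * ‖y i u‖)]
    refine le_trans (le_of_eq ?_) (Finset.sum_le_sum fun i _ => hterm i)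
    rw [← Finset.mul_sum, Finset.sum_sub_distrib, ← Finset.mul_sum, ← Finset.mul_sum,
      ← Finset.sum_mul]
    ring
  -- As `w` is quadratic in `y`, decay of rate `2M` is wanted and growth of rate `2N` is given; `M₀`
  -- exceeds both.
  set M₀ : ℝ := 2 * M + 2 * N + 1 with hM₀
  have hM₀pos : 0 < M₀ := by positivity
  -- From `exp u = t₀` on, `β² exp(2u)` dominates the lower-order terms and leaves the coefficient
  -- at least `M₀²`.
  set t₀ := max 1 ((‖γ‖ * S + (‖c‖ + ‖a‖ ^ 2 / 4) + M₀ ^ 2 / 2) / β ^ 2) with ht₀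
  have ht₀1 : 1 ≤ t₀ := le_max_left _ _
  have hβ2 : 0 < β ^ 2 := by positivity
  have hu₀ : 0 ≤ Real.log t₀ := Real.log_nonneg ht₀1
  have hconv : ∀ u, Real.log t₀ ≤ u → M₀ ^ 2 * w u ≤ w'' u := by
    intro u hu
    refine le_trans (mul_le_mul_of_nonneg_right ?_ (hw0 u)) (hlow u)
    have h1 : t₀ ≤ Real.exp u := by
      rwa [← Real.log_le_iff_le_exp (by positivity)]
    have h2 : (‖γ‖ * S + (‖c‖ + ‖a‖ ^ 2 / 4) + M₀ ^ 2 / 2) ≤ β ^ 2 * Real.exp u := by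
      rw [mul_comm (β ^ 2)]
      exact (div_le_iff₀ hβ2).mp ((le_max_right _ _).trans h1)
    have h3 : 1 ≤ Real.exp u := ht₀1.trans h1
    have h4 := mul_le_mul_of_nonneg_right h2 (Real.exp_pos u).le
    have h5 : 0 ≤ ‖c‖ + ‖a‖ ^ 2 / 4 + M₀ ^ 2 / 2 := by positivity
    nlinarith
  obtain ⟨C₁, hC₁⟩ := exp_decay_of_convex hdw hdw' hM₀pos
    (N := 2 * N) (C := Fintype.card ι * C ^ 2) (u₀ := Real.log t₀)
    (by rw [hM₀]; have := Nat.cast_nonneg (α := ℝ) M; linarith) hconv fun u hu => by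
      have h1 : ∀ i, ‖y i u‖ ^ 2 ≤ C ^ 2 * Real.exp (2 * N * u) := fun i => by
        have := pow_le_pow_left₀ (norm_nonneg _) (hgrow i u (hu₀.trans hu)) 2
        rwa [mul_pow, ← Real.exp_nat_mul, Nat.cast_ofNat, ← mul_assoc] at this
      refine (Finset.sum_le_sum fun i _ => h1 i).trans (le_of_eq ?_)
      rw [Finset.sum_const, nsmul_eq_mul, Finset.card_univ, mul_assoc 2]
      ring
  -- The first constant covers `0 ≤ u ≤ log t₀` by the growth bound, the second covers the rest.
  refine ⟨max (|C| * Real.exp ((N + M) * Real.log t₀)) (Real.sqrt |C₁|), fun i u hu => ?_⟩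
  rcases le_total u (Real.log t₀) with hut | hut
  · refine (hgrow i u hu).trans ?_
    have h1 : C * Real.exp (N * u) ≤ |C| * Real.exp ((N + M) * Real.log t₀) *
        Real.exp (-(M * u)) := by
      rw [mul_assoc, ← Real.exp_add]
      refine mul_le_mul (le_abs_self C) (Real.exp_le_exp.mpr ?_) (Real.exp_pos _).le (abs_nonneg C)
      have := mul_le_mul_of_nonneg_left hut (by positivity : (0 : ℝ) ≤ N + M)
      linarith
    exact h1.trans (mul_le_mul_of_nonneg_right (le_max_left _ _) (Real.exp_pos _).le)
  · have h1 : ‖y i u‖ ^ 2 ≤ (Real.sqrt |C₁| * Real.exp (-(M * u))) ^ 2 := by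
      rw [mul_pow, Real.sq_sqrt (abs_nonneg _), ← Real.exp_nat_mul]
      refine (hle i u).trans ((hC₁ u hut).trans ?_)
      refine mul_le_mul (le_abs_self _) (Real.exp_le_exp.mpr ?_) (Real.exp_pos _).le (abs_nonneg _)
      rw [hM₀]
      push_cast
      nlinarith [mul_nonneg (Nat.cast_nonneg (α := ℝ) N) hu]
    have h2 := abs_le_of_sq_le_sq h1 (by positivity)
    rw [abs_norm] at h2
    exact h2.trans (mul_le_mul_of_nonneg_right (le_max_right _ _) (Real.exp_pos _).le)

end Decay

/-! ### The real torus, one-parameter subgroups and compactness of `O(2)` -/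

/-- The diagonal matrix `[exp u, 0; 0, 1]`. -/
noncomputable def torus (u : ℝ) : GL (Fin 2) ℝ := diag (Units.mk0 (Real.exp u) (Real.exp_ne_zero u)) 1

theorem expGL_diagonal (v : Fin 2 → ℝ) (t : ℝ) :
    expGL (diagonal v) t = diag (Units.mk0 (Real.exp (t * v 0)) (Real.exp_ne_zero _))
      (Units.mk0 (Real.exp (t * v 1)) (Real.exp_ne_zero _)) := by
  refine Units.ext ?_
  change NormedSpace.exp (t • diagonal v) = _
  rw [← diagonal_smul, Matrix.exp_diagonal]
  ext i j
  fin_cases i <;> fin_cases j <;> simp [diag, Real.exp_eq_exp_ℝ, Pi.coe_exp]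

theorem torus_mul_expGL (u t : ℝ) : torus u * expGL (single 0 0 1) t = torus (u + t) := by
  have h : (single 0 0 1 : gl2) = diagonal ![1, 0] := by
    ext i j; fin_cases i <;> fin_cases j <;> simp
  rw [h, expGL_diagonal]
  ext i j
  fin_cases i <;> fin_cases j <;>
    simp [torus, diag, Matrix.mul_apply, Fin.sum_univ_two, Real.exp_add]

theorem expGL_upper (t : ℝ) : expGL (single 0 1 1) t = unip t := by
  refine Units.ext ?_
  change NormedSpace.exp (t • (single 0 1 1 : gl2)) = !![1, t; 0, 1]
  have hsq : (t • (single 0 1 1 : gl2)) ^ 2 = 0 := by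
    rw [sq, smul_mul_smul_comm, single_mul_single_of_ne _ _ _ _ (by decide), smul_zero]
  rw [NormedSpace.exp_eq_tsum ℝ]
  change ∑' n : ℕ, ((n.factorial : ℝ)⁻¹ • (t • (single 0 1 1 : gl2)) ^ n) = _
  rw [tsum_eq_sum (s := Finset.range 2) fun n hn => by
    rw [pow_eq_zero_of_le (by simpa [Nat.succ_le_iff] using hn) hsq, smul_zero]]
  ext i j
  fin_cases i <;> fin_cases j <;> simp [Finset.sum_range_succ]

theorem torus_mul_unip (u t : ℝ) : torus u * unip t = unip (Real.exp u * t) * torus u := by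
  ext i j
  fin_cases i <;> fin_cases j <;>
    simp [torus, diag, unip, Matrix.mul_apply, Fin.sum_univ_two]

theorem norm_torus_le {u : ℝ} (hu : 0 ≤ u) :
    ∑ i, ∑ j, (|(torus u : gl2) i j| + |(((torus u)⁻¹ : GL (Fin 2) ℝ) : gl2) i j|) ≤
      4 * Real.exp u := by
  have h1 : 1 ≤ Real.exp u := Real.one_le_exp hu
  have h2 : (Real.exp u)⁻¹ ≤ 1 := inv_le_one_of_one_le₀ h1
  have h3 : (((torus u)⁻¹ : GL (Fin 2) ℝ) : gl2) = !![(Real.exp u)⁻¹, 0; 0, 1] := by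
    change !![_, _; _, _] = _
    simp
  rw [h3]
  simp [torus, diag, Fin.sum_univ_two, abs_of_pos (Real.exp_pos u)]
  linarith

theorem abs_orthogonal_le_one (k : O2) (i j : Fin 2) : |(k : gl2) i j| ≤ 1 :=
  entry_norm_bound_of_unitary k.2 i j

instance : CompactSpace O2 := by
  refine isCompact_iff_compactSpace.mp ?_
  have h : IsCompact (Set.univ.pi fun _ : Fin 2 => Set.univ.pi fun _ : Fin 2 =>
      Set.Icc (-1 : ℝ) 1) :=
    isCompact_univ_pi fun _ => isCompact_univ_pi fun _ => isCompact_Icc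
  refine h.of_isClosed_subset ?_ fun k hk i _ j _ => abs_le.mp (abs_orthogonal_le_one ⟨k, hk⟩ i j)
  have : ((Matrix.orthogonalGroup (Fin 2) ℝ : Submonoid gl2) : Set gl2) =
      {k | k * kᵀ = 1} := by
    ext k
    exact Matrix.mem_orthogonalGroup_iff (Fin 2) ℝ
  change IsClosed ((Matrix.orthogonalGroup (Fin 2) ℝ : Submonoid gl2) : Set gl2)
  rw [this]
  exact isClosed_eq (by fun_prop) continuous_const

/-! ### Lie algebra action on Whittaker functions restricted to the torus -/

namespace GKModule

variable {E : Type*} [AddCommGroup E] [Module ℂ E] {π : GKModule E} {ψ : AddChar ℝ Circle}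

/-- `ℓ` is a `(𝔤, K)`-map into the space of Whittaker functions of moderate growth. -/
structure IsWhittakerMap (π : GKModule E) (ψ : AddChar ℝ Circle)
    (ℓ : E →ₗ[ℂ] (GL (Fin 2) ℝ → ℂ)) : Prop where
  continuous : ∀ e, Continuous (ℓ e)
  growth : ∀ e, ModerateGrowth (ℓ e)
  unip : ∀ e (x : ℝ) g, ℓ e (unip x * g) = (ψ x : ℂ) * ℓ e g
  rep : ∀ e (k : O2) g, ℓ (π.rep k e) g = ℓ e (g * Unitary.toUnits k)
  deriv : ∀ e (X : gl2) g,
    HasDerivAt (fun t : ℝ => ℓ e (g * expGL X t)) (ℓ (π.lie X e) g) 0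

variable {ℓ : E →ₗ[ℂ] (GL (Fin 2) ℝ → ℂ)}

theorem IsWhittakerMap.hasDerivAt_torus (h : IsWhittakerMap π ψ ℓ) (e : E) (u : ℝ) :
    HasDerivAt (fun u => ℓ e (torus u)) (ℓ (π.elem 0 0 e) (torus u)) u := by
  have h1 := h.deriv e (single 0 0 1) (torus u)
  simp only [torus_mul_expGL] at h1
  have h2 := HasDerivAt.comp_sub_const (f := fun t => ℓ e (torus (u + t))) u u (by rwa [sub_self])
  simpa [elem] using h2

/-- Moving `n(t)` to the left of the torus element turns it into `n(exp(u) t)`, so the derivative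
falls on `ψ`. Applied twice, this produces the dominant term `α² exp(2u)` of the differential
equation. -/
theorem IsWhittakerMap.upper_torus (h : IsWhittakerMap π ψ ℓ) {α : ℝ}
    (hα : ∀ x, ((ψ x : Circle) : ℂ) = Complex.exp (Complex.I * (α * x : ℝ))) (e : E) (u : ℝ) :
    ℓ (π.elem 0 1 e) (torus u) = Complex.I * α * (Real.exp u : ℂ) * ℓ e (torus u) := by
  have h1 := h.deriv e (single 0 1 1) (torus u)
  simp only [expGL_upper, torus_mul_unip, h.unip, hα] at h1
  refine h1.unique ?_
  have h2 : HasDerivAt (fun x : ℝ => Complex.exp (Complex.I * α * (Real.exp u : ℂ) * (x : ℂ)))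
      (Complex.exp (Complex.I * α * (Real.exp u : ℂ) * ((0 : ℝ) : ℂ)) *
        (Complex.I * α * (Real.exp u : ℂ) * 1)) 0 :=
    ((Complex.ofRealCLM.hasDerivAt (x := 0)).const_mul _).cexp
  have h3 := h2.mul_const (ℓ e (torus u))
  simp only [Complex.ofReal_zero, mul_zero, Complex.exp_zero, one_mul, mul_one] at h3
  refine h3.congr_of_eventuallyEq (Filter.Eventually.of_forall fun x => ?_)
  simp only [Complex.ofReal_mul, mul_assoc]

/-- The Casimir operator, solved for the square of the derivative along the torus. -/
theorem elem_zero_sq (π : GKModule E) {s c : ℂ} (hs : ∀ e, π.lie 1 e = s • e)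
    (hc : ∀ e, π.casimir e = c • e) (e : E) :
    π.elem 0 0 (π.elem 0 0 e) = (s + 1) • π.elem 0 0 e - π.elem 0 1 (π.elem 0 1 e) +
      π.elem 0 1 (π.lie rotGen e) + ((c - s ^ 2 - s) / 2) • e := by
  have h1 : π.elem 0 0 + π.elem 1 1 = s • (1 : Module.End ℂ E) := by
    ext e
    have := hs e
    rw [lie_eq_sum] at this
    simpa [Fin.sum_univ_two] using this
  have h2 : π.casimir = c • (1 : Module.End ℂ E) := LinearMap.ext fun e => by simp [hc e]
  have h3 : π.lie rotGen = π.elem 0 1 - π.elem 1 0 := by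
    rw [lie_eq_sum]
    simp [Fin.sum_univ_two, rotGen, sub_eq_add_neg]
  have h4 := π.elem_bracket 0 1 1 0
  simp only [if_true] at h4
  simp only [casimir, Fin.sum_univ_two] at h2
  have key : π.elem 0 0 * π.elem 0 0 = (s + 1) • π.elem 0 0 - π.elem 0 1 * π.elem 0 1 +
      π.elem 0 1 * π.lie rotGen + ((c - s ^ 2 - s) / 2) • (1 : Module.End ℂ E) := by
    rw [h3]
    -- The centre eliminates `E₁₁`, the rotation generator eliminates `E₁₀`, and the bracket of
    -- `E₀₁` with `E₁₀` orders their product; the Casimir relation can then be solved for `E₀₀²`.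
    have hD : π.elem 1 1 = s • (1 : Module.End ℂ E) - π.elem 0 0 := by rw [← h1]; abel
    have hCB : π.elem 1 0 * π.elem 0 1 = π.elem 0 1 * π.elem 1 0 - (π.elem 0 0 - π.elem 1 1) := by
      rw [← h4]; abel
    rw [hCB, hD] at h2
    generalize π.elem 0 0 = A at *
    generalize π.elem 0 1 = B at *
    generalize π.elem 1 0 = C at *
    have h5 : (2 : ℂ) • (A * A) = (2 : ℂ) • ((s + 1) • A - B * B + B * (B - C) +
        ((c - s ^ 2 - s) / 2) • (1 : Module.End ℂ E)) := by
      have e1 : (s • (1 : Module.End ℂ E) - A) * (s • (1 : Module.End ℂ E) - A) =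
          (s ^ 2) • (1 : Module.End ℂ E) - (2 * s) • A + A * A := by
        simp only [sub_mul, mul_sub, smul_mul_assoc, mul_smul_comm, one_mul, mul_one]
        module
      have e2 : c • (1 : Module.End ℂ E) = A * A + B * C + (B * C - (A - (s • 1 - A)) +
        ((s ^ 2) • (1 : Module.End ℂ E) - (2 * s) • A + A * A)) := by rw [← h2, ← e1]
      rw [mul_sub]
      have e3 : ((c - s ^ 2 - s) / 2) • (1 : Module.End ℂ E) =
        (2⁻¹ : ℂ) • (c • (1 : Module.End ℂ E)) - ((s ^ 2 + s) / 2) • (1 : Module.End ℂ E) := by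
        module
      rw [e3, e2]
      module
    exact smul_right_injective _ two_ne_zero h5
  exact LinearMap.congr_fun key e

end GKModule

/-! ### Rapid decay and central character of real Whittaker functions -/

namespace GKModule

variable {E : Type*} [AddCommGroup E] [Module ℂ E] {π : GKModule E} {ψ : AddChar ℝ Circle}
  {ℓ : E →ₗ[ℂ] (GL (Fin 2) ℝ → ℂ)}

theorem IsWhittakerMap.exists_torus_growth (h : IsWhittakerMap π ψ ℓ) {ι : Type*} [Fintype ι]
    (f : ι → E) : ∃ (C : ℝ) (N : ℕ), ∀ i u, 0 ≤ u →
      ‖ℓ (f i) (torus u)‖ ≤ C * Real.exp (N * u) := by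
  choose C N hCN using fun i => h.growth (f i)
  refine ⟨∑ i, |C i| * 4 ^ N i, ∑ i, N i, fun i u hu => ?_⟩
  have h1 : C i * (∑ p, ∑ q, (|(torus u : gl2) p q| +
      |(((torus u)⁻¹ : GL (Fin 2) ℝ) : gl2) p q|)) ^ N i ≤ |C i| * (4 * Real.exp u) ^ N i := by
    refine mul_le_mul (le_abs_self _) (pow_le_pow_left₀ ?_ (norm_torus_le hu) _) ?_ (abs_nonneg _)
    · exact Finset.sum_nonneg fun p _ => Finset.sum_nonneg fun q _ => by positivity
    · exact pow_nonneg (Finset.sum_nonneg fun p _ => Finset.sum_nonneg fun q _ => by positivity) _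
  refine (hCN i _).trans (h1.trans ?_)
  rw [mul_pow, ← Real.exp_nat_mul, ← mul_assoc]
  refine mul_le_mul ?_ (Real.exp_le_exp.mpr ?_) (Real.exp_pos _).le
    (Finset.sum_nonneg fun _ _ => by positivity)
  · exact Finset.single_le_sum (f := fun i => |C i| * 4 ^ N i) (fun _ _ => by positivity)
      (Finset.mem_univ i)
  · refine mul_le_mul_of_nonneg_right (Nat.cast_le.mpr ?_) hu
    exact Finset.single_le_sum (f := N) (fun _ _ => Nat.zero_le _) (Finset.mem_univ i)

/-- Whittaker functions decrease rapidly on the Weyl chamber where `ψ` oscillates. -/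
theorem IsWhittakerMap.rapid_decay (h : IsWhittakerMap π ψ ℓ) (hπ : π.IsIrredAdmissible)
    {ω : ℝˣ →* ℂˣ} (hω : π.HasCentralChar ω) (hψ : Continuous ψ) (hψ1 : ψ ≠ 1) (e : E) (M : ℕ) :
    ∃ C : ℝ, ∀ u, 0 ≤ u → ∀ k : O2,
      ‖ℓ e (torus u * Unitary.toUnits k)‖ ≤ C * Real.exp (-(M * u)) := by
  obtain ⟨α, hα0, hα⟩ := exists_eq_exp hψ hψ1
  obtain ⟨c, hc⟩ := hπ.exists_casimir_eq
  obtain ⟨-, s, hs, -⟩ := hω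
  have := π.locally_finite e
  have hfin : FiniteDimensional ℂ (π.orbitSpan e) := this
  -- The orbit span is stable under the rotation generator, with matrix `A`, so the functions of its
  -- basis vectors form a closed finite system.
  let b := Module.finBasis ℂ (π.orbitSpan e)
  let A : Fin _ → Fin _ → ℂ := fun i j => b.repr ⟨_, π.lie_rotGen_mem_orbitSpan (b i).2⟩ j
  have hA : ∀ i, π.lie rotGen (b i) = ∑ j, A i j • (b j : E) := fun i => by
    have h1 := congrArg Subtype.val (b.sum_repr ⟨_, π.lie_rotGen_mem_orbitSpan (b i).2⟩)
    rw [Submodule.coe_sum] at h1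
    exact h1.symm
  have hU : ∀ i u, ℓ (π.elem 0 1 (π.lie rotGen (b i))) (torus u) =
      Complex.I * α * (Real.exp u : ℂ) * ∑ j, A i j * ℓ (b j) (torus u) := fun i u => by
    rw [h.upper_torus hα, hA]
    simp only [map_sum, map_smul, Finset.sum_apply, Pi.smul_apply, smul_eq_mul]
  obtain ⟨C, N, hgrow⟩ := h.exists_torus_growth (fun i => (b i : E))
  obtain ⟨C', hC'⟩ := rapid_decay_of_ode (y := fun i u => ℓ (b i) (torus u))
    (y' := fun i u => ℓ (π.elem 0 0 (b i)) (torus u))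
    (y'' := fun i u => ℓ (π.elem 0 0 (π.elem 0 0 (b i))) (torus u))
    (fun i u => h.hasDerivAt_torus _ u) (fun i u => h.hasDerivAt_torus _ u)
    (a := s + 1) (c := (c - s ^ 2 - s) / 2) (γ := Complex.I * α) hα0 (A := A)
    (fun i u => by
      rw [π.elem_zero_sq hs hc]
      simp only [map_add, map_sub, map_smul, Pi.add_apply, Pi.sub_apply, Pi.smul_apply,
        hU, h.upper_torus hα, smul_eq_mul]
      push_cast
      linear_combination (-(α : ℂ) ^ 2 * (Complex.exp u) ^ 2 * ℓ (b i) (torus u)) * Complex.I_sq)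
    hgrow M
  -- Coordinates of `π.rep k e` are continuous on the compact group `O(2)`; this makes the decay
  -- uniform in `k`.
  have hcoord : ∀ i, ∃ B, ∀ k : O2, ‖b.repr ⟨_, π.rep_mem_orbitSpan (π.mem_orbitSpan e) k⟩ i‖ ≤ B := by
    intro i
    obtain ⟨l, hl⟩ := LinearMap.exists_extend (b.coord i)
    have hl' : ∀ k : O2, b.repr ⟨_, π.rep_mem_orbitSpan (π.mem_orbitSpan e) k⟩ i =
        l (π.rep k e) := fun k => (LinearMap.congr_fun hl
      ⟨_, π.rep_mem_orbitSpan (π.mem_orbitSpan e) k⟩).symm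
    obtain ⟨B, hB⟩ := (isCompact_range (π.continuous e l)).isBounded.exists_norm_le
    exact ⟨B, fun k => by rw [hl']; exact hB _ ⟨k, rfl⟩⟩
  choose B hB using hcoord
  refine ⟨∑ i, B i * C', fun u hu k => ?_⟩
  rw [← h.rep]
  have h1 : π.rep k e =
      ∑ i, b.repr ⟨_, π.rep_mem_orbitSpan (π.mem_orbitSpan e) k⟩ i • (b i : E) := by
    have h1 := congrArg Subtype.val
      (b.sum_repr ⟨_, π.rep_mem_orbitSpan (π.mem_orbitSpan e) k⟩)
    rw [Submodule.coe_sum] at h1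
    exact h1.symm
  rw [h1, map_sum, Finset.sum_apply, Finset.sum_mul]
  refine (norm_sum_le _ _).trans (Finset.sum_le_sum fun i _ => ?_)
  rw [map_smul, Pi.smul_apply, norm_smul, mul_assoc]
  exact mul_le_mul (hB i k) (hC' i u hu) (norm_nonneg _) ((norm_nonneg _).trans (hB i k))

theorem diag_self_comm (z : ℝˣ) (g : GL (Fin 2) ℝ) : diag z z * g = g * diag z z := by
  ext i j
  fin_cases i <;> fin_cases j <;> simp [diag, Matrix.mul_apply, Fin.sum_univ_two, mul_comm]

/-- Positive scalars are exponentials in the centre, along which the function solves `y' = s y`; a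
negative scalar differs from a positive one by `-1 ∈ K`. -/
theorem IsWhittakerMap.central (h : IsWhittakerMap π ψ ℓ) {ω : ℝˣ →* ℂˣ}
    (hω : π.HasCentralChar ω) (e : E) (z : ℝˣ) (g : GL (Fin 2) ℝ) :
    ℓ e (diag z z * g) = (ω z : ℂ) * ℓ e g := by
  obtain ⟨hneg, s, hs, hpos⟩ := hω
  have hexp1 : ∀ r, expGL 1 r = diag (Units.mk0 (Real.exp r) (Real.exp_ne_zero _))
      (Units.mk0 (Real.exp r) (Real.exp_ne_zero _)) := fun r => by
    rw [← diagonal_one, expGL_diagonal]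
    simp
  have hmul : ∀ (r t : ℝ) (g : GL (Fin 2) ℝ), g * expGL 1 r * expGL 1 t = g * expGL 1 (r + t) := by
    intro r t g
    rw [mul_assoc]
    congr 1
    simp only [hexp1]
    ext i j
    fin_cases i <;> fin_cases j <;>
      simp [diag, Matrix.mul_apply, Fin.sum_univ_two, Real.exp_add]
  have hd : ∀ (g : GL (Fin 2) ℝ) (r : ℝ), HasDerivAt (fun r => ℓ e (g * expGL 1 r))
      (s * ℓ e (g * expGL 1 r)) r := fun g r => by
    have h1 := h.deriv e 1 (g * expGL 1 r)
    simp only [hmul, hs, map_smul, Pi.smul_apply, smul_eq_mul] at h1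
    have h2 := HasDerivAt.comp_sub_const (f := fun t => ℓ e (g * expGL 1 (r + t))) r r
      (by rwa [sub_self])
    simpa using h2
  have hp : ∀ z : ℝˣ, 0 < (z : ℝ) → ∀ g, ℓ e (diag z z * g) = (ω z : ℂ) * ℓ e g := by
    intro z hz g
    have hconst : ∀ r : ℝ, Complex.exp (-(s * r)) * ℓ e (g * expGL 1 r) =
        Complex.exp (-(s * (0 : ℝ))) * ℓ e (g * expGL 1 0) := by
      intro r
      have hder : ∀ r : ℝ, HasDerivAt (fun r : ℝ => Complex.exp (-(s * r)) *
          ℓ e (g * expGL 1 r)) 0 r := fun r => by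
        have h1 := (((Complex.ofRealCLM.hasDerivAt (x := r)).const_mul s).fun_neg.cexp).fun_mul
          (hd g r)
        refine h1.congr_deriv ?_
        simp only [Complex.ofRealCLM_apply, Complex.ofReal_one]
        ring
      exact is_const_of_deriv_eq_zero (fun r => (hder r).differentiableAt)
        (fun r => (hder r).deriv) r 0
    have h1 := hconst (Real.log z)
    have h0 : expGL 1 0 = 1 := by
      rw [hexp1]
      ext i j
      fin_cases i <;> fin_cases j <;> simp [diag]
    have hz' : expGL 1 (Real.log z) = diag z z := by
      rw [hexp1]
      have : Units.mk0 (Real.exp (Real.log (z : ℝ))) (Real.exp_ne_zero _) = z :=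
        Units.ext (Real.exp_log hz)
      rw [this]
    rw [h0, hz', mul_one, Complex.ofReal_zero, mul_zero, neg_zero, Complex.exp_zero, one_mul] at h1
    rw [diag_self_comm, hpos z hz, ← h1, ← mul_assoc, ← Complex.exp_add, add_neg_cancel,
      Complex.exp_zero, one_mul]
  rcases lt_or_gt_of_ne z.ne_zero with hz | hz
  · have h0 : (Unitary.toUnits (-1 : O2) : GL (Fin 2) ℝ) = -1 := Units.ext rfl
    have h1 : diag z z * g = diag (-z) (-z) * (g * Unitary.toUnits (-1 : O2)) := by
      have h2 : diag (-z) (-z) = -diag z z := by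
        ext i j
        fin_cases i <;> fin_cases j <;> simp [diag]
      rw [h0, h2, mul_neg, mul_one, neg_mul_neg]
    rw [h1, hp (-z) (by simpa using hz), ← h.rep, hneg, map_smul, Pi.smul_apply, smul_eq_mul,
      ← mul_assoc, ← Units.val_mul, ← map_mul, neg_mul_neg, mul_one]
  · exact hp z hz g

theorem IsWhittakerMap.isWhittaker (h : IsWhittakerMap π ψ ℓ) {ω : ℝˣ →* ℂˣ}
    (hω : π.HasCentralChar ω) (e : E) : IsWhittaker ψ ω (ℓ e) := fun z x g => by
  rw [mul_assoc, h.central hω, h.unip, mul_assoc]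

end GKModule

/-! ### A submultiplicative size on `GL₂(ℝ)` -/

section Size

/-- The sum of the absolute values of the entries of a matrix. -/
def entrySum (A : Matrix (Fin 2) (Fin 2) ℝ) : ℝ := ∑ i, ∑ j, |A i j|

theorem abs_le_entrySum (A : Matrix (Fin 2) (Fin 2) ℝ) (i j : Fin 2) : |A i j| ≤ entrySum A :=
  (Finset.single_le_sum (f := fun j => |A i j|) (fun _ _ => abs_nonneg _) (Finset.mem_univ j)).trans
    (Finset.single_le_sum (f := fun i => ∑ j, |A i j|)
      (fun _ _ => Finset.sum_nonneg fun _ _ => abs_nonneg _) (Finset.mem_univ i))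

theorem entrySum_nonneg (A : Matrix (Fin 2) (Fin 2) ℝ) : 0 ≤ entrySum A :=
  Finset.sum_nonneg fun _ _ => Finset.sum_nonneg fun _ _ => abs_nonneg _

theorem entrySum_mul_le (A B : Matrix (Fin 2) (Fin 2) ℝ) :
    entrySum (A * B) ≤ entrySum A * entrySum B := by
  have h : ∀ i j, |(A * B) i j| ≤ ∑ k, |A i k| * ∑ l, |B l j| := fun i j => by
    rw [Matrix.mul_apply]
    refine (Finset.abs_sum_le_sum_abs _ _).trans (Finset.sum_le_sum fun k _ => ?_)
    rw [abs_mul]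
    exact mul_le_mul_of_nonneg_left (Finset.single_le_sum (f := fun l => |B l j|)
      (fun _ _ => abs_nonneg _) (Finset.mem_univ k)) (abs_nonneg _)
  refine (Finset.sum_le_sum fun i _ => Finset.sum_le_sum fun j _ => h i j).trans (le_of_eq ?_)
  simp only [entrySum, Fin.sum_univ_two]
  ring

/-- The size of an element of `GL₂(ℝ)`. -/
def size (g : GL (Fin 2) ℝ) : ℝ :=
  ∑ i, ∑ j, (|(g : gl2) i j| + |((g⁻¹ : GL (Fin 2) ℝ) : gl2) i j|)

theorem size_eq (g : GL (Fin 2) ℝ) :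
    size g = entrySum g + entrySum ((g⁻¹ : GL (Fin 2) ℝ) : gl2) := by
  simp only [size, entrySum, Finset.sum_add_distrib]

theorem size_inv (g : GL (Fin 2) ℝ) : size g⁻¹ = size g := by
  rw [size_eq, size_eq, inv_inv, add_comm]

theorem size_nonneg (g : GL (Fin 2) ℝ) : 0 ≤ size g := by
  rw [size_eq]
  exact add_nonneg (entrySum_nonneg _) (entrySum_nonneg _)

theorem size_mul_le (g h : GL (Fin 2) ℝ) : size (g * h) ≤ size g * size h := by
  simp only [size_eq, _root_.mul_inv_rev, Units.val_mul]
  have h1 := entrySum_mul_le (g : gl2) h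
  have h2 := entrySum_mul_le ((h⁻¹ : GL (Fin 2) ℝ) : gl2) ((g⁻¹ : GL (Fin 2) ℝ) : gl2)
  have h3 := mul_nonneg (entrySum_nonneg (g : gl2)) (entrySum_nonneg ((h⁻¹ : GL (Fin 2) ℝ) : gl2))
  have h4 := mul_nonneg (entrySum_nonneg ((g⁻¹ : GL (Fin 2) ℝ) : gl2)) (entrySum_nonneg (h : gl2))
  linarith

theorem one_le_size (g : GL (Fin 2) ℝ) : 1 ≤ size g := by
  have h1 := size_mul_le g g⁻¹
  have h2 : size (1 : GL (Fin 2) ℝ) = 4 := by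
    simp [size, Fin.sum_univ_two]
    norm_num
  rw [mul_inv_cancel, size_inv, h2] at h1
  nlinarith [size_nonneg g]

theorem entrySum_orthogonal_le (k : O2) : entrySum (k : gl2) ≤ 4 := by
  have h := abs_orthogonal_le_one k
  simp only [entrySum, Fin.sum_univ_two]
  linarith [h 0 0, h 0 1, h 1 0, h 1 1]

theorem size_toUnits_le (k : O2) : size (Unitary.toUnits k) ≤ 8 := by
  rw [size_eq, ← map_inv]
  have h1 := entrySum_orthogonal_le k
  have h2 := entrySum_orthogonal_le k⁻¹
  simp only [Unitary.val_toUnits_apply]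
  linarith

theorem size_torus_le (u : ℝ) : size (torus u) ≤ 4 * Real.exp |u| := by
  rcases le_total 0 u with hu | hu
  · rw [abs_of_nonneg hu]
    exact norm_torus_le hu
  · have h1 : (torus u)⁻¹ = torus (-u) := by
      refine inv_eq_of_mul_eq_one_right ?_
      ext i j
      fin_cases i <;> fin_cases j <;>
        simp [torus, diag, Matrix.mul_apply, Fin.sum_univ_two, ← Real.exp_add]
    rw [abs_of_nonpos hu, ← size_inv, h1]
    exact norm_torus_le (by linarith)

end Size

/-! ### Polynomial growth of volume -/

section Volume

/-- The size of a pair. -/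
def pairSize (h : DetPairs ℝ) : ℝ := size h.1.1 + size h.1.2

/-- Pairs whose entries, and those of the inverses, are less than `4`. -/
def smallPairs : Set (DetPairs ℝ) :=
  {h | ∀ i j, |(h.1.1 : gl2) i j| < 4 ∧ |((h.1.1⁻¹ : GL (Fin 2) ℝ) : gl2) i j| < 4 ∧
    |(h.1.2 : gl2) i j| < 4 ∧ |((h.1.2⁻¹ : GL (Fin 2) ℝ) : gl2) i j| < 4}

theorem isOpen_smallPairs : IsOpen smallPairs := by
  simp only [smallPairs, Set.ofPred_forall]
  refine isOpen_iInter_of_finite fun i => isOpen_iInter_of_finite fun j => ?_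
  have c1 : Continuous fun h : DetPairs ℝ => h.1.1 := continuous_fst.comp continuous_subtype_val
  have c2 : Continuous fun h : DetPairs ℝ => h.1.2 := continuous_snd.comp continuous_subtype_val
  have c : ∀ f : DetPairs ℝ → GL (Fin 2) ℝ, Continuous f →
      IsOpen {h : DetPairs ℝ | |(f h : gl2) i j| < 4} := fun f hf =>
    isOpen_lt ((Units.continuous_val.comp hf).matrix_elem i j).abs continuous_const
  exact (c _ c1).inter ((c _ c1.inv).inter ((c _ c2).inter (c _ c2.inv)))

theorem smallPairs_subset : smallPairs ⊆ boundedPairs ℝ 4 := fun _ h =>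
  ⟨⟨fun i j => (h i j).1.le, fun i j => (h i j).2.1.le⟩,
    ⟨fun i j => (h i j).2.2.1.le, fun i j => (h i j).2.2.2.le⟩⟩

/-- In `g b⁻¹ = 1 + (g - b) b⁻¹` each entry is a sum of three terms of absolute value at most `1`;
hence the threshold `4` in `smallPairs`. -/
theorem abs_mul_inv_lt {n : ℝ} {g b : GL (Fin 2) ℝ} (hn : 0 < n)
    (hgb : ∀ i j, |(g : gl2) i j - (b : gl2) i j| ≤ n⁻¹) (hb : size b ≤ n) (i j : Fin 2) :
    |((g * b⁻¹ : GL (Fin 2) ℝ) : gl2) i j| < 4 := by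
  have e : ((g * b⁻¹ : GL (Fin 2) ℝ) : gl2) =
      1 + ((g : gl2) - b) * ((b⁻¹ : GL (Fin 2) ℝ) : gl2) := by
    rw [Matrix.sub_mul, Units.mul_inv, Units.val_mul]
    abel
  rw [e, Matrix.add_apply, Matrix.mul_apply, Fin.sum_univ_two]
  have hb' : ∀ i j, |((b⁻¹ : GL (Fin 2) ℝ) : gl2) i j| ≤ n := fun i j => by
    refine (abs_le_entrySum _ i j).trans (le_trans ?_ hb)
    rw [size_eq]
    linarith [entrySum_nonneg (b : gl2)]
  have h1 : |(1 : gl2) i j| ≤ 1 := by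
    rw [Matrix.one_apply]
    split_ifs <;> simp
  have h2 : ∀ k, |((g : gl2) - b) i k * ((b⁻¹ : GL (Fin 2) ℝ) : gl2) k j| ≤ 1 := fun k => by
    rw [abs_mul, Matrix.sub_apply]
    calc _ ≤ n⁻¹ * n := mul_le_mul (hgb i k) (hb' k j) (abs_nonneg _) (by positivity)
      _ = 1 := inv_mul_cancel₀ hn.ne'
  have h3 := abs_add_le ((1 : gl2) i j) (((g : gl2) - b) i 0 * ((b⁻¹ : GL (Fin 2) ℝ) : gl2) 0 j +
    ((g : gl2) - b) i 1 * ((b⁻¹ : GL (Fin 2) ℝ) : gl2) 1 j)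
  have h4 := abs_add_le (((g : gl2) - b) i 0 * ((b⁻¹ : GL (Fin 2) ℝ) : gl2) 0 j)
    (((g : gl2) - b) i 1 * ((b⁻¹ : GL (Fin 2) ℝ) : gl2) 1 j)
  linarith [h2 0, h2 1]

/-- The entries of a pair. -/
def pairEntries (h : DetPairs ℝ) (k i j : Fin 2) : ℝ :=
  if k = 0 then (h.1.1 : gl2) i j else (h.1.2 : gl2) i j

theorem mul_inv_mem_smallPairs {n : ℝ} {h b : DetPairs ℝ} (hn : 0 < n)
    (hhb : ∀ k i j, |pairEntries h k i j - pairEntries b k i j| ≤ n⁻¹)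
    (hh : pairSize h ≤ n) (hb : pairSize b ≤ n) : h * b⁻¹ ∈ smallPairs := by
  have s : ∀ h : DetPairs ℝ, pairSize h ≤ n → size h.1.1 ≤ n ∧ size h.1.2 ≤ n := fun h hh =>
    ⟨by linarith [size_nonneg h.1.2, show size h.1.1 + size h.1.2 ≤ n from hh],
      by linarith [size_nonneg h.1.1, show size h.1.1 + size h.1.2 ≤ n from hh]⟩
  have e1 : ∀ i j, |(h.1.1 : gl2) i j - (b.1.1 : gl2) i j| ≤ n⁻¹ := hhb 0
  have e2 : ∀ i j, |(h.1.2 : gl2) i j - (b.1.2 : gl2) i j| ≤ n⁻¹ := hhb 1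
  have e1' : ∀ i j, |(b.1.1 : gl2) i j - (h.1.1 : gl2) i j| ≤ n⁻¹ := fun i j => by
    rw [abs_sub_comm]; exact e1 i j
  have e2' : ∀ i j, |(b.1.2 : gl2) i j - (h.1.2 : gl2) i j| ≤ n⁻¹ := fun i j => by
    rw [abs_sub_comm]; exact e2 i j
  have i1 : (h * b⁻¹).1.1⁻¹ = b.1.1 * h.1.1⁻¹ := by
    change (h.1.1 * b.1.1⁻¹)⁻¹ = _
    group
  have i2 : (h * b⁻¹).1.2⁻¹ = b.1.2 * h.1.2⁻¹ := by
    change (h.1.2 * b.1.2⁻¹)⁻¹ = _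
    group
  intro i j
  rw [i1, i2]
  exact ⟨abs_mul_inv_lt hn e1 (s b hb).1 i j, abs_mul_inv_lt hn e1' (s h hh).1 i j,
    abs_mul_inv_lt hn e2 (s b hb).2 i j, abs_mul_inv_lt hn e2' (s h hh).2 i j⟩

/-- The volume of the set of points represented by pairs of size at most `n` grows polynomially. -/
theorem exists_measure_pairSize_le {μ : Measure (NHatQuot ℝ)} (hμ : IsInvariantMeasure μ) :
    ∃ K : ENNReal, K ≠ ⊤ ∧ ∀ n : ℕ, 0 < n →
      μ (NHatQuot.mk ℝ '' {h | pairSize h ≤ n}) ≤ ((2 * n ^ 2 + 1) ^ 8 : ℕ) * K := by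
  classical
  have hopen : IsOpen (NHatQuot.mk ℝ '' smallPairs) := NHatQuot.isOpenMap_mk _ isOpen_smallPairs
  refine ⟨μ (NHatQuot.mk ℝ '' smallPairs), ?_, fun n hn => ?_⟩
  · refine ne_of_lt ((measure_mono (Set.image_mono smallPairs_subset)).trans_lt ?_)
    exact hμ.finite_on_compacts _
      ((isCompact_boundedPairs 4).image NHatQuot.isQuotientMap_mk.continuous)
  have hn0 : (0 : ℝ) < n := Nat.cast_pos.mpr hn
  -- A grid of mesh `1/n` on the eight entries: these are at most `n` in absolute value, so each
  -- scaled floor takes one of `2n² + 1` values.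
  let I := Fin 2 → Fin 2 → Fin 2 → Finset.Icc (-(n ^ 2 : ℤ)) (n ^ 2)
  let P : I → DetPairs ℝ → Prop := fun c h => pairSize h ≤ n ∧
    ∀ k i j, ⌊n * pairEntries h k i j⌋ = c k i j
  -- All pairs of an occupied cell lie in the right translate of `smallPairs` by one chosen member;
  -- by invariance every such translate has the same volume.
  let U : I → Set (NHatQuot ℝ) := fun c => if hc : ∃ b, P c b then
    NHatQuot.rightMul ℝ (hc.choose)⁻¹ ⁻¹' (NHatQuot.mk ℝ '' smallPairs) else ∅
  have hU : ∀ c, μ (U c) ≤ μ (NHatQuot.mk ℝ '' smallPairs) := fun c => by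
    by_cases hc : ∃ b, P c b
    · simp only [U, dif_pos hc]
      exact (hμ.invariant _ _ hopen.measurableSet).le
    · simp only [U, dif_neg hc, measure_empty, zero_le]
  have hcover : NHatQuot.mk ℝ '' {h | pairSize h ≤ n} ⊆ ⋃ c, U c := by
    rintro _ ⟨h, hh, rfl⟩
    have hent : ∀ k i j, |pairEntries h k i j| ≤ n := fun k i j => by
      have h1 : size h.1.1 + size h.1.2 ≤ n := hh
      have h2 := size_nonneg h.1.1
      have h3 := size_nonneg h.1.2
      have h4 := entrySum_nonneg ((h.1.1⁻¹ : GL (Fin 2) ℝ) : gl2)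
      have h5 := entrySum_nonneg ((h.1.2⁻¹ : GL (Fin 2) ℝ) : gl2)
      have h6 := abs_le_entrySum (h.1.1 : gl2) i j
      have h7 := abs_le_entrySum (h.1.2 : gl2) i j
      rw [size_eq, size_eq] at h1
      rw [size_eq] at h2 h3
      unfold pairEntries
      split_ifs
      · linarith [entrySum_nonneg (h.1.2 : gl2)]
      · linarith [entrySum_nonneg (h.1.1 : gl2)]
    have hmem : ∀ k i j, ⌊n * pairEntries h k i j⌋ ∈ Finset.Icc (-(n ^ 2 : ℤ)) (n ^ 2) := by
      intro k i j
      obtain ⟨h1, h2⟩ := abs_le.mp (hent k i j)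
      rw [Finset.mem_Icc, Int.le_floor]
      refine ⟨?_, Int.floor_le_iff.mpr ?_⟩
      · push_cast
        nlinarith
      · push_cast
        nlinarith
    let c : I := fun k i j => ⟨_, hmem k i j⟩
    have hc : ∃ b, P c b := ⟨h, hh, fun k i j => rfl⟩
    refine Set.mem_iUnion.mpr ⟨c, ?_⟩
    simp only [U, dif_pos hc]
    refine ⟨h * hc.choose⁻¹, mul_inv_mem_smallPairs hn0 (fun k i j => ?_) hh hc.choose_spec.1, rfl⟩
    have h1 : ⌊n * pairEntries h k i j⌋ = ⌊n * pairEntries hc.choose k i j⌋ :=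
      (hc.choose_spec.2 k i j).symm
    have h2 := (Int.abs_sub_lt_one_of_floor_eq_floor h1).le
    rw [← mul_sub, abs_mul, Nat.abs_cast] at h2
    rwa [← one_div, le_div_iff₀ hn0, mul_comm]
  have hcard : Fintype.card I = (2 * n ^ 2 + 1) ^ 8 := by
    have : Fintype.card (Finset.Icc (-(n ^ 2 : ℤ)) (n ^ 2)) = 2 * n ^ 2 + 1 := by
      rw [Fintype.card_coe, Int.card_Icc]
      have : (n : ℤ) ^ 2 + 1 - -(n : ℤ) ^ 2 = ((2 * n ^ 2 + 1 : ℕ) : ℤ) := by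
        push_cast
        ring
      rw [this, Int.toNat_natCast]
    simp only [I, Fintype.card_pi, this, Finset.prod_const, Finset.card_univ, Fintype.card_fin]
    ring
  calc μ (NHatQuot.mk ℝ '' {h | pairSize h ≤ n}) ≤ ∑ c, μ (U c) :=
        (measure_mono hcover).trans (measure_iUnion_fintype_le _ _)
    _ ≤ ∑ _c : I, μ (NHatQuot.mk ℝ '' smallPairs) := Finset.sum_le_sum fun c _ => hU c
    _ = _ := by rw [Finset.sum_const, Finset.card_univ, hcard, nsmul_eq_mul]

end Volume

/-! ### Integrability from rapid decay -/

section Integrability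

/-- A continuous function on the quotient that decreases rapidly in terms of the size of
representatives is integrable. -/
theorem integrable_of_decay {μ : Measure (NHatQuot ℝ)} (hμ : IsInvariantMeasure μ)
    {Φ : NHatQuot ℝ → ℂ} (hΦ : Continuous Φ) {C : ℝ}
    (hC : ∀ q, ∃ h, NHatQuot.mk ℝ h = q ∧ ‖Φ q‖ * pairSize h ^ 18 ≤ C) : Integrable Φ μ := by
  obtain ⟨K, hK, hvol⟩ := exists_measure_pairSize_le hμ
  have hC0 : 0 ≤ C := by
    obtain ⟨h, -, hh⟩ := hC (NHatQuot.mk ℝ 1)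
    have : 0 ≤ pairSize h := add_nonneg (size_nonneg _) (size_nonneg _)
    exact le_trans (by positivity) hh
  -- Measurable hulls are used because the images themselves need not be known to be measurable; the
  -- measure is unchanged.
  let A : ℕ → Set (NHatQuot ℝ) := fun n =>
    toMeasurable μ (NHatQuot.mk ℝ '' {h | pairSize h ≤ (n + 1 : ℕ)})
  -- Volume grows like `n¹⁶`, so the exponent `18` leaves the summable `n⁻²`. The factor `2¹⁸` comes
  -- from replacing the size by the next integer, at most twice as large.
  let a : ℕ → ℝ := fun n => C * 2 ^ 18 / (n + 1 : ℕ) ^ 18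
  have ha : ∀ n, 0 ≤ a n := fun n => by positivity
  have hbound : ∀ q, ‖Φ q‖ₑ ≤ ∑' n, (A n).indicator (fun _ => ENNReal.ofReal (a n)) q := by
    intro q
    obtain ⟨h, rfl, hh⟩ := hC q
    have hs : 1 ≤ pairSize h := (one_le_size h.1.1).trans
      (le_add_of_nonneg_right (size_nonneg h.1.2))
    set n := ⌊pairSize h⌋₊ with hn
    have hn1 : pairSize h ≤ (n + 1 : ℕ) := by
      push_cast
      exact (Nat.lt_floor_add_one _).le
    have hn2 : ((n + 1 : ℕ) : ℝ) ≤ 2 * pairSize h := by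
      have := Nat.floor_le (zero_le_one.trans hs)
      push_cast
      linarith
    refine le_trans ?_ (ENNReal.le_tsum n)
    rw [Set.indicator_of_mem (subset_toMeasurable μ _ (Set.mem_image_of_mem (NHatQuot.mk ℝ)
      (show h ∈ {h | pairSize h ≤ (n + 1 : ℕ)} from hn1))), ← ofReal_norm]
    refine ENNReal.ofReal_le_ofReal ?_
    rw [le_div_iff₀ (by positivity)]
    calc ‖Φ (NHatQuot.mk ℝ h)‖ * ((n + 1 : ℕ) : ℝ) ^ 18
        ≤ ‖Φ (NHatQuot.mk ℝ h)‖ * (2 * pairSize h) ^ 18 := by gcongr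
      _ = ‖Φ (NHatQuot.mk ℝ h)‖ * pairSize h ^ 18 * 2 ^ 18 := by ring
      _ ≤ C * 2 ^ 18 := by gcongr
  refine ⟨hΦ.measurable.aestronglyMeasurable, ?_⟩
  rw [hasFiniteIntegral_iff_enorm]
  have hsum : Summable fun n : ℕ => C * 2 ^ 18 * 3 ^ 8 * (1 / ((n + 1 : ℕ) : ℝ) ^ 2) :=
    ((summable_nat_add_iff 1).mpr (Real.summable_one_div_nat_pow.mpr one_lt_two)).mul_left _
  have hterm : ∀ n, ENNReal.ofReal (a n) * μ (A n) ≤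
      ENNReal.ofReal (C * 2 ^ 18 * 3 ^ 8 * (1 / ((n + 1 : ℕ) : ℝ) ^ 2)) * K := by
    intro n
    rw [measure_toMeasurable]
    refine (mul_le_mul_right (hvol (n + 1) n.succ_pos) _).trans ?_
    rw [← mul_assoc, ← ENNReal.ofReal_natCast, ← ENNReal.ofReal_mul (ha n)]
    refine mul_le_mul_left (ENNReal.ofReal_le_ofReal ?_) _
    have hx : (1 : ℝ) ≤ (n + 1 : ℕ) := by
      push_cast
      linarith [Nat.cast_nonneg (α := ℝ) n]
    have hcast : (((2 * (n + 1) ^ 2 + 1) ^ 8 : ℕ) : ℝ) = (2 * ((n + 1 : ℕ) : ℝ) ^ 2 + 1) ^ 8 := by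
      push_cast
      rfl
    simp only [a, hcast]
    generalize ((n + 1 : ℕ) : ℝ) = x at hx
    have hx2 : 2 * x ^ 2 + 1 ≤ 3 * x ^ 2 := by nlinarith
    calc C * 2 ^ 18 / x ^ 18 * (2 * x ^ 2 + 1) ^ 8
        ≤ C * 2 ^ 18 / x ^ 18 * (3 * x ^ 2) ^ 8 := by gcongr
      _ = _ := by field_simp
  calc ∫⁻ q, ‖Φ q‖ₑ ∂μ
      ≤ ∫⁻ q, ∑' n, (A n).indicator (fun _ => ENNReal.ofReal (a n)) q ∂μ := lintegral_mono hbound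
    _ = ∑' n, ENNReal.ofReal (a n) * μ (A n) := by
      rw [lintegral_tsum fun n => (measurable_const.indicator
        (measurableSet_toMeasurable _ _)).aemeasurable]
      exact tsum_congr fun n => lintegral_indicator_const (measurableSet_toMeasurable _ _) _
    _ ≤ ∑' n : ℕ, ENNReal.ofReal (C * 2 ^ 18 * 3 ^ 8 * (1 / ((n + 1 : ℕ) : ℝ) ^ 2)) * K :=
      ENNReal.tsum_le_tsum hterm
    _ < ⊤ := by
      rw [ENNReal.tsum_mul_right]
      exact ENNReal.mul_lt_top hsum.tsum_ofReal_lt_top hK.lt_top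

end Integrability

/-! ### The Iwasawa decomposition -/

section Iwasawa

/-- The Iwasawa decomposition of `GL₂(ℝ)`. -/
theorem exists_iwasawa (g : GL (Fin 2) ℝ) : ∃ (z : ℝˣ) (x u : ℝ) (k : O2),
    diag z z * unip x * g = torus u * Unitary.toUnits k := by
  have hD : (g : gl2).det ≠ 0 := ((Matrix.isUnit_iff_isUnit_det _).mp g.isUnit).ne_zero
  obtain ⟨D, hD'⟩ : ∃ D, D = (g : gl2).det := ⟨_, rfl⟩
  rw [← hD'] at hD
  rw [det_fin_two] at hD'
  obtain ⟨a, ha⟩ : ∃ a, a = g 0 0 := ⟨_, rfl⟩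
  obtain ⟨b, hb⟩ : ∃ b, b = g 0 1 := ⟨_, rfl⟩
  obtain ⟨r, hr⟩ : ∃ r, r = g 1 0 := ⟨_, rfl⟩
  obtain ⟨s, hs⟩ : ∃ s, s = g 1 1 := ⟨_, rfl⟩
  have hg : (g : gl2) = !![a, b; r, s] := by
    ext i j; fin_cases i <;> fin_cases j <;> simp [ha, hb, hr, hs]
  have hD' : D = a * s - b * r := by rw [hD', ha, hb, hr, hs]
  have hp : 0 < r ^ 2 + s ^ 2 := by
    rcases eq_or_ne r 0 with h | h
    · rcases eq_or_ne s 0 with h' | h'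
      · exact absurd (by rw [hD', h, h']; ring) hD
      · positivity
    · positivity
  obtain ⟨p, hp0, hpp⟩ : ∃ p, 0 < p ∧ p ^ 2 = r ^ 2 + s ^ 2 :=
    ⟨Real.sqrt (r ^ 2 + s ^ 2), Real.sqrt_pos.mpr hp, Real.sq_sqrt hp.le⟩
  obtain ⟨σ, hσ, hσD⟩ : ∃ σ : ℝ, σ ^ 2 = 1 ∧ 0 < σ * D := by
    rcases lt_or_gt_of_ne hD with h | h
    · exact ⟨-1, by norm_num, by linarith⟩
    · exact ⟨1, by norm_num, by linarith⟩
  -- The bottom row of `k` is the normalised bottom row of `g`; the sign `σ` of the determinant is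
  -- put into `k`, so that the torus entry is positive.
  let k : O2 := ⟨!![σ * s / p, -(σ * r / p); r / p, s / p], by
    rw [Matrix.mem_orthogonalGroup_iff]
    change _ * (!![σ * s / p, -(σ * r / p); r / p, s / p])ᵀ = 1
    ext i j
    fin_cases i <;> fin_cases j <;> simp [Matrix.mul_apply, Fin.sum_univ_two] <;> field_simp
    · linear_combination (r ^ 2 + s ^ 2) * hσ - hpp
    · ring
    · ring
    · linear_combination -hpp⟩
  -- The scalar normalises the bottom row, and the unipotent removes the component of the top row
  -- along it.
  refine ⟨Units.mk0 p⁻¹ (inv_ne_zero hp0.ne'), -((a * r + b * s) / p ^ 2),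
    Real.log (σ * D / p ^ 2), k, ?_⟩
  have hexp : Real.exp (Real.log (σ * D / p ^ 2)) = σ * D / p ^ 2 :=
    Real.exp_log (by positivity)
  refine Units.ext ?_
  simp only [Units.val_mul, hg, Unitary.val_toUnits_apply]
  ext i j
  fin_cases i <;> fin_cases j <;>
    simp [torus, diag, unip, Matrix.mul_apply, Fin.sum_univ_two, k, hexp] <;> field_simp
  · linear_combination a * hpp - s * D * hσ - s * hD'
  · linear_combination b * hpp + r * D * hσ + r * hD'

end Iwasawa

/-! ### The real case -/

section RealCase

theorem entrySum_le {A : Matrix (Fin 2) (Fin 2) ℝ} {R : ℝ} (h : ∀ i j, |A i j| ≤ R) :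
    entrySum A ≤ 4 * R := by
  simp only [entrySum, Fin.sum_univ_two]
  linarith [h 0 0, h 0 1, h 1 0, h 1 1]

/-- Undoing the conjugation by `k` leaves `exp(-u) E`, and each of the two orthogonal factors costs
at most `4`. Bounded `conjNilp` therefore keeps `u` bounded below. -/
theorem exp_neg_le_entrySum (u : ℝ) (k : O2) :
    Real.exp (-u) ≤ 16 * entrySum (conjNilp (torus u * Unitary.toUnits k)) := by
  set g : GL (Fin 2) ℝ := Unitary.toUnits k with hg
  have h1 : (g : gl2) * conjNilp (torus u * g) * ((g⁻¹ : GL (Fin 2) ℝ) : gl2) =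
      (((torus u)⁻¹ : GL (Fin 2) ℝ) : gl2) * !![0, 1; 0, 0] * (torus u : gl2) := by
    rw [conjNilp, _root_.mul_inv_rev, Units.val_mul, Units.val_mul]
    simp only [← Matrix.mul_assoc, Units.mul_inv, Matrix.one_mul]
    rw [Matrix.mul_assoc _ (g : gl2), Units.mul_inv, Matrix.mul_one]
  have h2 : ((g : gl2) * conjNilp (torus u * g) * ((g⁻¹ : GL (Fin 2) ℝ) : gl2)) 0 1 =
      Real.exp (-u) := by
    rw [h1, Real.exp_neg]
    change (!![_, _; _, _] * _ * _ : gl2) 0 1 = _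
    simp [torus, diag, Matrix.mul_apply, Fin.sum_univ_two]
  have h3 := abs_le_entrySum ((g : gl2) * conjNilp (torus u * g) *
    ((g⁻¹ : GL (Fin 2) ℝ) : gl2)) 0 1
  rw [h2, abs_of_pos (Real.exp_pos _)] at h3
  have h4 : entrySum (g : gl2) ≤ 4 := entrySum_orthogonal_le k
  have h5 : entrySum ((g⁻¹ : GL (Fin 2) ℝ) : gl2) ≤ 4 := by
    rw [hg, ← map_inv]
    exact entrySum_orthogonal_le k⁻¹
  calc Real.exp (-u) ≤ _ := h3
    _ ≤ entrySum (g : gl2) * entrySum (conjNilp (torus u * g)) *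
        entrySum ((g⁻¹ : GL (Fin 2) ℝ) : gl2) := (entrySum_mul_le _ _).trans
          (mul_le_mul_of_nonneg_right (entrySum_mul_le _ _) (entrySum_nonneg _))
    _ ≤ 4 * entrySum (conjNilp (torus u * g)) * 4 := by
      have := entrySum_nonneg (conjNilp (torus u * g))
      gcongr
      exact entrySum_nonneg _
    _ = _ := by ring

/-- Bounds for a pair in terms of its image of the base point. -/
theorem pairSize_le_of_iwasawa {h : DetPairs ℝ} {u : ℝ} {k : O2}
    (hk : h.1.2 = torus u * Unitary.toUnits k) {ρ : ℝ}
    (hρ : ρ = 1 + ‖entries (invAct h.1.1 h.1.2 (basePoint ℝ))‖) :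
    pairSize h ≤ 288 * (Real.exp |u| * ρ) ∧ Real.exp (-u) ≤ 256 * ρ ^ 2 := by
  have hρ1 : 1 ≤ ρ := by
    rw [hρ]
    linarith [norm_nonneg (entries (invAct h.1.1 h.1.2 (basePoint ℝ)))]
  set x := invAct h.1.1 h.1.2 (basePoint ℝ) with hx
  have hent : ∀ l i j, |x l i j| ≤ ρ := fun l i j => by
    have := norm_le_norm_entries x l i j
    rw [Real.norm_eq_abs] at this
    linarith
  set a := h.1.1⁻¹ * h.1.2 with ha
  have hdet : GeneralLinearGroup.det a = 1 := det_inv_mul_detPairs h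
  have ha1 : ∀ i j, |(a : gl2) i j| ≤ ρ := fun i j => by
    rw [ha, ← invAct_basePoint_one]
    exact hent 1 i j
  have ha2 : ∀ i j, |((a⁻¹ : GL (Fin 2) ℝ) : gl2) i j| ≤ ρ := fun i j => by
    rw [coe_inv_eq_adjugate hdet]
    fin_cases i <;> fin_cases j <;> simp [ha1]
  have hsa : size a ≤ 8 * ρ := by
    rw [size_eq]
    linarith [entrySum_le ha1, entrySum_le ha2]
  have hs2 : size h.1.2 ≤ 32 * Real.exp |u| := by
    rw [hk]
    refine (size_mul_le _ _).trans ?_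
    calc size (torus u) * size (Unitary.toUnits k) ≤ 4 * Real.exp |u| * 8 :=
          mul_le_mul (size_torus_le u) (size_toUnits_le k) (size_nonneg _) (by positivity)
      _ = _ := by ring
  -- `288 = 32 + 256` adds the bounds for `h₂` and for `h₁ = h₂ a⁻¹`, where `a` contributes `8 ρ`;
  -- in the second bound `256 = 16 · 4 · 4`.
  constructor
  · have h1 : h.1.1 = h.1.2 * a⁻¹ := by
      rw [ha]
      group
    have h2 : size h.1.1 ≤ size h.1.2 * size a := by
      conv_lhs => rw [h1]
      exact (size_mul_le _ _).trans_eq (by rw [size_inv])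
    have h3 : size h.1.2 * size a ≤ 32 * Real.exp |u| * (8 * ρ) :=
      mul_le_mul hs2 hsa (size_nonneg _) (by positivity)
    have h4 : 32 * Real.exp |u| ≤ 32 * Real.exp |u| * ρ :=
      le_mul_of_one_le_right (by positivity) hρ1
    unfold pairSize
    linarith
  · have e : conjNilp h.1.2 = ((a⁻¹ : GL (Fin 2) ℝ) : gl2) * (-x 0) := by
      rw [← neg_conjNilp_invAct, ← ha, ← Matrix.mul_assoc, Units.inv_mul, Matrix.one_mul]
    have h1 : entrySum (-x 0) ≤ 4 * ρ := entrySum_le fun i j => by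
      rw [Matrix.neg_apply, abs_neg]
      exact hent 0 i j
    have h2 : entrySum (conjNilp h.1.2) ≤ 4 * ρ * (4 * ρ) := by
      rw [e]
      exact (entrySum_mul_le _ _).trans
        (mul_le_mul (entrySum_le ha2) h1 (entrySum_nonneg _) (by positivity))
    have h3 := exp_neg_le_entrySum u k
    rw [← hk] at h3
    nlinarith

/-- For `u ≥ 0` the decay of `W` absorbs the powers of `exp u` and that of `φ` the powers of `ρ`.
For `u ≤ 0`, `exp |u|` is itself at most `256 ρ²`, so `φ` absorbs everything, including the moderate
growth of `W`. -/
theorem exists_pairSize_decay {W : GL (Fin 2) ℝ → ℂ} {φ : VSq ℝ → ℂ}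
    (hW : GKModule.ModerateGrowth W)
    (hdecay : ∀ M : ℕ, ∃ C : ℝ, ∀ u, 0 ≤ u → ∀ k : O2,
      ‖W (torus u * Unitary.toUnits k)‖ ≤ C * Real.exp (-(M * u)))
    (hφ : IsRealSchwartz φ) (P : ℕ) :
    ∃ C, ∀ (h : DetPairs ℝ) (u : ℝ) (k : O2), h.1.2 = torus u * Unitary.toUnits k →
      ‖W h.1.2‖ * ‖φ (invAct h.1.1 h.1.2 (basePoint ℝ))‖ * pairSize h ^ P ≤ C := by
  obtain ⟨C₀, N, hC₀⟩ := hW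
  obtain ⟨C₁, hC₁⟩ := hdecay P
  obtain ⟨C₂, hC₂⟩ := hφ.exists_decay P
  -- For `u ≤ 0` the size is at most a constant times `ρ³`, which accounts for the factor `3`.
  obtain ⟨C₃, hC₃⟩ := hφ.exists_decay (3 * (N + P))
  refine ⟨max (288 ^ P * (|C₁| * C₂)) (|C₀| * (288 * 256) ^ (N + P) * C₃), fun h u k hk => ?_⟩
  obtain ⟨ρ, hρ⟩ : ∃ ρ, ρ = 1 + ‖entries (invAct h.1.1 h.1.2 (basePoint ℝ))‖ := ⟨_, rfl⟩
  obtain ⟨h1, h2⟩ := pairSize_le_of_iwasawa hk hρ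
  have hS0 : 0 ≤ pairSize h := add_nonneg (size_nonneg _) (size_nonneg _)
  have hρ0 : 0 ≤ ρ := by rw [hρ]; positivity
  have hφ2 := hC₂ (invAct h.1.1 h.1.2 (basePoint ℝ))
  have hφ3 := hC₃ (invAct h.1.1 h.1.2 (basePoint ℝ))
  rw [← hρ] at hφ2 hφ3
  have hb : 0 ≤ ‖φ (invAct h.1.1 h.1.2 (basePoint ℝ))‖ := norm_nonneg _
  generalize ‖φ (invAct h.1.1 h.1.2 (basePoint ℝ))‖ = b at hφ2 hφ3 hb
  rcases le_total 0 u with hu | hu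
  · refine le_max_of_le_left ?_
    have hw : ‖W h.1.2‖ ≤ |C₁| * Real.exp (-(P * u)) := by
      rw [hk]
      exact (hC₁ u hu k).trans (mul_le_mul_of_nonneg_right (le_abs_self _) (Real.exp_pos _).le)
    rw [abs_of_nonneg hu] at h1
    have he : Real.exp (-(P * u)) * Real.exp u ^ P = 1 := by
      rw [← Real.exp_nat_mul, ← Real.exp_add, neg_add_cancel, Real.exp_zero]
    calc ‖W h.1.2‖ * b * pairSize h ^ P
        ≤ |C₁| * Real.exp (-(P * u)) * b * (288 * (Real.exp u * ρ)) ^ P := by gcongr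
      _ = 288 ^ P * (|C₁| * (ρ ^ P * b)) * (Real.exp (-(P * u)) * Real.exp u ^ P) := by
        rw [mul_pow, mul_pow]; ring
      _ ≤ 288 ^ P * (|C₁| * C₂) := by
        rw [he, mul_one]
        gcongr
  · refine le_max_of_le_right ?_
    have hs : size h.1.2 ≤ pairSize h := le_add_of_nonneg_left (size_nonneg _)
    have hw : ‖W h.1.2‖ ≤ |C₀| * pairSize h ^ N :=
      (hC₀ _).trans (mul_le_mul (le_abs_self _) (pow_le_pow_left₀ (size_nonneg _) hs N)
        (pow_nonneg (size_nonneg _) _) (abs_nonneg _))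
    rw [abs_of_nonpos hu] at h1
    have h3 : pairSize h ≤ 288 * 256 * ρ ^ 3 := by
      refine h1.trans ?_
      calc 288 * (Real.exp (-u) * ρ) ≤ 288 * (256 * ρ ^ 2 * ρ) := by gcongr
        _ = _ := by ring
    calc ‖W h.1.2‖ * b * pairSize h ^ P
        ≤ |C₀| * pairSize h ^ N * b * pairSize h ^ P := by gcongr
      _ = |C₀| * pairSize h ^ (N + P) * b := by rw [pow_add]; ring
      _ ≤ |C₀| * (288 * 256 * ρ ^ 3) ^ (N + P) * b := by gcongr
      _ = |C₀| * (288 * 256) ^ (N + P) * (ρ ^ (3 * (N + P)) * b) := by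
        rw [mul_pow (288 * 256), ← pow_mul]; ring
      _ ≤ |C₀| * (288 * 256) ^ (N + P) * C₃ := by gcongr

theorem realConverges {ψ : AddChar ℝ Circle} (hψ : Continuous ψ) (hψ1 : ψ ≠ 1)
    {E₁ E₂ : Type*} [AddCommGroup E₁] [Module ℂ E₁] [AddCommGroup E₂] [Module ℂ E₂]
    {π₁ : GKModule E₁} {π₂ : GKModule E₂} (hπ₂ : π₂.IsIrredAdmissible)
    {ω₁ ω₂ : ℝˣ →* ℂˣ} (hω₁ : π₁.HasCentralChar ω₁) (hω₂ : π₂.HasCentralChar ω₂)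
    (hω : ω₁ * ω₂ = 1) {W₁ W₂ : GL (Fin 2) ℝ → ℂ} (hW₁ : W₁ ∈ π₁.whittakerModel ψ)
    (hW₂ : W₂ ∈ π₂.whittakerModel ψ) {f : VSq ℝ → ℂ} (hf : IsRealSchwartz f) (g : GSp4 ℝ)
    {m : Measure (VSq ℝ)} (hm : IsSelfDual ψ m) {μ : Measure (NHatQuot ℝ)}
    (hμ : IsInvariantMeasure μ) : ConvergesAbsolutely μ (integrand ψ m W₁ W₂ f g) := by
  obtain ⟨ℓ₁, c₁, g₁, u₁, r₁, d₁, e₁, rfl⟩ := hW₁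
  obtain ⟨ℓ₂, c₂, g₂, u₂, r₂, d₂, e₂, rfl⟩ := hW₂
  have h₁ : π₁.IsWhittakerMap ψ ℓ₁ := ⟨c₁, g₁, u₁, r₁, d₁⟩
  have h₂ : π₂.IsWhittakerMap ψ ℓ₂ := ⟨c₂, g₂, u₂, r₂, d₂⟩
  obtain ⟨φ, hφ, hφe⟩ := (isTestSpace_realSchwartz hψ hψ1 hm.haar).exists_extWeil_eq hm hf g
  have hΦ : integrand ψ m (ℓ₁ e₁) (ℓ₂ e₂) f g = fun h =>
      ℓ₁ e₁ (eps * h.1.1 * diag g.nu 1) * ℓ₂ e₂ h.1.2 *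
        φ (invAct h.1.1 h.1.2 (basePoint ℝ)) := by
    funext h
    rw [integrand, hφe]
  rw [hΦ]
  obtain ⟨Φ, hΦ'⟩ := NHatQuot.exists_lift
    (Φ := fun h : DetPairs ℝ => ℓ₁ e₁ (eps * h.1.1 * diag g.nu 1) * ℓ₂ e₂ h.1.2 *
      φ (invAct h.1.1 h.1.2 (basePoint ℝ))) fun n hn h =>
    (h₁.isWhittaker hω₁ e₁).mul_left_invariant (h₂.isWhittaker hω₂ e₂) hω (diag g.nu 1) φ hn h
  refine ⟨Φ, hΦ', ?_⟩
  have hcont : Continuous Φ := by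
    refine NHatQuot.continuous_of_comp_mk ?_
    simp only [hΦ']
    have p1 : Continuous fun h : DetPairs ℝ => h.1.1 := continuous_fst.comp continuous_subtype_val
    have p2 : Continuous fun h : DetPairs ℝ => h.1.2 := continuous_snd.comp continuous_subtype_val
    exact (((c₁ e₁).comp ((continuous_const.mul p1).mul continuous_const)).mul
      ((c₂ e₂).comp p2)).mul
      (((isTestSpace_realSchwartz hψ hψ1 hm.haar).continuous φ hφ).comp continuous_invAct_basePoint)
  obtain ⟨C₁, N, hC₁⟩ := g₁ e₁
  -- `N` powers of the size pay for the growth of `W₁`; `18` remain for integrability.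
  obtain ⟨C₂, hC₂⟩ := exists_pairSize_decay (g₂ e₂)
    (fun M => h₂.rapid_decay hπ₂ hω₂ hψ hψ1 e₂ M) hφ (N + 18)
  refine integrable_of_decay hμ hcont
    (C := |C₁| * (size eps * size (diag g.nu 1)) ^ N * C₂) fun q => ?_
  obtain ⟨h, rfl⟩ := NHatQuot.mk_surjective q
  -- Multiplying by an element of `NHat` brings `h₂` into the form `torus u · k`, where the decay
  -- estimate applies.
  obtain ⟨z, x, u, k, hk⟩ := exists_iwasawa h.1.2
  let n : DetPairs ℝ := ⟨(diag z z * unip x, diag z z * unip x), rfl⟩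
  have hn : n ∈ NHat ℝ := ⟨z, x, rfl⟩
  refine ⟨n * h, NHatQuot.mk_eq hn h, ?_⟩
  rw [← NHatQuot.mk_eq hn h, hΦ']
  have hd := hC₂ (n * h) u k hk
  generalize n * h = h' at hd
  have hS0 : 0 ≤ pairSize h' := add_nonneg (size_nonneg _) (size_nonneg _)
  have hs : size (eps * h'.1.1 * diag g.nu 1) ≤ size eps * size (diag g.nu 1) * pairSize h' := by
    have hs1 : size h'.1.1 ≤ pairSize h' := le_add_of_nonneg_right (size_nonneg _)
    calc size (eps * h'.1.1 * diag g.nu 1) ≤ size eps * size h'.1.1 * size (diag g.nu 1) :=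
          (size_mul_le _ _).trans
            (mul_le_mul_of_nonneg_right (size_mul_le _ _) (size_nonneg _))
      _ ≤ size eps * pairSize h' * size (diag g.nu 1) := by
        have := size_nonneg (eps : GL (Fin 2) ℝ)
        have := size_nonneg (diag g.nu 1)
        gcongr
      _ = _ := by ring
  have hw : ‖ℓ₁ e₁ (eps * h'.1.1 * diag g.nu 1)‖ ≤
      |C₁| * (size eps * size (diag g.nu 1) * pairSize h') ^ N :=
    (hC₁ _).trans (mul_le_mul (le_abs_self _) (pow_le_pow_left₀ (size_nonneg _) hs N)
      (pow_nonneg (size_nonneg _) _) (abs_nonneg _))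
  have hc : 0 ≤ size (eps : GL (Fin 2) ℝ) * size (diag g.nu 1) :=
    mul_nonneg (size_nonneg _) (size_nonneg _)
  rw [norm_mul, norm_mul]
  generalize size (eps : GL (Fin 2) ℝ) * size (diag g.nu 1) = c at hw hc
  calc ‖ℓ₁ e₁ (eps * h'.1.1 * diag g.nu 1)‖ * ‖ℓ₂ e₂ h'.1.2‖ *
        ‖φ (invAct h'.1.1 h'.1.2 (basePoint ℝ))‖ * pairSize h' ^ 18
      ≤ |C₁| * (c * pairSize h') ^ N * ‖ℓ₂ e₂ h'.1.2‖ *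
        ‖φ (invAct h'.1.1 h'.1.2 (basePoint ℝ))‖ * pairSize h' ^ 18 := by gcongr
    _ = |C₁| * c ^ N * (‖ℓ₂ e₂ h'.1.2‖ * ‖φ (invAct h'.1.1 h'.1.2 (basePoint ℝ))‖ *
        pairSize h' ^ (N + 18)) := by rw [mul_pow, pow_add]; ring
    _ ≤ |C₁| * c ^ N * C₂ := by gcongr

end RealCase

end ThetaWhittaker

theorem mainTheorem10 :
    -- non-archimedean local fields of characteristic zero
    (∀ (F : Type*) [Field F] [ValuativeRel F] [TopologicalSpace F] [IsNonarchimedeanLocalField F]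
        [CharZero F]
        (ψ : AddChar F Circle), Continuous ψ → ψ ≠ 1 →
      ∀ (E₁ E₂ : Type*) [AddCommGroup E₁] [Module ℂ E₁] [AddCommGroup E₂] [Module ℂ E₂]
        (π₁ : Representation ℂ (Matrix.GeneralLinearGroup (Fin 2) F) E₁)
        (π₂ : Representation ℂ (Matrix.GeneralLinearGroup (Fin 2) F) E₂),
        IsIrredAdmissible π₁ → IsIrredAdmissible π₂ →
      ∀ ω₁ ω₂ : Fˣ →* ℂˣ, HasCentralChar π₁ ω₁ → HasCentralChar π₂ ω₂ → ω₁ * ω₂ = 1 →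
      ∀ W₁ ∈ whittakerModel π₁ ψ, ∀ W₂ ∈ whittakerModel π₂ ψ,
      ∀ f : VSq F → ℂ, IsSchwartzBruhat f →
      ∀ g : GSp4 F,
      ∀ m : MeasureTheory.Measure (VSq F), IsSelfDual ψ m →
      ∀ μ : MeasureTheory.Measure (NHatQuot F), IsInvariantMeasure μ →
        ConvergesAbsolutely μ (integrand ψ m W₁ W₂ f g)) ∧
    -- the real field
    (∀ ψ : AddChar ℝ Circle, Continuous ψ → ψ ≠ 1 →
      ∀ (E₁ E₂ : Type*) [AddCommGroup E₁] [Module ℂ E₁] [AddCommGroup E₂] [Module ℂ E₂]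
        (π₁ : GKModule E₁) (π₂ : GKModule E₂),
        π₁.IsIrredAdmissible → π₂.IsIrredAdmissible →
      ∀ ω₁ ω₂ : ℝˣ →* ℂˣ, π₁.HasCentralChar ω₁ → π₂.HasCentralChar ω₂ → ω₁ * ω₂ = 1 →
      ∀ W₁ ∈ π₁.whittakerModel ψ, ∀ W₂ ∈ π₂.whittakerModel ψ,
      ∀ f : VSq ℝ → ℂ, IsRealSchwartz f →
      ∀ g : GSp4 ℝ,
      ∀ m : MeasureTheory.Measure (VSq ℝ), IsSelfDual ψ m →
      ∀ μ : MeasureTheory.Measure (NHatQuot ℝ), IsInvariantMeasure μ →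
        ConvergesAbsolutely μ (integrand ψ m W₁ W₂ f g)) := by
  refine ⟨fun F _ _ _ _ _ =>
    nonarchConverges_of_normed (fun _ _ _ _ => nonarchConverges_normed) F, ?_⟩
  intro _ hψ hψ1 _ _ _ _ _ _ _ _ _ hπ₂ _ _ hω₁ hω₂ hω _ hW₁ _ hW₂ _ hf g _ hm _ hμ
  exact realConverges hψ hψ1 hπ₂ hω₁ hω₂ hω hW₁ hW₂ hf g hm hμ
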